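/- Let $X$ be a metric space of bounded geometry (for every $R$ the closed balls of radius $R$ have uniformly bounded cardinality), let $\Gamma$ be a countable discrete group acting on $X$ from the right, freely, properly and by isometries, and let $H$ be an infinite-dimensional separable Hilbert space. Put $F=\ell^2(\Gamma)\otimes H$, $(R_\gamma v)(\eta)=v(\eta\gamma)$ on $F$, and $\mathcal K=\mathcal K(F)$. *Groupoid.* $G=G(X,\Gamma)=\bigcup_{R\ge 0}\overline{\Delta_R/\Gamma}\subseteq\beta((X\times X)/\Gamma)$, where $\Delta_R=\{(x,y): d(x,y)\le R\}$, with unit space $G^{(0)}=\beta(X/\Gamma)$ and with range, source, inverse and composition the continuous extensions of $r[x,y]=[x]$, $s[x,y]=[y]$, $[x,y]^{-1}=[y,x]$, $[x,y][y,z]=[x,z]$. *Coefficients.* $A=\ell^\infty(X,\mathcal K)^\Gamma$ is the $C^*$-algebra of bounded functions $a:X\to\mathcal K$ with $R_\gamma a(x\gamma)R_\gamma^*=a(x)$ for all $x,\gamma$. It is a $C(\beta(X/\Gamma))$-algebra with fibres $A_\omega=A/C_0(\beta(X/\Gamma)\setminus\{\omega\})A$; evaluation at $y$ identifies $A_{[y]}$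 with $\mathcal K$. The groupoid acts by $\alpha_g:A_{s(g)}\to A_{r(g)}$, $\alpha_g[a]=[b]$ whenever $\|b(x)-a(y)\|\to0$ as $[x,y]\to g$. *Crossed product.* For a continuous compactly supported section $k$ of $s^*A$ over $G$ (so $k(g)\in A_{s(g)}$) and $\omega\in G^{(0)}$ let $\pi_\omega(k)$ be the adjointable operator on the Hilbert $A_\omega$-module $\ell^2(G_\omega)\otimes A_\omega$, $G_\omega=s^{-1}(\omega)$, given by $(\pi_\omega(k)\xi)(g)=\sum_{h\in G_\omega}\alpha_h^{-1}(k(gh^{-1}))\,\xi(h)$. The reduced crossed product $G(X,\Gamma)\ltimes_r\ell^\infty(X,\mathcal K)^\Gamma$ is the completion of the algebra of these sections in the norm $\|k\|_r=\sup_\omega\|\pi_\omega(k)\|$. *Roe algebra.* An equivariant ample $X$-module is an infinite-dimensional separable Hilbert space $E$ with a faithful nondegenerate $*$-representation $\rho$ of $C_0(X)$ and a unitary representation $u$ of $\Gamma$ such that $u_\gamma\rho(f)u_\gamma^*=\rho(f(\,\cdot\,\gamma))$ and $\rho(f)$ is not compact for $f\ne0$. The equivariant Roe algebra $C^*(X)^\Gamma$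 of $E$ is the norm closure of the algebra of bounded operators $T$ on $E$ that have finite propagation ($\rho(f)T\rho(g)=0$ whenever the distance of the supports of $f$ and $g$ exceeds some constant $R$ depending only on $T$), are locally compact ($\rho(f)T$ and $T\rho(f)$ are compact for all $f\in C_0(X)$) and satisfy $u_\gamma Tu_\gamma^*=T$ for all $\gamma$. The standard module is $\ell^2(X)\otimes F=\ell^2(X)\otimes\ell^2(\Gamma)\otimes H$ with multiplication by functions on $X$ and $(u_\gamma\xi)(x)=R_\gamma(\xi(x\gamma))$. Then there is a unique isomorphism of $C^*$-algebras $$\Phi: G(X,\Gamma)\ltimes_r\ell^\infty(X,\mathcal K)^\Gamma\;\xrightarrow{\ \cong\ }\;C^*(X)^\Gamma,$$ the Roe algebra being that of the standard module, which sends each continuous compactly supported section $k$ to the operator on $\ell^2(X)\otimes F$ with the $\mathcal K$-valued kernel $T_k(x,y)=k([x,y])\in A_{[y]}\cong\mathcal K$ (evaluation at $y$). Moreover, every equivariant ample $X$-module $E$ is identified with the standard one by some unitary $W:E\to\ell^2(X)\otimes F$ that intertwines the representations of $C_0(X)$ and of $\Gamma$, and for every such $W$ there is a unique isomorphism $\Phi$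 of the crossed product onto the Roe algebra of $E$ such that $W\Phi(k)W^*$ has the kernel $T_k$ for all such $k$. -/

import Mathlib

open scoped ENNReal NNReal ZeroAtInfty

namespace EquivariantCoarse

section HilbertModule

variable (I : Type*) (B : Type*) [NonUnitalCStarAlgebra B]

theorem summable_of_nonneg_of_le_cstar {I B : Type*} [NonUnitalCStarAlgebra B] [PartialOrder B]
    [StarOrderedRing B] {f g : I → B} (hf : ∀ i, 0 ≤ f i) (hfg : ∀ i, f i ≤ g i)
    (hg : Summable g) : Summable f := by
  rw [summable_iff_vanishing_norm] at hg ⊢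
  intro ε hε
  obtain ⟨s, hs⟩ := hg ε hε
  refine ⟨s, fun t ht => lt_of_le_of_lt ?_ (hs t ht)⟩
  exact CStarAlgebra.norm_le_norm_of_nonneg_of_le (Finset.sum_nonneg fun i _ => hf i)
    (Finset.sum_le_sum fun i _ => hfg i)

/-- Families `ξ : I → B` such that `∑ ξ(i)* ξ(i)` converges in norm. -/
def l2Submodule : Submodule ℂ (I → B) where
  carrier := {ξ | Summable fun i => star (ξ i) * ξ i}
  zero_mem' := by simp
  smul_mem' c ξ hξ := by
    have : (fun i => star ((c • ξ) i) * (c • ξ) i) = fun i => (star c * c) • (star (ξ i) * ξ i) := by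
      ext i; simp [smul_mul_smul_comm]
    simpa only [Set.mem_ofPred_eq, this] using Summable.const_smul (star c * c) hξ
  add_mem' {ξ η} hξ hη := by
    let _ := CStarAlgebra.spectralOrder B
    have _ := CStarAlgebra.spectralOrderedRing B
    refine summable_of_nonneg_of_le_cstar (g := fun i => (2 : ℕ) • (star (ξ i) * ξ i + star (η i) * η i))
      (fun i => star_mul_self_nonneg _) (fun i => ?_) ((hξ.add hη).const_smul 2)
    have h := star_mul_self_nonneg (ξ i - η i)
    rw [← sub_nonneg]
    convert h using 1
    simp only [Pi.add_apply, star_add, star_sub, add_mul, mul_add, sub_mul, mul_sub]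
    abel

/-- The standard Hilbert `B`-module `ℓ²(I) ⊗ B`. -/
def L2 : Type _ := l2Submodule I B

noncomputable instance : AddCommGroup (L2 I B) := inferInstanceAs (AddCommGroup (l2Submodule I B))
noncomputable instance : Module ℂ (L2 I B) := inferInstanceAs (Module ℂ (l2Submodule I B))
instance : CoeFun (L2 I B) (fun _ => I → B) := ⟨fun ξ => ξ.1⟩

variable {I B}

namespace L2

/-- The vector of `ℓ²(I) ⊗ B` given by a square summable family. -/
def mk (f : I → B) (hf : Summable fun i => star (f i) * f i) : L2 I B := ⟨f, hf⟩

@[simp] theorem mk_apply (f : I → B) (hf : Summable fun i => star (f i) * f i) (i : I) :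
    mk f hf i = f i := rfl
@[ext] theorem ext {ξ η : L2 I B} (h : ∀ i, ξ i = η i) : ξ = η := Subtype.ext (funext h)
@[simp] theorem add_apply (ξ η : L2 I B) (i : I) : (ξ + η) i = ξ i + η i := rfl
@[simp] theorem sub_apply (ξ η : L2 I B) (i : I) : (ξ - η) i = ξ i - η i := rfl
@[simp] theorem zero_apply (i : I) : (0 : L2 I B) i = 0 := rfl
@[simp] theorem smul_apply (c : ℂ) (ξ : L2 I B) (i : I) : (c • ξ) i = c • ξ i := rfl

theorem summable_self (ξ : L2 I B) : Summable fun i => star (ξ i) * ξ i := ξ.2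

theorem summable_inner (ξ η : L2 I B) : Summable fun i => star (ξ i) * η i := by
  have h (c : ℂ) := ((ξ + c • η).summable_self.sub ξ.summable_self).sub (c • η).summable_self
  have h1 := h 1
  have hI := (h Complex.I).const_smul (-Complex.I)
  have h2 := (h1.add hI).const_smul (2⁻¹ : ℂ)
  refine h2.congr fun i => ?_
  simp only [one_smul, add_apply, smul_apply, star_add, star_smul, add_mul, mul_add, smul_mul_assoc,
    mul_smul_comm, Complex.star_def, Complex.conj_I, smul_add, smul_sub, smul_smul, neg_mul,
    Complex.I_mul_I, neg_smul, neg_neg]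
  match_scalars <;> (ring_nf; try simp)

/-- The `B`-valued inner product `⟨ξ, η⟩ = ∑ ξ(i)* η(i)`. -/
noncomputable def inner (ξ η : L2 I B) : B := ∑' i, star (ξ i) * η i

instance : SMul Bᵐᵒᵖ (L2 I B) where
  smul b ξ := mk (fun i => ξ i * b.unop) <| by
    have : (fun i => star (ξ i * b.unop) * (ξ i * b.unop)) =
        fun i => star b.unop * (star (ξ i) * ξ i) * b.unop := by
      ext i; simp [mul_assoc]
    rw [this]
    exact (ξ.summable_self.mul_left _).mul_right _

@[simp] theorem op_smul_apply (b : Bᵐᵒᵖ) (ξ : L2 I B) (i : I) : (b • ξ) i = ξ i * b.unop := rfl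

noncomputable instance : Norm (L2 I B) := ⟨fun ξ => √‖inner ξ ξ‖⟩

theorem norm_def (ξ : L2 I B) : ‖ξ‖ = √‖inner ξ ξ‖ := rfl

/-- The Hilbert module structure, in Mathlib's convention, in which a right module over `B` is
a left module over the opposite algebra. -/
@[reducible] noncomputable def cstarModule [PartialOrder Bᵐᵒᵖ] [StarOrderedRing Bᵐᵒᵖ] :
    CStarModule Bᵐᵒᵖ (L2 I B) where
  inner ξ η := MulOpposite.op (inner ξ η)
  inner_add_right {x y z} := by
    simp only [inner, add_apply, mul_add]
    rw [(summable_inner x y).tsum_add (summable_inner x z), MulOpposite.op_add]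
  inner_self_nonneg {x} := by
    rw [inner, ← tsum_op]
    refine tsum_nonneg fun i => ?_
    rw [MulOpposite.op_mul, MulOpposite.op_star]
    exact mul_star_self_nonneg _
  inner_self {x} := by
    rw [MulOpposite.op_eq_zero_iff]
    refine ⟨fun h => ?_, fun h => by simp [h, inner]⟩
    have hs : Summable fun i => MulOpposite.op (star (x i) * x i) := x.summable_self.op
    have h0 : ∀ i, 0 ≤ MulOpposite.op (star (x i) * x i) := fun i => by
      rw [MulOpposite.op_mul, MulOpposite.op_star]
      exact mul_star_self_nonneg _
    have h1 : ∑' i, MulOpposite.op (star (x i) * x i) = 0 := by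
      rw [tsum_op, ← inner, h, MulOpposite.op_zero]
    ext i
    have h2 : MulOpposite.op (star (x i) * x i) ≤ 0 := by
      rw [← h1]
      exact hs.le_tsum i fun j _ => h0 j
    have h3 := le_antisymm h2 (h0 i)
    rw [MulOpposite.op_eq_zero_iff, CStarRing.star_mul_self_eq_zero_iff] at h3
    exact h3
  inner_op_smul_right {a x y} := by
    simp only [inner, op_smul_apply, ← mul_assoc]
    rw [(summable_inner x y).tsum_mul_right, MulOpposite.op_mul, MulOpposite.op_unop]
  inner_smul_right_complex {z x y} := by
    simp only [inner, smul_apply, mul_smul_comm]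
    rw [(summable_inner x y).tsum_const_smul, MulOpposite.op_smul]
  star_inner x y := by
    rw [← MulOpposite.op_star]
    congr 1
    rw [inner, inner, tsum_star]
    simp
  norm_eq_sqrt_norm_inner_self x := rfl

noncomputable instance : NormedAddCommGroup (L2 I B) :=
  let _ := CStarAlgebra.spectralOrder Bᵐᵒᵖ
  have _ := CStarAlgebra.spectralOrderedRing Bᵐᵒᵖ
  let _ : CStarModule Bᵐᵒᵖ (L2 I B) := cstarModule
  NormedAddCommGroup.ofCore (CStarModule.normedSpaceCore Bᵐᵒᵖ)

noncomputable instance : NormedSpace ℂ (L2 I B) :=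
  let _ := CStarAlgebra.spectralOrder Bᵐᵒᵖ
  have _ := CStarAlgebra.spectralOrderedRing Bᵐᵒᵖ
  let _ : CStarModule Bᵐᵒᵖ (L2 I B) := cstarModule
  NormedSpace.ofCore (CStarModule.normedSpaceCore Bᵐᵒᵖ)

theorem norm_sq (ξ : L2 I B) : ‖ξ‖ ^ 2 = ‖inner ξ ξ‖ := Real.sq_sqrt (norm_nonneg _)

theorem norm_inner_le (ξ η : L2 I B) : ‖inner ξ η‖ ≤ ‖ξ‖ * ‖η‖ := by
  let _ := CStarAlgebra.spectralOrder Bᵐᵒᵖ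
  have _ := CStarAlgebra.spectralOrderedRing Bᵐᵒᵖ
  let _ : CStarModule Bᵐᵒᵖ (L2 I B) := cstarModule
  exact CStarModule.norm_inner_le (A := Bᵐᵒᵖ) (L2 I B) (x := ξ) (y := η)

theorem inner_add_right (ξ η ζ : L2 I B) : inner ξ (η + ζ) = inner ξ η + inner ξ ζ := by
  simp only [inner, add_apply, mul_add]
  exact (summable_inner ξ η).tsum_add (summable_inner ξ ζ)

theorem inner_smul_right (c : ℂ) (ξ η : L2 I B) : inner ξ (c • η) = c • inner ξ η := by
  simp only [inner, smul_apply, mul_smul_comm]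
  exact (summable_inner ξ η).tsum_const_smul c

theorem star_inner (ξ η : L2 I B) : star (inner ξ η) = inner η ξ := by
  simp [inner, tsum_star]

theorem inner_sub_right (ξ η ζ : L2 I B) : inner ξ (η - ζ) = inner ξ η - inner ξ ζ := by
  rw [eq_sub_iff_add_eq, ← inner_add_right, sub_add_cancel]

theorem inner_sub_left (ξ η ζ : L2 I B) : inner (ξ - η) ζ = inner ξ ζ - inner η ζ := by
  rw [← star_inner, inner_sub_right, star_sub, star_inner, star_inner]

theorem norm_sum_le (ξ : L2 I B) (s : Finset I) :
    ‖∑ i ∈ s, star (ξ i) * ξ i‖ ≤ ‖ξ‖ ^ 2 := by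
  let _ := CStarAlgebra.spectralOrder B
  have _ := CStarAlgebra.spectralOrderedRing B
  rw [norm_sq]
  exact CStarAlgebra.norm_le_norm_of_nonneg_of_le
    (Finset.sum_nonneg fun i _ => star_mul_self_nonneg _)
    (ξ.summable_self.sum_le_tsum s fun i _ => star_mul_self_nonneg _)

theorem norm_apply_le (ξ : L2 I B) (i : I) : ‖ξ i‖ ≤ ‖ξ‖ := by
  have := norm_sum_le ξ {i}
  rw [Finset.sum_singleton, CStarRing.norm_star_mul_self, ← pow_two] at this
  exact (pow_le_pow_iff_left₀ (norm_nonneg _) (norm_nonneg _) two_ne_zero).1 this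

theorem norm_le_of_sum_le (ξ : L2 I B) {C : ℝ} (hC : 0 ≤ C)
    (h : ∀ s : Finset I, ‖∑ i ∈ s, star (ξ i) * ξ i‖ ≤ C ^ 2) : ‖ξ‖ ≤ C := by
  rw [← pow_le_pow_iff_left₀ (norm_nonneg _) hC two_ne_zero, norm_sq]
  exact le_of_tendsto' ξ.summable_self.hasSum.norm h

/-- Restriction of `ξ` to a finite set. -/
noncomputable def cut (s : Finset I) (f : I → B) : L2 I B :=
  open Classical in
  mk (fun i => if i ∈ s then f i else 0)
    (summable_of_ne_finset_zero (s := s) fun i hi => by simp [hi])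

theorem norm_cut_sq (s : Finset I) (f : I → B) :
    ‖cut s f‖ ^ 2 = ‖∑ i ∈ s, star (f i) * f i‖ := by
  classical
  rw [norm_sq, inner, tsum_eq_sum (s := s) fun i hi => by simp [cut, hi]]
  congr 1
  refine Finset.sum_congr rfl fun i hi => by simp [cut, hi]

theorem cut_add (s : Finset I) (f g : I → B) : cut s (f + g) = cut s f + cut s g := by
  classical
  ext i
  by_cases hi : i ∈ s <;> simp [cut, hi]

instance : CompleteSpace (L2 I B) := by
  refine Metric.complete_of_cauchySeq_tendsto fun u hu => ?_
  have hc : ∀ i, ∃ b, Filter.Tendsto (fun n => u n i) Filter.atTop (nhds b) := fun i => by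
    refine cauchySeq_tendsto_of_complete (Metric.cauchySeq_iff'.2 fun ε hε => ?_)
    obtain ⟨N, hN⟩ := Metric.cauchySeq_iff'.1 hu ε hε
    refine ⟨N, fun n hn => lt_of_le_of_lt ?_ (hN n hn)⟩
    rw [dist_eq_norm, dist_eq_norm]
    exact norm_apply_le (u n - u N) i
  choose x hx using hc
  have key : ∀ ε > 0, ∃ N, ∀ n ≥ N, ∀ s : Finset I,
      ‖∑ i ∈ s, star (u n i - x i) * (u n i - x i)‖ ≤ ε ^ 2 := by
    intro ε hε
    obtain ⟨N, hN⟩ := Metric.cauchySeq_iff.1 hu ε hε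
    refine ⟨N, fun n hn s => ?_⟩
    refine le_of_tendsto (x := Filter.atTop)
      (f := fun m => ‖∑ i ∈ s, star ((u n - u m) i) * (u n - u m) i‖) ?_
      (Filter.eventually_atTop.2 ⟨N, fun m hm => (norm_sum_le (u n - u m) s).trans ?_⟩)
    · refine (tendsto_finsetSum _ fun i _ => ?_).norm
      have : Filter.Tendsto (fun m => (u n - u m) i) Filter.atTop (nhds (u n i - x i)) :=
        tendsto_const_nhds.sub (hx i)
      exact this.star.mul this
    · have := (hN n hn m hm).le
      rw [dist_eq_norm] at this
      exact pow_le_pow_left₀ (norm_nonneg _) this 2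
  have hxs : Summable fun i => star (x i) * x i := by
    rw [summable_iff_vanishing_norm]
    intro ε hε
    obtain ⟨N, hN⟩ := key (√ε / 4) (by positivity)
    obtain ⟨s, hs⟩ := summable_iff_vanishing_norm.1 (u N).summable_self ((√ε / 4) ^ 2) (by positivity)
    refine ⟨s, fun t ht => ?_⟩
    have h1 : ‖cut t (x - (u N).1)‖ ≤ √ε / 4 := by
      rw [← pow_le_pow_iff_left₀ (norm_nonneg _) (by positivity) two_ne_zero, norm_cut_sq]
      have := hN N le_rfl t
      refine le_of_eq_of_le (congrArg norm (Finset.sum_congr rfl fun i _ => ?_)) this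
      rw [Pi.sub_apply, ← neg_sub (u N i) (x i), star_neg, neg_mul_neg]
    have h2 : ‖cut t (u N).1‖ ≤ √ε / 4 := by
      rw [← pow_le_pow_iff_left₀ (norm_nonneg _) (by positivity) two_ne_zero, norm_cut_sq]
      exact (hs t ht).le
    have h3 : ‖cut t x‖ ≤ √ε / 2 := by
      have : cut t x = cut t (x - (u N).1) + cut t (u N).1 := by rw [← cut_add, sub_add_cancel]
      rw [this]
      refine (norm_add_le _ _).trans ?_
      linarith
    rw [← norm_cut_sq]
    calc ‖cut t x‖ ^ 2 ≤ (√ε / 2) ^ 2 := pow_le_pow_left₀ (norm_nonneg _) h3 2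
      _ = ε / 4 := by rw [div_pow, Real.sq_sqrt hε.le]; norm_num
      _ < ε := by linarith
  refine ⟨mk x hxs, Metric.tendsto_atTop.2 fun ε hε => ?_⟩
  obtain ⟨N, hN⟩ := key (ε / 2) (by positivity)
  refine ⟨N, fun n hn => ?_⟩
  rw [dist_eq_norm]
  refine lt_of_le_of_lt (norm_le_of_sum_le _ (by positivity : 0 ≤ ε / 2) fun s => ?_) (half_lt_self hε)
  exact hN n hn s

end L2

variable (I B)

/-- The algebra of adjointable operators on the Hilbert module `ℓ²(I) ⊗ B`. -/
noncomputable def adjointableSubalgebra : Subalgebra ℂ (L2 I B →L[ℂ] L2 I B) where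
  carrier := {T | ∃ S : L2 I B →L[ℂ] L2 I B, ∀ ξ η, L2.inner (T ξ) η = L2.inner ξ (S η)}
  mul_mem' {T T'} := by
    rintro ⟨S, hS⟩ ⟨S', hS'⟩
    exact ⟨S' * S, fun ξ η => by simp [hS, hS']⟩
  one_mem' := ⟨1, fun ξ η => rfl⟩
  add_mem' {T T'} := by
    rintro ⟨S, hS⟩ ⟨S', hS'⟩
    refine ⟨S + S', fun ξ η => ?_⟩
    rw [_root_.add_apply, _root_.add_apply, L2.inner_add_right,
      ← hS, ← hS', ← L2.star_inner, L2.inner_add_right, star_add, L2.star_inner, L2.star_inner]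
  algebraMap_mem' c := by
    refine ⟨algebraMap ℂ _ (star c), fun ξ η => ?_⟩
    rw [Algebra.algebraMap_eq_smul_one, Algebra.algebraMap_eq_smul_one,
      _root_.smul_apply, _root_.smul_apply, L2.inner_smul_right,
      ← L2.star_inner, one_apply_eq_self, one_apply_eq_self,
      L2.inner_smul_right, star_smul, L2.star_inner]

variable {I B}

namespace adjointableSubalgebra

theorem ext_inner {S S' : L2 I B →L[ℂ] L2 I B}
    (h : ∀ ξ η, L2.inner ξ (S η) = L2.inner ξ (S' η)) : S = S' := by
  refine ContinuousLinearMap.ext fun η => sub_eq_zero.1 ?_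
  rw [← norm_eq_zero, ← sq_eq_zero_iff, L2.norm_sq, norm_eq_zero, L2.inner_sub_right, h, sub_self]

theorem inner_swap {T S : L2 I B →L[ℂ] L2 I B}
    (h : ∀ ξ η, L2.inner (T ξ) η = L2.inner ξ (S η)) (ξ η : L2 I B) :
    L2.inner (S ξ) η = L2.inner ξ (T η) := by
  rw [← L2.star_inner, ← h, L2.star_inner]

noncomputable instance : Star (adjointableSubalgebra I B) :=
  ⟨fun T => ⟨T.2.choose, T, inner_swap T.2.choose_spec⟩⟩

theorem inner_star (T : adjointableSubalgebra I B) (ξ η : L2 I B) :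
    L2.inner (T.1 ξ) η = L2.inner ξ ((star T).1 η) := T.2.choose_spec ξ η

theorem star_eq {T : adjointableSubalgebra I B} {S : L2 I B →L[ℂ] L2 I B}
    (h : ∀ ξ η, L2.inner (T.1 ξ) η = L2.inner ξ (S η)) : (star T).1 = S :=
  ext_inner fun ξ η => by rw [← inner_star, h]

noncomputable instance : StarRing (adjointableSubalgebra I B) where
  star_involutive T := Subtype.ext <| star_eq fun ξ η => inner_swap (inner_star T) ξ η
  star_mul T S := Subtype.ext <| star_eq fun ξ η => by
    change L2.inner (T.1 (S.1 ξ)) η = L2.inner ξ ((star S).1 ((star T).1 η))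
    rw [inner_star, inner_star]
  star_add T S := Subtype.ext <| star_eq fun ξ η => by
    change L2.inner (T.1 ξ + S.1 ξ) η = L2.inner ξ ((star T).1 η + (star S).1 η)
    rw [L2.inner_add_right, ← inner_star, ← inner_star, ← L2.star_inner, L2.inner_add_right,
      star_add, L2.star_inner, L2.star_inner]

instance : StarModule ℂ (adjointableSubalgebra I B) where
  star_smul c T := Subtype.ext <| star_eq fun ξ η => by
    change L2.inner (c • T.1 ξ) η = L2.inner ξ (star c • (star T).1 η)
    rw [L2.inner_smul_right, ← inner_star, ← L2.star_inner, L2.inner_smul_right, star_smul,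
      L2.star_inner]

instance : CStarRing (adjointableSubalgebra I B) where
  norm_mul_self_le T := by
    have h : ‖T.1‖ ≤ √‖(star T * T).1‖ := by
      refine ContinuousLinearMap.opNorm_le_bound _ (Real.sqrt_nonneg _) fun ξ => ?_
      rw [← pow_le_pow_iff_left₀ (norm_nonneg _) (by positivity) two_ne_zero, mul_pow,
        Real.sq_sqrt (norm_nonneg _), L2.norm_sq, inner_star]
      calc _ ≤ ‖ξ‖ * ‖(star T * T).1 ξ‖ := L2.norm_inner_le ξ ((star T * T).1 ξ)
        _ ≤ ‖ξ‖ * (‖(star T * T).1‖ * ‖ξ‖) := by gcongr; exact ContinuousLinearMap.le_opNorm _ _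
        _ = _ := by ring
    calc ‖T‖ * ‖T‖ = ‖T.1‖ ^ 2 := (pow_two _).symm
      _ ≤ (√‖(star T * T).1‖) ^ 2 := pow_le_pow_left₀ (norm_nonneg _) h 2
      _ = ‖star T * T‖ := Real.sq_sqrt (norm_nonneg _)

instance : CompleteSpace (adjointableSubalgebra I B) := by
  refine Metric.complete_of_cauchySeq_tendsto fun u hu => ?_
  have h1 : CauchySeq fun n => (u n).1 := hu.map uniformContinuous_subtype_val
  have h2 : CauchySeq fun n => (star (u n)).1 :=
    (hu.map (starₗᵢ ℂ : adjointableSubalgebra I B ≃ₗᵢ⋆[ℂ] adjointableSubalgebra I B).isometry.uniformContinuous).map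
      uniformContinuous_subtype_val
  obtain ⟨T, hT⟩ := cauchySeq_tendsto_of_complete h1
  obtain ⟨S, hS⟩ := cauchySeq_tendsto_of_complete h2
  have cont : ∀ ξ : L2 I B, Continuous (L2.inner ξ) := fun ξ => by
    refine (LipschitzWith.of_dist_le_mul (K := ‖ξ‖₊) fun η ζ => ?_).continuous
    rw [dist_eq_norm, dist_eq_norm, ← L2.inner_sub_right]
    exact L2.norm_inner_le _ _
  have hTS : ∀ ξ η, L2.inner (T ξ) η = L2.inner ξ (S η) := fun ξ η => by
    have a1 : Filter.Tendsto (fun n => (u n).1 ξ) Filter.atTop (nhds (T ξ)) :=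
      ((ContinuousLinearMap.apply ℂ (L2 I B) ξ).continuous.tendsto T).comp hT
    have a2 : Filter.Tendsto (fun n => (star (u n)).1 η) Filter.atTop (nhds (S η)) :=
      ((ContinuousLinearMap.apply ℂ (L2 I B) η).continuous.tendsto S).comp hS
    have b1 := (((cont η).tendsto _).comp a1).star
    have b2 := ((cont ξ).tendsto _).comp a2
    rw [L2.star_inner] at b1
    refine tendsto_nhds_unique b1 (b2.congr fun n => ?_)
    simp only [Function.comp_apply]
    rw [← inner_star, L2.star_inner]
  exact ⟨⟨T, S, hTS⟩, tendsto_subtype_rng.2 hT⟩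

noncomputable instance : CStarAlgebra (adjointableSubalgebra I B) where

end adjointableSubalgebra

variable (I B) in
/-- The C⋆-algebra `ℒ_B(ℓ²(I) ⊗ B)` of adjointable operators. -/
def Adjointable : Type _ := adjointableSubalgebra I B

noncomputable instance : CStarAlgebra (Adjointable I B) :=
  inferInstanceAs (CStarAlgebra (adjointableSubalgebra I B))

end HilbertModule

section HilbertSpace

variable {ι : Type*} {E : Type*} [NormedAddCommGroup E] [InnerProductSpace ℂ E]

/-- `ℓ²(ι; E)`, that is `ℓ²(ι) ⊗ E`. -/
abbrev HilbertSum (ι : Type*) (E : Type*) [NormedAddCommGroup E] [InnerProductSpace ℂ E] : Type _ :=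
  lp (fun _ : ι => E) 2

namespace HilbertSum

theorem memℓp_reindex (e : Equiv.Perm ι) (V : E ≃ₗᵢ[ℂ] E) (ξ : HilbertSum ι E) :
    Memℓp (fun i => V (ξ (e i))) 2 := by
  have h := lp.memℓp ξ
  rw [memℓp_gen_iff (by norm_num)] at h ⊢
  simpa [Function.comp_def] using (e.summable_iff (f := fun i => ‖ξ i‖ ^ (2 : ℝ≥0∞).toReal)).2 h

/-- Reindexing combined with an isometry of the coefficients: `(W ξ)(i) = V (ξ (e i))`. -/
noncomputable def reindexMap (e : Equiv.Perm ι) (V : E ≃ₗᵢ[ℂ] E) :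
    HilbertSum ι E ≃ₗᵢ[ℂ] HilbertSum ι E where
  toFun ξ := ⟨fun i => V (ξ (e i)), memℓp_reindex e V ξ⟩
  invFun ξ := ⟨fun i => V.symm (ξ (e.symm i)), memℓp_reindex e.symm V.symm ξ⟩
  left_inv ξ := by ext i; simp
  right_inv ξ := by ext i; simp
  map_add' ξ η := lp.ext (funext fun i => map_add V (ξ (e i)) (η (e i)))
  map_smul' c ξ := lp.ext (funext fun i => map_smul V c (ξ (e i)))
  norm_map' ξ := by
    rw [lp.norm_eq_tsum_rpow (by norm_num), lp.norm_eq_tsum_rpow (by norm_num)]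
    congr 1
    simpa using e.tsum_eq (fun i => ‖ξ i‖ ^ (2 : ℝ≥0∞).toReal)

@[simp] theorem reindexMap_apply (e : Equiv.Perm ι) (V : E ≃ₗᵢ[ℂ] E)
    (ξ : HilbertSum ι E) (i : ι) : reindexMap e V ξ i = V (ξ (e i)) := rfl

theorem norm_mul_le_of_bound {c : ι → ℂ} {C : ℝ} (hc : ∀ i, ‖c i‖ ≤ C) (ξ : HilbertSum ι E) (i : ι) :
    ‖c i • ξ i‖ ≤ ‖C • ξ i‖ := by
  rw [norm_smul, norm_smul]
  gcongr
  exact (hc i).trans (le_abs_self C)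

theorem memℓp_mul {c : ι → ℂ} {C : ℝ} (hc : ∀ i, ‖c i‖ ≤ C) (ξ : HilbertSum ι E) :
    Memℓp (fun i => c i • ξ i) 2 := by
  have h := lp.memℓp (C • ξ)
  rw [memℓp_gen_iff (by norm_num)] at h ⊢
  refine Summable.of_nonneg_of_le (fun i => by positivity) (fun i => ?_) h
  exact Real.rpow_le_rpow (norm_nonneg _) (norm_mul_le_of_bound hc ξ i) (by norm_num)

/-- Multiplication by a bounded function: `(M ξ)(i) = c(i) ξ(i)`. -/
noncomputable def mulOp (c : ι → ℂ) (C : ℝ) (hc : ∀ i, ‖c i‖ ≤ C) :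
    HilbertSum ι E →L[ℂ] HilbertSum ι E :=
  LinearMap.mkContinuous
    { toFun := fun ξ => ⟨fun i => c i • ξ i, memℓp_mul hc ξ⟩
      map_add' := fun ξ η => lp.ext (funext fun i => smul_add (c i) (ξ i) (η i))
      map_smul' := fun z ξ => lp.ext (funext fun i => smul_comm (c i) z (ξ i)) }
    |C| fun ξ => by
      have h : ‖C • ξ‖ = |C| * ‖ξ‖ := by rw [norm_smul, Real.norm_eq_abs]
      rw [← h]
      have hs := lp.memℓp (C • ξ)
      have hs' := memℓp_mul hc ξ
      rw [memℓp_gen_iff (by norm_num)] at hs hs'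
      rw [lp.norm_eq_tsum_rpow (by norm_num), lp.norm_eq_tsum_rpow (by norm_num)]
      refine Real.rpow_le_rpow (tsum_nonneg fun i => by positivity) ?_ (by norm_num)
      refine hs'.tsum_le_tsum (fun i => ?_) hs
      exact Real.rpow_le_rpow (norm_nonneg _) (norm_mul_le_of_bound hc ξ i) (by norm_num)

@[simp] theorem mulOp_apply (c : ι → ℂ) (C : ℝ) (hc : ∀ i, ‖c i‖ ≤ C) (ξ : HilbertSum ι E) (i : ι) :
    mulOp c C hc ξ i = c i • ξ i := rfl

/-- The representation of `C₀(ι)` on `ℓ²(ι) ⊗ E` by multiplication operators. -/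
noncomputable def mulRep [TopologicalSpace ι] [CompleteSpace E] :
    C₀(ι, ℂ) →⋆ₙₐ[ℂ] (HilbertSum ι E →L[ℂ] HilbertSum ι E) where
  toFun f := mulOp f ‖f‖ fun i => by
    rw [← ZeroAtInftyContinuousMap.norm_toBCF_eq_norm]
    exact f.toBCF.norm_coe_le_norm i
  map_smul' c f := by ext ξ i; simp [smul_smul]
  map_zero' := by ext ξ i; simp
  map_add' f g := by ext ξ i; simp [add_smul]
  map_mul' f g := by ext ξ i; simp [smul_smul]
  map_star' f := by
    rw [ContinuousLinearMap.star_eq_adjoint, ContinuousLinearMap.eq_adjoint_iff]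
    intro ξ η
    rw [lp.inner_eq_tsum, lp.inner_eq_tsum]
    refine tsum_congr fun i => ?_
    simp [inner_smul_left, inner_smul_right]

end HilbertSum

theorem isCompactOperator_star {F : Type*} [NormedAddCommGroup F] [InnerProductSpace ℂ F]
    [CompleteSpace F] {T : F →L[ℂ] F} (hT : IsCompactOperator T) :
    IsCompactOperator (star T : F →L[ℂ] F) := by
  have hc : IsCompactOperator (T * star T : F →L[ℂ] F) := hT.comp_clm (star T)
  have hk := hc.isCompact_closure_image_closedBall
    (f := ((T * star T : F →L[ℂ] F) : F →ₗ[ℂ] F)) 1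
  have htb := hk.totallyBounded.subset subset_closure
  refine (isCompactOperator_iff_isCompact_closure_image_closedBall
    ((star T : F →L[ℂ] F) : F →ₗ[ℂ] F) one_pos).2 ?_
  refine isCompact_iff_totallyBounded_isComplete.2
    ⟨TotallyBounded.closure ?_, isClosed_closure.isComplete⟩
  rw [Metric.totallyBounded_iff]
  intro ε hε
  obtain ⟨t, hts, htf, hcov⟩ := Metric.finite_approx_of_totallyBounded htb (ε ^ 2 / 2) (by positivity)
  obtain ⟨t', ht', htf', rfl⟩ := Set.exists_subset_image_finite_and.1 ⟨t, hts, htf, rfl⟩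
  refine ⟨(star T : F →L[ℂ] F) '' t', htf'.image _, ?_⟩
  rintro _ ⟨x, hx, rfl⟩
  obtain ⟨_, ⟨y, hy, rfl⟩, hxy⟩ := Set.mem_iUnion₂.1 (hcov ⟨x, hx, rfl⟩)
  refine Set.mem_iUnion₂.2 ⟨_, ⟨y, hy, rfl⟩, ?_⟩
  have hy' := ht' hy
  rw [mem_closedBall_zero_iff] at hx hy'
  have hxy' : ‖T ((star T : F →L[ℂ] F) (x - y))‖ < ε ^ 2 / 2 := by
    rw [map_sub, map_sub, ← dist_eq_norm]
    exact hxy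
  have h1 : ‖(star T : F →L[ℂ] F) (x - y)‖ ^ 2 ≤ ‖T ((star T : F →L[ℂ] F) (x - y))‖ * ‖x - y‖ := by
    rw [← inner_self_eq_norm_sq (𝕜 := ℂ)]
    conv_lhs => rw [ContinuousLinearMap.star_eq_adjoint, ContinuousLinearMap.adjoint_inner_right]
    exact (RCLike.re_le_norm _).trans (norm_inner_le_norm _ _)
  have h2 : ‖x - y‖ ≤ 2 := (norm_sub_le _ _).trans (by linarith)
  have h3 : ‖(star T : F →L[ℂ] F) (x - y)‖ ^ 2 < ε ^ 2 := by
    refine h1.trans_lt ?_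
    calc _ ≤ ‖T ((star T : F →L[ℂ] F) (x - y))‖ * 2 := by gcongr
      _ < ε ^ 2 / 2 * 2 := by gcongr
      _ = ε ^ 2 := by ring
  rw [Metric.mem_ball, dist_eq_norm]
  have h4 := lt_of_pow_lt_pow_left₀ 2 hε.le h3
  rwa [map_sub] at h4

end HilbertSpace

section Coefficients

/-- The right regular representation of `Γ` on `ℓ²(Γ) ⊗ H`, `(R_γ v)(η) = v(ηγ)`. -/
noncomputable def rightRegular (Γ H : Type*) [Group Γ] [NormedAddCommGroup H]
    [InnerProductSpace ℂ H] : Γ →* (HilbertSum Γ H ≃ₗᵢ[ℂ] HilbertSum Γ H) where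
  toFun γ := HilbertSum.reindexMap (Equiv.mulRight γ) (LinearIsometryEquiv.refl ℂ H)
  map_one' := by
    refine LinearIsometryEquiv.ext fun v => lp.ext (funext fun η => ?_)
    change v (η * 1) = v η
    rw [mul_one]
  map_mul' γ δ := by
    refine LinearIsometryEquiv.ext fun v => lp.ext (funext fun η => ?_)
    change v (η * (γ * δ)) = v (η * γ * δ)
    rw [mul_assoc]

/-- The orbit space `Y/Γ` of a right action. -/
abbrev Orbits (Γ Y : Type*) [Group Γ] [MulAction Γᵐᵒᵖ Y] : Type _ :=
  MulAction.orbitRel.Quotient Γᵐᵒᵖ Y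

/-- The orbit of a point. -/
def orbit (Γ : Type*) {Y : Type*} [Group Γ] [MulAction Γᵐᵒᵖ Y] (y : Y) : Orbits Γ Y :=
  Quotient.mk'' y

theorem orbit_smul (Γ : Type*) {Y : Type*} [Group Γ] [MulAction Γᵐᵒᵖ Y] (g : Γᵐᵒᵖ) (y : Y) :
    orbit Γ (g • y) = orbit Γ y := Quotient.sound' ⟨g, rfl⟩

variable (X : Type*) {Γ F : Type*} [Group Γ] [MulAction Γᵐᵒᵖ X]
  [NormedAddCommGroup F] [InnerProductSpace ℂ F]

/-- The unitary representation of `Γ` on `ℓ²(X) ⊗ F`, `(u_γ ξ)(x) = R_γ (ξ(xγ))`, for a unitary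
representation `R` of `Γ` on `F`. -/
noncomputable def diagonalRep (R : Γ →* (F ≃ₗᵢ[ℂ] F)) :
    Γ →* (HilbertSum X F ≃ₗᵢ[ℂ] HilbertSum X F) where
  toFun γ := HilbertSum.reindexMap (MulAction.toPerm (MulOpposite.op γ)) (R γ)
  map_one' := by
    refine LinearIsometryEquiv.ext fun v => lp.ext (funext fun x => ?_)
    change R 1 (v (MulOpposite.op (1 : Γ) • x)) = v x
    rw [map_one, MulOpposite.op_one, one_smul]
    rfl
  map_mul' γ δ := by
    refine LinearIsometryEquiv.ext fun v => lp.ext (funext fun x => ?_)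
    change R (γ * δ) (v (MulOpposite.op (γ * δ) • x)) =
      R γ (R δ (v (MulOpposite.op δ • MulOpposite.op γ • x)))
    rw [map_mul, MulOpposite.op_mul, mul_smul]
    rfl

variable [CompleteSpace F]

/-- The C⋆-algebra `ℓ^∞(X, 𝒦(F))^Γ`: bounded families `a` of compact operators on `F` that are
fixed by `Γ`, that is `R_γ a(xγ) R_γ* = a(x)`. -/
noncomputable def coeffSubalgebra (R : Γ →* (F ≃ₗᵢ[ℂ] F)) :
    NonUnitalStarSubalgebra ℂ (lp (fun _ : X => F →L[ℂ] F) ∞) where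
  carrier := {a | (∀ x, IsCompactOperator (a x)) ∧
    ∀ x γ v, R γ (a (MulOpposite.op γ • x) ((R γ).symm v)) = a x v}
  zero_mem' := ⟨fun x => isCompactOperator_zero, fun x γ v => by simp⟩
  add_mem' {a b} ha hb := ⟨fun x => (ha.1 x).add (hb.1 x), fun x γ v => by
    have h1 := ha.2 x γ v
    have h2 := hb.2 x γ v
    simp [h1, h2]⟩
  smul_mem' c a ha := ⟨fun x => (ha.1 x).smul c, fun x γ v => by
    have h1 := ha.2 x γ v
    simp [h1]⟩
  mul_mem' {a b} ha hb := ⟨fun x => (ha.1 x).comp_clm (b x), fun x γ v => by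
    have h1 := ha.2 x γ (b x v)
    have h2 := hb.2 x γ v
    change R γ (a _ (b _ _)) = a x (b x v)
    rw [← h1, ← h2]
    simp⟩
  star_mem' {a} ha := ⟨fun x => isCompactOperator_star (ha.1 x), fun x γ v => by
    refine ext_inner_left ℂ fun w => ?_
    change inner ℂ w (R γ (star (a _) _)) = inner ℂ w (star (a x) v)
    have hR : ∀ (S : F ≃ₗᵢ[ℂ] F) (w z : F), inner ℂ w (S z) = inner ℂ (S.symm w) z :=
      fun S w z => by rw [← S.inner_map_map (S.symm w) z, S.apply_symm_apply]
    have hL : ∀ (S : F ≃ₗᵢ[ℂ] F) (w z : F), inner ℂ (S w) z = inner ℂ w (S.symm z) :=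
      fun S w z => by rw [← S.inner_map_map w (S.symm z), S.apply_symm_apply]
    rw [ContinuousLinearMap.star_eq_adjoint, ContinuousLinearMap.star_eq_adjoint, hR,
      ContinuousLinearMap.adjoint_inner_right, ContinuousLinearMap.adjoint_inner_right,
      ← ha.2 x γ w, hL]⟩

instance (R : Γ →* (F ≃ₗᵢ[ℂ] F)) :
    IsClosed (coeffSubalgebra X R : Set (lp (fun _ : X => F →L[ℂ] F) ∞)) := by
  have hx : ∀ x : X, Continuous fun a : lp (fun _ : X => F →L[ℂ] F) ∞ => a x := fun x => by
    refine (LipschitzWith.of_dist_le_mul (K := 1) fun a b => ?_).continuous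
    rw [dist_eq_norm, dist_eq_norm, NNReal.coe_one, one_mul]
    exact lp.norm_apply_le_norm (by simp) (a - b) x
  have : (coeffSubalgebra X R : Set (lp (fun _ : X => F →L[ℂ] F) ∞)) =
      (⋂ x, {a | IsCompactOperator (a x)}) ∩ ⋂ x, ⋂ γ, ⋂ v, {a | R γ
        (a (MulOpposite.op γ • x) ((R γ).symm v)) = a x v} := by
    ext a
    simp only [Set.mem_inter_iff, Set.mem_iInter]
    rfl
  rw [this]
  refine IsClosed.inter (isClosed_iInter fun x => ?_)
    (isClosed_iInter fun x => isClosed_iInter fun γ => isClosed_iInter fun v => ?_)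
  · exact (isClosed_setOfPred_isCompactOperator (𝕜₁ := ℂ) (𝕜₂ := ℂ) (σ₁₂ := RingHom.id ℂ)
      (M₁ := F) (M₂ := F)).preimage (hx x)
  · refine isClosed_eq ((R γ).continuous.comp ?_) ?_
    · exact (ContinuousLinearMap.apply ℂ _ _).continuous.comp (hx _)
    · exact (ContinuousLinearMap.apply ℂ _ _).continuous.comp (hx _)

/-- `ℓ^∞(X, 𝒦(F))^Γ` as a type. -/
def Coeff (R : Γ →* (F ≃ₗᵢ[ℂ] F)) : Type _ := coeffSubalgebra X R

noncomputable instance (R : Γ →* (F ≃ₗᵢ[ℂ] F)) : NonUnitalCStarAlgebra (Coeff X R) :=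
  inferInstanceAs (NonUnitalCStarAlgebra (coeffSubalgebra X R))

instance (R : Γ →* (F ≃ₗᵢ[ℂ] F)) : CoeFun (Coeff X R) (fun _ => X → F →L[ℂ] F) :=
  ⟨fun a => a.1⟩

variable {X}

namespace Coeff

variable {R : Γ →* (F ≃ₗᵢ[ℂ] F)}

@[ext] theorem ext {a b : Coeff X R} (h : ∀ x, a x = b x) : a = b :=
  Subtype.ext (lp.ext (funext h))
@[simp] theorem add_apply (a b : Coeff X R) (x : X) : (a + b) x = a x + b x := rfl
@[simp] theorem sub_apply (a b : Coeff X R) (x : X) : (a - b) x = a x - b x := rfl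
@[simp] theorem mul_apply (a b : Coeff X R) (x : X) : (a * b) x = a x * b x := rfl
@[simp] theorem zero_apply (x : X) : (0 : Coeff X R) x = 0 := rfl
@[simp] theorem star_apply (a : Coeff X R) (x : X) : (star a) x = star (a x) := rfl
@[simp] theorem smul_apply (c : ℂ) (a : Coeff X R) (x : X) : (c • a) x = c • a x := rfl

theorem norm_apply_le (a : Coeff X R) (x : X) : ‖a x‖ ≤ ‖a‖ :=
  lp.norm_apply_le_norm (by simp) a.1 x

theorem norm_le_of_forall_le (a : Coeff X R) {C : ℝ} (hC : 0 ≤ C) (h : ∀ x, ‖a x‖ ≤ C) : ‖a‖ ≤ C :=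
  lp.norm_le_of_forall_le hC h

/-- The product of `a` with the indicator function of a set of orbits. -/
noncomputable def restrict (V : Set (Orbits Γ X)) (a : Coeff X R) :
    Coeff X R :=
  open Classical in
  ⟨⟨fun x => if orbit Γ x ∈ V then a x else 0, by
    refine memℓp_infty ⟨‖a‖, ?_⟩
    rintro _ ⟨x, rfl⟩
    dsimp only
    split_ifs
    · exact norm_apply_le a x
    · simp⟩, fun x => by
    dsimp only
    split_ifs
    · exact a.2.1 x
    · exact isCompactOperator_zero, fun x γ v => by
    dsimp only
    rw [orbit_smul]
    split_ifs
    · exact a.2.2 x γ v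
    · simp⟩

theorem restrict_apply_of_mem {V : Set (Orbits Γ X)} (a : Coeff X R) {x : X}
    (hx : orbit Γ x ∈ V) : restrict V a x = a x :=
  if_pos hx

theorem restrict_apply_of_notMem {V : Set (Orbits Γ X)} (a : Coeff X R)
    {x : X} (hx : orbit Γ x ∉ V) : restrict V a x = 0 :=
  if_neg hx

end Coeff

end Coefficients

section Fiber

variable {X Γ F : Type*} [Group Γ] [MulAction Γᵐᵒᵖ X]
  [NormedAddCommGroup F] [InnerProductSpace ℂ F] [CompleteSpace F]

/-- The ideal `C₀(β(X/Γ) ∖ {ω}) · A` of `A = ℓ^∞(X, 𝒦(F))^Γ`, where `C(β(X/Γ))` acts by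
`(φ · a)(x) = φ([x]) a(x)`. Here and below, the Stone-Čech compactification of a discrete space
is the space of ultrafilters on it, and `pure` is the inclusion of the discrete space. -/
noncomputable def fiberIdeal (R : Γ →* (F ≃ₗᵢ[ℂ] F)) (ω : Ultrafilter (Orbits Γ X)) :
    Submodule ℂ (Coeff X R) :=
  (Submodule.span ℂ {b : Coeff X R | ∃ φ : C(Ultrafilter (Orbits Γ X), ℂ), φ ω = 0 ∧
    ∃ a : Coeff X R, ∀ x, b x = φ (pure (orbit Γ x)) • a x}).topologicalClosure

/-- The fibre `A_ω = A / C₀(β(X/Γ) ∖ {ω}) A`. -/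
def Fiber (R : Γ →* (F ≃ₗᵢ[ℂ] F)) (ω : Ultrafilter (Orbits Γ X)) : Type _ :=
  Coeff X R ⧸ fiberIdeal R ω

namespace Fiber

variable {R : Γ →* (F ≃ₗᵢ[ℂ] F)} {ω : Ultrafilter (Orbits Γ X)}

instance : IsClosed (fiberIdeal R ω : Set (Coeff X R)) :=
  Submodule.isClosed_topologicalClosure _

noncomputable instance : NormedAddCommGroup (Fiber R ω) :=
  inferInstanceAs (NormedAddCommGroup (Coeff X R ⧸ fiberIdeal R ω))

noncomputable instance : NormedSpace ℂ (Fiber R ω) :=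
  inferInstanceAs (NormedSpace ℂ (Coeff X R ⧸ fiberIdeal R ω))

instance : CompleteSpace (Fiber R ω) :=
  inferInstanceAs (CompleteSpace (Coeff X R ⧸ fiberIdeal R ω))

variable (R ω) in
/-- The quotient map `A → A_ω`. -/
noncomputable def mk : Coeff X R →ₗ[ℂ] Fiber R ω := (fiberIdeal R ω).mkQ

theorem mk_surjective : Function.Surjective (mk R ω) := Submodule.mkQ_surjective _

theorem mk_eq_zero_iff {a : Coeff X R} : mk R ω a = 0 ↔ a ∈ fiberIdeal R ω :=
  Submodule.Quotient.mk_eq_zero _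

theorem mk_eq_mk_iff {a b : Coeff X R} : mk R ω a = mk R ω b ↔ a - b ∈ fiberIdeal R ω :=
  Submodule.Quotient.eq _

theorem norm_mk_le (a : Coeff X R) : ‖mk R ω a‖ ≤ ‖a‖ := Submodule.Quotient.norm_mk_le _ a

theorem exists_of_mem {a : Coeff X R} (ha : a ∈ fiberIdeal R ω) {ε : ℝ} (hε : 0 < ε) :
    ∃ V ∈ ω, ∀ x, orbit Γ x ∈ V → ‖a x‖ ≤ ε := by
  have hspan : ∀ b ∈ Submodule.span ℂ {b : Coeff X R | ∃ φ : C(Ultrafilter (Orbits Γ X), ℂ), φ ω = 0 ∧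
      ∃ a : Coeff X R, ∀ x, b x = φ (pure (orbit Γ x)) • a x},
      ∀ ε > 0, ∃ V ∈ ω, ∀ x, orbit Γ x ∈ V → ‖b x‖ ≤ ε := by
    intro b hb
    induction hb using Submodule.span_induction with
    | mem b hb =>
      obtain ⟨φ, hφ, a, hab⟩ := hb
      intro ε hε
      have h1 : Filter.Tendsto (fun z => φ (pure z)) (ω : Filter (Orbits Γ X)) (nhds 0) := by
        rw [← hφ]
        exact (φ.continuous.tendsto ω).comp (Ultrafilter.tendsto_pure_self ω)
      have hp : 0 < ε / (‖a‖ + 1) := by positivity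
      refine ⟨_, h1 (Metric.ball_mem_nhds 0 hp), fun x hx => ?_⟩
      have hx' : ‖φ (pure (orbit Γ x))‖ < ε / (‖a‖ + 1) := mem_ball_zero_iff.1 hx
      rw [hab, norm_smul]
      calc _ ≤ ε / (‖a‖ + 1) * (‖a‖ + 1) := by
            gcongr
            exact (a.norm_apply_le x).trans (by linarith)
        _ = ε := by field_simp
    | zero => exact fun ε hε => ⟨Set.univ, Filter.univ_mem, fun x _ => by simpa using hε.le⟩
    | add b c _ _ hb hc =>
      intro ε hε
      obtain ⟨V, hV, h1⟩ := hb (ε / 2) (by positivity)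
      obtain ⟨W, hW, h2⟩ := hc (ε / 2) (by positivity)
      refine ⟨V ∩ W, Filter.inter_mem hV hW, fun x hx => ?_⟩
      rw [Coeff.add_apply]
      refine (norm_add_le _ _).trans ?_
      linarith [h1 x hx.1, h2 x hx.2]
    | smul c b _ hb =>
      intro ε hε
      obtain ⟨V, hV, h1⟩ := hb (ε / (‖c‖ + 1)) (by positivity)
      refine ⟨V, hV, fun x hx => ?_⟩
      rw [Coeff.smul_apply, norm_smul]
      calc _ ≤ (‖c‖ + 1) * (ε / (‖c‖ + 1)) := by
            gcongr
            · linarith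
            · exact h1 x hx
        _ = ε := by field_simp
  obtain ⟨b, hb, hab⟩ := Metric.mem_closure_iff.1 ha (ε / 2) (by positivity)
  obtain ⟨V, hV, h1⟩ := hspan b hb (ε / 2) (by positivity)
  refine ⟨V, hV, fun x hx => ?_⟩
  have h2 : ‖(a - b) x‖ ≤ ε / 2 := by
    rw [dist_eq_norm] at hab
    exact ((a - b).norm_apply_le x).trans hab.le
  have h3 : a x = (a - b) x + b x := by simp
  rw [h3]
  refine (norm_add_le _ _).trans ?_
  linarith [h1 x hx]

theorem sub_restrict_mem {V : Set (Orbits Γ X)} (hV : V ∈ ω) (a : Coeff X R) :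
    a - Coeff.restrict V a ∈ fiberIdeal R ω := by
  classical
  refine Submodule.le_topologicalClosure _ (Submodule.subset_span ?_)
  have hcl : IsClopen {u : Ultrafilter (Orbits Γ X) | V ∈ u} :=
    ⟨ultrafilter_isClosed_basic V, ultrafilter_isOpen_basic V⟩
  refine ⟨⟨fun u => if V ∈ u then 0 else 1, ?_⟩, if_pos hV, a, fun x => ?_⟩
  · exact continuous_const.if (fun u hu => by rw [hcl.frontier_eq] at hu; exact hu.elim)
      continuous_const
  · by_cases hx : orbit Γ x ∈ V
    · rw [Coeff.sub_apply, Coeff.restrict_apply_of_mem a hx]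
      simp [hx]
    · rw [Coeff.sub_apply, Coeff.restrict_apply_of_notMem a hx]
      simp [hx]

theorem norm_mk_le_of_forall {V : Set (Orbits Γ X)} (hV : V ∈ ω) (a : Coeff X R) {C : ℝ}
    (hC : 0 ≤ C) (h : ∀ x, orbit Γ x ∈ V → ‖a x‖ ≤ C) : ‖mk R ω a‖ ≤ C := by
  rw [mk_eq_mk_iff.2 (sub_restrict_mem hV a)]
  refine (norm_mk_le _).trans (Coeff.norm_le_of_forall_le _ hC fun x => ?_)
  by_cases hx : orbit Γ x ∈ V
  · rw [Coeff.restrict_apply_of_mem a hx]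
    exact h x hx
  · rw [Coeff.restrict_apply_of_notMem a hx, norm_zero]
    exact hC

theorem exists_norm_apply_le (a : Coeff X R) {ε : ℝ} (hε : 0 < ε) :
    ∃ V ∈ ω, ∀ x, orbit Γ x ∈ V → ‖a x‖ ≤ ‖mk R ω a‖ + ε := by
  obtain ⟨b, hb, hlt⟩ := Submodule.Quotient.norm_mk_lt (S := fiberIdeal R ω) (mk R ω a)
    (half_pos hε)
  have hlt : ‖b‖ < ‖mk R ω a‖ + ε / 2 := hlt
  have hmem : a - b ∈ fiberIdeal R ω := mk_eq_mk_iff.1 hb.symm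
  obtain ⟨V, hV, h1⟩ := exists_of_mem hmem (half_pos hε)
  refine ⟨V, hV, fun x hx => ?_⟩
  have h3 : a x = (a - b) x + b x := by simp
  rw [h3]
  refine (norm_add_le _ _).trans ?_
  linarith [h1 x hx, b.norm_apply_le x]

theorem mem_fiberIdeal_iff {a : Coeff X R} :
    a ∈ fiberIdeal R ω ↔ ∀ ε > 0, ∃ V ∈ ω, ∀ x, orbit Γ x ∈ V → ‖a x‖ ≤ ε := by
  refine ⟨fun ha ε hε => exists_of_mem ha hε, fun h => ?_⟩
  rw [← mk_eq_zero_iff, ← norm_le_zero_iff]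
  refine le_of_forall_pos_le_add fun ε hε => ?_
  obtain ⟨V, hV, h1⟩ := h ε hε
  rw [zero_add]
  exact norm_mk_le_of_forall hV a hε.le h1

theorem mul_mem_left (a : Coeff X R) {b : Coeff X R} (hb : b ∈ fiberIdeal R ω) :
    a * b ∈ fiberIdeal R ω := by
  rw [mem_fiberIdeal_iff]
  intro ε hε
  obtain ⟨V, hV, h⟩ := exists_of_mem hb (show 0 < ε / (‖a‖ + 1) by positivity)
  refine ⟨V, hV, fun x hx => (norm_mul_le _ _).trans ?_⟩
  calc ‖a x‖ * ‖b x‖ ≤ (‖a‖ + 1) * (ε / (‖a‖ + 1)) := by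
        gcongr
        · exact (a.norm_apply_le x).trans (by linarith)
        · exact h x hx
    _ = ε := by field_simp

theorem star_mem {b : Coeff X R} (hb : b ∈ fiberIdeal R ω) : star b ∈ fiberIdeal R ω := by
  rw [mem_fiberIdeal_iff]
  intro ε hε
  obtain ⟨V, hV, h⟩ := exists_of_mem hb hε
  refine ⟨V, hV, fun x hx => ?_⟩
  rw [Coeff.star_apply, norm_star]
  exact h x hx

theorem mul_mem_right {a : Coeff X R} (b : Coeff X R) (ha : a ∈ fiberIdeal R ω) :
    a * b ∈ fiberIdeal R ω := by
  rw [← star_star (a * b), star_mul]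
  exact star_mem (mul_mem_left _ (star_mem ha))

noncomputable instance : Mul (Fiber R ω) where
  mul := Quotient.map₂ (fun a b => a * b) fun a a' ha b b' hb => by
    have ha : a - a' ∈ fiberIdeal R ω := (Submodule.quotientRel_def _).1 ha
    have hb : b - b' ∈ fiberIdeal R ω := (Submodule.quotientRel_def _).1 hb
    refine (Submodule.quotientRel_def _).2 ?_
    have : a * b - a' * b' = (a - a') * b + a' * (b - b') := by
      rw [sub_mul, mul_sub]; abel
    rw [this]
    exact add_mem (mul_mem_right _ ha) (mul_mem_left _ hb)

theorem mk_mul (a b : Coeff X R) : mk R ω (a * b) = mk R ω a * mk R ω b := rfl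

noncomputable instance : Star (Fiber R ω) where
  star := Quotient.map (fun a => star a) fun a a' ha => by
    have ha : a - a' ∈ fiberIdeal R ω := (Submodule.quotientRel_def _).1 ha
    refine (Submodule.quotientRel_def _).2 ?_
    rw [← star_sub]
    exact star_mem ha

theorem mk_star (a : Coeff X R) : mk R ω (star a) = star (mk R ω a) := rfl

theorem ind {p : Fiber R ω → Prop} (h : ∀ a, p (mk R ω a)) (κ : Fiber R ω) : p κ := by
  obtain ⟨a, rfl⟩ := mk_surjective κ
  exact h a

noncomputable instance : NonUnitalNormedRing (Fiber R ω) where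
  left_distrib a b c := by
    induction a using ind; induction b using ind; induction c using ind
    simp only [← mk_mul, ← map_add, mul_add]
  right_distrib a b c := by
    induction a using ind; induction b using ind; induction c using ind
    simp only [← mk_mul, ← map_add, add_mul]
  zero_mul a := by
    induction a using ind
    rw [← map_zero (mk R ω), ← mk_mul, zero_mul]
  mul_zero a := by
    induction a using ind
    rw [← map_zero (mk R ω), ← mk_mul, mul_zero]
  mul_assoc a b c := by
    induction a using ind; induction b using ind; induction c using ind
    simp only [← mk_mul, mul_assoc]
  dist_eq := dist_eq_norm_neg_add
  norm_mul_le a b := by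
    obtain ⟨a, rfl⟩ := mk_surjective a
    obtain ⟨b, rfl⟩ := mk_surjective b
    rw [← mk_mul]
    have key : ∀ ε > 0, ‖mk R ω (a * b)‖ ≤ (‖mk R ω a‖ + ε) * (‖mk R ω b‖ + ε) := fun ε hε => by
      obtain ⟨V, hV, h1⟩ := exists_norm_apply_le (ω := ω) a hε
      obtain ⟨W, hW, h2⟩ := exists_norm_apply_le (ω := ω) b hε
      refine norm_mk_le_of_forall (Filter.inter_mem hV hW) _ (by positivity) fun x hx => ?_
      refine (norm_mul_le _ _).trans ?_
      gcongr
      · exact h1 x hx.1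
      · exact h2 x hx.2
    have hlim : Filter.Tendsto (fun ε : ℝ => (‖mk R ω a‖ + ε) * (‖mk R ω b‖ + ε))
        (nhdsWithin 0 (Set.Ioi 0)) (nhds ((‖mk R ω a‖ + 0) * (‖mk R ω b‖ + 0))) :=
      (Continuous.tendsto (by fun_prop) 0).mono_left nhdsWithin_le_nhds
    rw [add_zero, add_zero] at hlim
    exact ge_of_tendsto hlim (eventually_nhdsWithin_of_forall fun ε hε => key ε hε)

noncomputable instance : StarRing (Fiber R ω) where
  star_involutive a := by
    induction a using ind
    rw [← mk_star, ← mk_star, star_star]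
  star_mul a b := by
    induction a using ind; induction b using ind
    simp only [← mk_mul, ← mk_star, star_mul]
  star_add a b := by
    induction a using ind; induction b using ind
    simp only [← map_add, ← mk_star, star_add]

instance : StarModule ℂ (Fiber R ω) where
  star_smul c a := by
    induction a using ind
    simp only [← map_smul, ← mk_star, star_smul]

instance : IsScalarTower ℂ (Fiber R ω) (Fiber R ω) where
  smul_assoc c a b := by
    induction a using ind; induction b using ind
    simp only [smul_eq_mul, ← map_smul, ← mk_mul, smul_mul_assoc]

instance : SMulCommClass ℂ (Fiber R ω) (Fiber R ω) where
  smul_comm c a b := by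
    induction a using ind; induction b using ind
    simp only [smul_eq_mul, ← map_smul, ← mk_mul, mul_smul_comm]

instance : CStarRing (Fiber R ω) where
  norm_mul_self_le a := by
    obtain ⟨a, rfl⟩ := mk_surjective a
    rw [← mk_star, ← mk_mul, ← pow_two]
    refine le_of_forall_pos_le_add fun ε hε => ?_
    obtain ⟨V, hV, h1⟩ := exists_norm_apply_le (ω := ω) (star a * a) hε
    rw [← Real.le_sqrt (norm_nonneg _) (by positivity)]
    refine norm_mk_le_of_forall hV _ (Real.sqrt_nonneg _) fun x hx => ?_
    rw [Real.le_sqrt (norm_nonneg _) (by positivity)]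
    have := h1 x hx
    rwa [Coeff.mul_apply, Coeff.star_apply, CStarRing.norm_star_mul_self, ← pow_two] at this

noncomputable instance : NonUnitalCStarAlgebra (Fiber R ω) where

end Fiber

end Fiber

section Groupoid

/-- The map of orbit spaces induced by an equivariant map. -/
def orbitMap {Γ Y Z : Type*} [Group Γ] [MulAction Γᵐᵒᵖ Y] [MulAction Γᵐᵒᵖ Z] (f : Y → Z)
    (hf : ∀ (g : Γᵐᵒᵖ) (y : Y), f (g • y) = g • f y) : Orbits Γ Y → Orbits Γ Z :=
  Quotient.map' f <| by
    rintro _ y ⟨g, rfl⟩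
    exact ⟨g, (hf g y).symm⟩

variable (Γ X : Type*) [Group Γ] [MetricSpace X] [MulAction Γᵐᵒᵖ X]

/-- `Δ_R/Γ ⊆ (X × X)/Γ`, where `Δ_R = {(x, y) | d(x, y) ≤ R}`. -/
def entourage (R : ℝ≥0) : Set (Orbits Γ (X × X)) := orbit Γ '' {p : X × X | dist p.1 p.2 ≤ R}

/-- The equivariant coarse groupoid `G(X, Γ) = ⋃_R closure (Δ_R/Γ) ⊆ β((X × X)/Γ)`, with the
subspace topology. -/
def CoarseGroupoid : Type _ :=
  ↥(⋃ R : ℝ≥0, closure (pure '' entourage Γ X R) : Set (Ultrafilter (Orbits Γ (X × X))))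

instance : TopologicalSpace (CoarseGroupoid Γ X) := instTopologicalSpaceSubtype

variable {Γ X}

theorem mem_closure_pure_image_iff {α : Type*} {S : Set α} {u : Ultrafilter α} :
    u ∈ closure (pure '' S) ↔ S ∈ u := by
  constructor
  · intro h
    have hsub : (pure '' S : Set (Ultrafilter α)) ⊆ {v | S ∈ v} := by
      rintro _ ⟨a, ha, rfl⟩
      exact ha
    exact closure_minimal hsub (ultrafilter_isClosed_basic S) h
  · intro h
    exact mem_closure_of_tendsto (Ultrafilter.tendsto_pure_self u)
      (Filter.mem_of_superset h fun a ha => ⟨a, ha, rfl⟩)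

namespace CoarseGroupoid

theorem exists_entourage_mem (g : CoarseGroupoid Γ X) : ∃ R, entourage Γ X R ∈ g.1 := by
  obtain ⟨R, hR⟩ := Set.mem_iUnion.1 g.2
  exact ⟨R, mem_closure_pure_image_iff.1 hR⟩

/-- An ultrafilter containing some `Δ_R/Γ` as an element of the groupoid. -/
def ofMem (u : Ultrafilter (Orbits Γ (X × X))) (R : ℝ≥0) (hR : entourage Γ X R ∈ u) :
    CoarseGroupoid Γ X :=
  ⟨u, Set.mem_iUnion.2 ⟨R, mem_closure_pure_image_iff.2 hR⟩⟩

/-- The element `[x, y]` of the groupoid. -/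
def pair (x y : X) : CoarseGroupoid Γ X :=
  ofMem (pure (orbit Γ (x, y))) (nndist x y) ⟨(x, y), le_of_eq (coe_nndist x y).symm, rfl⟩

/-- The range map, the continuous extension of `[x, y] ↦ [x]`. -/
def r (g : CoarseGroupoid Γ X) : Ultrafilter (Orbits Γ X) :=
  g.1.map (orbitMap Prod.fst fun _ _ => rfl)

/-- The source map, the continuous extension of `[x, y] ↦ [y]`. -/
def s (g : CoarseGroupoid Γ X) : Ultrafilter (Orbits Γ X) :=
  g.1.map (orbitMap Prod.snd fun _ _ => rfl)

/-- The inverse, the continuous extension of `[x, y] ↦ [y, x]`. -/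
noncomputable def inv (g : CoarseGroupoid Γ X) : CoarseGroupoid Γ X :=
  ofMem (g.1.map (orbitMap Prod.swap fun _ _ => rfl)) g.exists_entourage_mem.choose <| by
    change _ ∈ Filter.map _ _
    refine Filter.mem_map.2 (Filter.mem_of_superset g.exists_entourage_mem.choose_spec ?_)
    rintro _ ⟨⟨x, y⟩, h, rfl⟩
    refine ⟨(y, x), ?_, rfl⟩
    rw [Set.mem_ofPred_eq, dist_comm]
    exact h

theorem r_inv (g : CoarseGroupoid Γ X) : g.inv.r = g.s := by
  change (g.1.map _).map _ = g.1.map _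
  rw [Ultrafilter.map_map]
  congr 1
  ext z
  induction z using Quotient.inductionOn'
  rfl

theorem s_inv (g : CoarseGroupoid Γ X) : g.inv.s = g.r := by
  change (g.1.map _).map _ = g.1.map _
  rw [Ultrafilter.map_map]
  congr 1
  ext z
  induction z using Quotient.inductionOn'
  rfl

/-- `[x, y, z] ↦ [x, y]` -/
def p₁₂ : Orbits Γ (X × X × X) → Orbits Γ (X × X) :=
  orbitMap (fun t => (t.1, t.2.1)) fun _ _ => rfl

/-- `[x, y, z] ↦ [y, z]` -/
def p₂₃ : Orbits Γ (X × X × X) → Orbits Γ (X × X) :=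
  orbitMap (fun t => (t.2.1, t.2.2)) fun _ _ => rfl

/-- `[x, y, z] ↦ [x, z]` -/
def p₁₃ : Orbits Γ (X × X × X) → Orbits Γ (X × X) :=
  orbitMap (fun t => (t.1, t.2.2)) fun _ _ => rfl

/-- For a free action, `(X × X × X)/Γ` is the set of composable pairs `([x, y], [y, z])` of the
discrete groupoid `(X × X)/Γ`. This is the filter of all pairs near `(g, h)`; it is an
ultrafilter if `X` has bounded geometry and `(g, h)` is composable. -/
def compFilter (g h : CoarseGroupoid Γ X) : Filter (Orbits Γ (X × X × X)) :=
  Filter.comap p₁₂ g.1 ⊓ Filter.comap p₂₃ h.1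

theorem compFilter_neBot (g h : CoarseGroupoid Γ X) (hgh : g.s = h.r) :
    (compFilter g h).NeBot := by
  rw [compFilter, Filter.inf_neBot_iff]
  rintro S ⟨A, hA, hAS⟩ T ⟨B, hB, hBT⟩
  have h1 : (orbitMap Prod.snd fun _ _ => rfl) '' A ∈ g.s := Filter.image_mem_map hA
  have h2 : (orbitMap Prod.fst fun _ _ => rfl) '' B ∈ h.r := Filter.image_mem_map hB
  rw [← hgh] at h2
  obtain ⟨_, ⟨p, hp, rfl⟩, ⟨q, hq, hpq⟩⟩ := g.s.nonempty_of_mem (Filter.inter_mem h1 h2)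
  induction p using Quotient.inductionOn' with | h p =>
  induction q using Quotient.inductionOn' with | h q =>
  obtain ⟨x, y⟩ := p
  obtain ⟨y', z⟩ := q
  obtain ⟨γ, hγ⟩ : y' ∈ MulAction.orbit Γᵐᵒᵖ y := Quotient.exact' hpq
  refine ⟨orbit Γ (x, y, γ⁻¹ • z), hAS hp, hBT ?_⟩
  have : orbit Γ (y, γ⁻¹ • z) = orbit Γ (y', z) := by
    rw [← orbit_smul Γ γ (y, γ⁻¹ • z), Prod.smul_mk, smul_inv_smul]
    exact congrArg (fun w => orbit Γ (w, z)) hγ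
  change orbit Γ (y, γ⁻¹ • z) ∈ B
  rw [this]
  exact hq

variable [IsIsometricSMul Γᵐᵒᵖ X]

theorem dist_le_of_orbit_mem {R : ℝ≥0} {x y : X} (h : orbit Γ (x, y) ∈ entourage Γ X R) :
    dist x y ≤ R := by
  obtain ⟨⟨x', y'⟩, hd, he⟩ := h
  obtain ⟨γ, hγ⟩ : (x', y') ∈ MulAction.orbit Γᵐᵒᵖ (x, y) := Quotient.exact' he
  obtain ⟨rfl, rfl⟩ := Prod.mk.inj hγ
  have : dist (γ • x) (γ • y) ≤ R := hd
  rwa [dist_smul] at this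

/-- The composition of a composable pair, the continuous extension of
`[x, y] ∘ [y, z] = [x, z]`. -/
noncomputable def comp (g h : CoarseGroupoid Γ X) (hgh : g.s = h.r) : CoarseGroupoid Γ X :=
  haveI := compFilter_neBot g h hgh
  ofMem ((Ultrafilter.of (compFilter g h)).map p₁₃)
    (g.exists_entourage_mem.choose + h.exists_entourage_mem.choose) <| by
    have h1 : p₁₂ ⁻¹' entourage Γ X g.exists_entourage_mem.choose ∈ compFilter g h :=
      Filter.mem_inf_of_left (Filter.preimage_mem_comap g.exists_entourage_mem.choose_spec)
    have h2 : p₂₃ ⁻¹' entourage Γ X h.exists_entourage_mem.choose ∈ compFilter g h :=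
      Filter.mem_inf_of_right (Filter.preimage_mem_comap h.exists_entourage_mem.choose_spec)
    have h3 := Ultrafilter.of_le (compFilter g h) (Filter.inter_mem h1 h2)
    refine Ultrafilter.mem_map.2 (Filter.mem_of_superset h3 ?_)
    intro t ht
    induction t using Quotient.inductionOn' with | h t =>
    obtain ⟨x, y, z⟩ := t
    refine ⟨(x, z), ?_, rfl⟩
    rw [Set.mem_ofPred_eq, NNReal.coe_add]
    exact (dist_triangle x y z).trans
      (add_le_add (dist_le_of_orbit_mem ht.1) (dist_le_of_orbit_mem ht.2))

theorem s_comp (g h : CoarseGroupoid Γ X) (hgh : g.s = h.r) : (g.comp h hgh).s = h.s := by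
  have := compFilter_neBot g h hgh
  have h1 : (Ultrafilter.of (compFilter g h)).map p₂₃ = h.1 := by
    refine Ultrafilter.eq_of_le ?_
    exact (Filter.map_mono ((Ultrafilter.of_le (compFilter g h)).trans inf_le_right)).trans
      Filter.map_comap_le
  change ((Ultrafilter.of (compFilter g h)).map p₁₃).map _ = h.1.map _
  rw [← h1, Ultrafilter.map_map, Ultrafilter.map_map]
  congr 1
  ext z
  induction z using Quotient.inductionOn'
  rfl

end CoarseGroupoid

end Groupoid

section CrossedProduct

variable {Γ X F : Type*} [Group Γ] [MetricSpace X] [MulAction Γᵐᵒᵖ X]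
  [NormedAddCommGroup F] [InnerProductSpace ℂ F] [CompleteSpace F]

/-- `‖b(x) - a(y)‖ → 0` as `[x, y] → g`. -/
def Transports (R : Γ →* (F ≃ₗᵢ[ℂ] F)) (g : CoarseGroupoid Γ X) (a b : Coeff X R) : Prop :=
  ∀ ε > 0, ∀ᶠ p in (g.1 : Filter (Orbits Γ (X × X))), ∀ x y, orbit Γ (x, y) = p → ‖b x - a y‖ ≤ ε

/-- The action `α_g : A_{s(g)} → A_{r(g)}` of the groupoid on `A = ℓ^∞(X, 𝒦(F))^Γ`: the image of
the class of `a` is the class of any `b` with `‖b(x) - a(y)‖ → 0` as `[x, y] → g`. In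
particular, `α_{[x, y]}` is the identity of `𝒦(F)` if `A_{[y]}` and `A_{[x]}` are identified
with `𝒦(F)` by evaluation at `y` and `x`. If the action is free and isometric and `X` has bounded
geometry, such `b` exists and its class in `A_{r(g)}` depends only on the class of `a` in
`A_{s(g)}`. -/
noncomputable def action {R : Γ →* (F ≃ₗᵢ[ℂ] F)} (g : CoarseGroupoid Γ X)
    {ω ω' : Ultrafilter (Orbits Γ X)} (_hs : g.s = ω) (_hr : g.r = ω') (κ : Fiber R ω) :
    Fiber R ω' :=
  Classical.epsilon fun μ => ∃ a b, Fiber.mk R ω a = κ ∧ Fiber.mk R ω' b = μ ∧ Transports R g a b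

/-- `k` is a continuous compactly supported section of the bundle `s^*𝒜` over `G(X, Γ)`, whose
fibre over `g` is `A_{s(g)}`; the bundle of the fibres carries the topology for which the maps
`ω ↦ [a]_ω`, `a ∈ A`, are continuous sections, so that a section is continuous if and only if it
is locally a uniform limit of these. -/
structure IsCompactlySupportedSection (R : Γ →* (F ≃ₗᵢ[ℂ] F))
    (k : (g : CoarseGroupoid Γ X) → Fiber R g.s) : Prop where
  continuous : ∀ g₀, ∀ ε > 0, ∃ a : Coeff X R, ∀ᶠ g in nhds g₀, ‖k g - Fiber.mk R g.s a‖ < ε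
  compactSupport : ∃ K : Set (CoarseGroupoid Γ X), IsCompact K ∧ ∀ g ∉ K, k g = 0

/-- `G_ω = s⁻¹(ω)`. -/
abbrev SourceFiber (Γ : Type*) {X : Type*} [Group Γ] [MetricSpace X] [MulAction Γᵐᵒᵖ X]
    (ω : Ultrafilter (Orbits Γ X)) : Type _ :=
  {g : CoarseGroupoid Γ X // g.s = ω}

/-- The C⋆-algebra of bounded families of adjointable operators on the Hilbert modules
`ℓ²(G_ω) ⊗ A_ω`, `ω ∈ β(X/Γ)`. -/
def RegularFamilies (X : Type*) [MetricSpace X] [MulAction Γᵐᵒᵖ X]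
    (R : Γ →* (F ≃ₗᵢ[ℂ] F)) : Type _ :=
  lp (fun ω : Ultrafilter (Orbits Γ X) => Adjointable (SourceFiber Γ ω) (Fiber R ω)) ∞

noncomputable instance (R : Γ →* (F ≃ₗᵢ[ℂ] F)) : NonUnitalCStarAlgebra (RegularFamilies X R) :=
  inferInstanceAs (NonUnitalCStarAlgebra
    (lp (fun ω : Ultrafilter (Orbits Γ X) => Adjointable (SourceFiber Γ ω) (Fiber R ω)) ∞))

/-- The operator with index `ω` of a family. -/
def RegularFamilies.op {R : Γ →* (F ≃ₗᵢ[ℂ] F)} (T : RegularFamilies X R)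
    (ω : Ultrafilter (Orbits Γ X)) :
    L2 (SourceFiber Γ ω) (Fiber R ω) →L[ℂ] L2 (SourceFiber Γ ω) (Fiber R ω) :=
  (T.1 ω).1

variable [IsIsometricSMul Γᵐᵒᵖ X]

/-- `T = (π_ω(k))_ω`, where `π_ω` is the left regular representation on `ℓ²(G_ω) ⊗ A_ω`,
`(π_ω(k) ξ)(g) = ∑_{h ∈ G_ω} α_h⁻¹(k(g h⁻¹)) ξ(h)`. -/
def IsRegularRep {R : Γ →* (F ≃ₗᵢ[ℂ] F)} (k : (g : CoarseGroupoid Γ X) → Fiber R g.s)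
    (T : RegularFamilies X R) : Prop :=
  ∀ (ω : Ultrafilter (Orbits Γ X)) (ξ : L2 (SourceFiber Γ ω) (Fiber R ω)) (g : SourceFiber Γ ω),
    HasSum (fun h : SourceFiber Γ ω =>
      action h.1.inv (CoarseGroupoid.s_comp g.1 h.1.inv
        (g.2.trans (h.2.symm.trans h.1.r_inv.symm))).symm (h.1.r_inv.trans h.2)
        (k (g.1.comp h.1.inv (g.2.trans (h.2.symm.trans h.1.r_inv.symm)))) * ξ h)
      (T.op ω ξ g)

/-- The reduced crossed product `G(X, Γ) ⋉_r ℓ^∞(X, 𝒦(F))^Γ`: the C⋆-algebra generated by the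
image of the compactly supported continuous sections under the left regular representation, that
is their completion in the norm `‖k‖_r = sup_ω ‖π_ω(k)‖`. -/
noncomputable def reducedCrossedProduct (X : Type*) [MetricSpace X] [MulAction Γᵐᵒᵖ X]
    [IsIsometricSMul Γᵐᵒᵖ X] (R : Γ →* (F ≃ₗᵢ[ℂ] F)) :
    NonUnitalStarSubalgebra ℂ (RegularFamilies X R) :=
  (NonUnitalStarAlgebra.adjoin ℂ
    {T : RegularFamilies X R | ∃ k, IsCompactlySupportedSection R k ∧ IsRegularRep k T}).topologicalClosure

end CrossedProduct

section Roe

variable {Γ X : Type*} [Group Γ] [MetricSpace X] [MulAction Γᵐᵒᵖ X]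
  {E : Type*} [NormedAddCommGroup E] [InnerProductSpace ℂ E] [CompleteSpace E]

/-- Equivariant ample `X`-modules, for a free action. (The condition that, for a finite subgroup
`F` of `Γ` and an `F`-invariant set `Y`, the representation of `F` on `χ_Y E` be a multiple of the
regular one is automatic for a free action on a discrete space.) -/
structure IsAmpleModule (ρ : C₀(X, ℂ) →⋆ₙₐ[ℂ] (E →L[ℂ] E)) (u : Γ →* (E ≃ₗᵢ[ℂ] E)) : Prop where
  separable : TopologicalSpace.SeparableSpace E
  infinite : ¬ FiniteDimensional ℂ E
  faithful : Function.Injective ρ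
  nondegenerate : Dense (Submodule.span ℂ {w | ∃ f v, ρ f v = w} : Set E)
  covariant : ∀ (γ : Γ) (f f' : C₀(X, ℂ)), (∀ x, f' x = f (MulOpposite.op γ • x)) →
    ∀ v, u γ (ρ f ((u γ).symm v)) = ρ f' v
  ample : ∀ f, f ≠ 0 → ¬ IsCompactOperator (ρ f)

/-- The operators of the algebraic equivariant Roe algebra `ℂ[X]^Γ`. -/
structure IsRoeOperator (ρ : C₀(X, ℂ) →⋆ₙₐ[ℂ] (E →L[ℂ] E)) (u : Γ →* (E ≃ₗᵢ[ℂ] E))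
    (T : E →L[ℂ] E) : Prop where
  finitePropagation : ∃ R : ℝ≥0, ∀ f g : C₀(X, ℂ),
    (R : ℝ≥0∞) < ⨅ x ∈ tsupport f, ⨅ y ∈ tsupport g, edist x y → ρ f * T * ρ g = 0
  locallyCompact : ∀ f, IsCompactOperator (ρ f * T) ∧ IsCompactOperator (T * ρ f)
  invariant : ∀ γ v, u γ (T ((u γ).symm v)) = T v

/-- The equivariant Roe algebra `C^*(X)^Γ`, the norm closure of `ℂ[X]^Γ`. -/
noncomputable def roeAlgebra (ρ : C₀(X, ℂ) →⋆ₙₐ[ℂ] (E →L[ℂ] E)) (u : Γ →* (E ≃ₗᵢ[ℂ] E)) :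
    NonUnitalStarSubalgebra ℂ (E →L[ℂ] E) :=
  (NonUnitalStarAlgebra.adjoin ℂ {T | IsRoeOperator ρ u T}).topologicalClosure

end Roe

section WellDefined

theorem exists_orbit_eq_of_fst {Γ X : Type*} [Group Γ] [MulAction Γᵐᵒᵖ X]
    {p : Orbits Γ (X × X)} {x : X}
    (h : orbitMap (Prod.fst : X × X → X) (fun _ _ => rfl) p = orbit Γ x) :
    ∃ y, p = orbit Γ (x, y) := by
  induction p using Quotient.inductionOn' with | h p =>
  obtain ⟨x', y⟩ := p
  obtain ⟨γ, hγ⟩ : x' ∈ MulAction.orbit Γᵐᵒᵖ x := Quotient.exact' h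
  refine ⟨γ⁻¹ • y, ?_⟩
  change orbit Γ (x', y) = _
  rw [← orbit_smul Γ γ (x, γ⁻¹ • y), Prod.smul_mk, smul_inv_smul]
  exact congrArg (fun w => orbit Γ (w, y)) hγ.symm

/-- Bounded geometry: the balls of each radius have uniformly bounded cardinality. -/
def BoundedGeometry (X : Type*) [MetricSpace X] : Prop :=
  ∀ R : ℝ, ∃ N : ℕ, ∀ x : X, (Metric.closedBall x R).encard ≤ N

theorem exists_injOn_mem_ultrafilter {α β : Type*} (f : α → β) (S : Set α) (N : ℕ)
    (hN : ∀ b, (S ∩ f ⁻¹' {b}).encard ≤ N) (u : Ultrafilter α) (hS : S ∈ u) :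
    ∃ V ∈ u, Set.InjOn f V := by
  have hc : ∀ b, ∃ c : α → Fin (N + 1), Set.InjOn c (S ∩ f ⁻¹' {b}) := fun b => by
    have hfin : (S ∩ f ⁻¹' {b}).Finite := Set.finite_of_encard_le_coe (hN b)
    obtain ⟨e, he⟩ := hfin.exists_injOn_of_encard_le (t := (Set.univ : Set (Fin (N + 1)))) (by
      refine (hN b).trans ?_
      simp)
    exact ⟨e, he.2⟩
  choose c hc using hc
  obtain ⟨i, hi⟩ : ∃ i : Fin (N + 1), {a | c (f a) a = i} ∈ u := by
    have h1 : (⋃ i : Fin (N + 1), {a | c (f a) a = i}) ∈ u := by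
      rw [Set.iUnion_eq_univ_iff.2 fun a => ⟨c (f a) a, rfl⟩]
      exact Filter.univ_mem
    rw [← Set.biUnion_univ, Ultrafilter.finite_biUnion_mem_iff Set.finite_univ] at h1
    obtain ⟨i, -, hi⟩ := h1
    exact ⟨i, hi⟩
  refine ⟨S ∩ {a | c (f a) a = i}, Filter.inter_mem hS hi, fun a ha b hb hab => ?_⟩
  refine hc (f a) ⟨ha.1, rfl⟩ ⟨hb.1, hab.symm⟩ ?_
  have h1 : c (f a) a = i := ha.2
  have h2 : c (f b) b = i := hb.2
  rw [h1, hab, h2]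

variable {Γ X F : Type*} [Group Γ] [MetricSpace X] [MulAction Γᵐᵒᵖ X]
  [NormedAddCommGroup F] [InnerProductSpace ℂ F] [CompleteSpace F]

theorem mk_eq_of_transports {R : Γ →* (F ≃ₗᵢ[ℂ] F)} (g : CoarseGroupoid Γ X) {a a' b b' : Coeff X R}
    (haa' : Fiber.mk R g.s a = Fiber.mk R g.s a') (h : Transports R g a b)
    (h' : Transports R g a' b') : Fiber.mk R g.r b = Fiber.mk R g.r b' := by
  rw [Fiber.mk_eq_mk_iff] at haa' ⊢
  rw [Fiber.mem_fiberIdeal_iff]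
  intro ε hε
  obtain ⟨V, hV, hVa⟩ := Fiber.exists_of_mem haa' (show 0 < ε / 3 by positivity)
  have h1 := h (ε / 3) (by positivity)
  have h2 := h' (ε / 3) (by positivity)
  refine ⟨_, Filter.image_mem_map (Filter.inter_mem (Filter.inter_mem h1 h2) hV), ?_⟩
  rintro x ⟨p, ⟨⟨hp1, hp2⟩, hp3⟩, hpx⟩
  obtain ⟨y, rfl⟩ := exists_orbit_eq_of_fst hpx
  have e1 := hp1 x y rfl
  have e2 := hp2 x y rfl
  have e3 := hVa y hp3
  rw [Coeff.sub_apply] at e3 ⊢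
  have : b x - b' x = (b x - a y) + ((a y - a' y) - (b' x - a' y)) := by abel
  rw [this]
  refine (norm_add_le _ _).trans ?_
  have := norm_sub_le (a y - a' y) (b' x - a' y)
  linarith

/-- The action of the groupoid is well defined: `α_g [a] = [b]` whenever `‖b(x) - a(y)‖ → 0` as
`[x, y] → g`. -/
theorem action_mk {R : Γ →* (F ≃ₗᵢ[ℂ] F)} (g : CoarseGroupoid Γ X) {a b : Coeff X R}
    (h : Transports R g a b) : action g rfl rfl (Fiber.mk R g.s a) = Fiber.mk R g.r b := by
  obtain ⟨a', b', ha, hb, hab⟩ := Classical.epsilon_spec (p := fun μ => ∃ a' b',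
    Fiber.mk R g.s a' = Fiber.mk R g.s a ∧ Fiber.mk R g.r b' = μ ∧ Transports R g a' b')
    ⟨Fiber.mk R g.r b, a, b, rfl, rfl, h⟩
  change Classical.epsilon _ = _
  rw [← hb]
  exact mk_eq_of_transports g ha hab h

variable [IsIsometricSMul Γᵐᵒᵖ X]

theorem exists_injOn_fst (hX : BoundedGeometry X) (g : CoarseGroupoid Γ X) :
    ∃ V ∈ g.1, Set.InjOn (orbitMap (Γ := Γ) (Prod.fst : X × X → X) fun _ _ => rfl) V := by
  obtain ⟨R, hR⟩ := g.exists_entourage_mem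
  obtain ⟨N, hN⟩ := hX R
  refine exists_injOn_mem_ultrafilter _ (entourage Γ X R) N (fun b => ?_) g.1 hR
  induction b using Quotient.inductionOn' with | h x =>
  refine le_trans ?_ (hN x)
  refine le_trans (Set.encard_le_encard (t := (fun y => orbit Γ (x, y)) '' Metric.closedBall x R) ?_)
    (Set.encard_image_le _ _)
  rintro p ⟨hp, hpx⟩
  obtain ⟨y, rfl⟩ := exists_orbit_eq_of_fst hpx
  exact ⟨y, Metric.mem_closedBall'.2 (CoarseGroupoid.dist_le_of_orbit_mem hp), rfl⟩

/-- The filter of composable pairs near a composable pair `(g, h)` is an ultrafilter, so that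
the composition is well defined. -/
theorem exists_compFilter_eq (hX : BoundedGeometry X)
    (hfree : ∀ (x : X) (γ : Γ), MulOpposite.op γ • x = x → γ = 1)
    (g h : CoarseGroupoid Γ X) (hgh : g.s = h.r) :
    ∃ u : Ultrafilter (Orbits Γ (X × X × X)), g.compFilter h = u := by
  have := CoarseGroupoid.compFilter_neBot g h hgh
  obtain ⟨V, hV, hinj⟩ := exists_injOn_fst hX h
  refine ⟨Ultrafilter.of (g.compFilter h), le_antisymm ?_ (Ultrafilter.of_le _)⟩
  intro S hS
  have h12 : (Ultrafilter.of (g.compFilter h)).map CoarseGroupoid.p₁₂ = g.1 :=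
    Ultrafilter.eq_of_le ((Filter.map_mono
      ((Ultrafilter.of_le (g.compFilter h)).trans inf_le_left)).trans Filter.map_comap_le)
  have h23V : CoarseGroupoid.p₂₃ ⁻¹' V ∈ g.compFilter h :=
    Filter.mem_inf_of_right (Filter.preimage_mem_comap hV)
  have hS' : S ∩ CoarseGroupoid.p₂₃ ⁻¹' V ∈ Ultrafilter.of (g.compFilter h) :=
    Filter.inter_mem hS (Ultrafilter.of_le _ h23V)
  have hA : CoarseGroupoid.p₁₂ '' (S ∩ CoarseGroupoid.p₂₃ ⁻¹' V) ∈ g.1 := by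
    rw [← h12]
    exact Filter.image_mem_map hS'
  refine Filter.mem_of_superset (Filter.inter_mem
    (Filter.mem_inf_of_left (Filter.preimage_mem_comap hA)) h23V) ?_
  rintro t ⟨⟨t', ⟨htS, htV⟩, htt'⟩, htV'⟩
  induction t using Quotient.inductionOn' with | h t =>
  induction t' using Quotient.inductionOn' with | h t' =>
  obtain ⟨x, y, z⟩ := t
  obtain ⟨x', y', z'⟩ := t'
  obtain ⟨γ, hγ⟩ : (x', y') ∈ MulAction.orbit Γᵐᵒᵖ (x, y) := Quotient.exact' htt'
  obtain ⟨rfl, rfl⟩ := Prod.mk.inj hγ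
  have e1 : orbit Γ (γ • y, z') = orbit Γ (y, γ⁻¹ • z') := by
    rw [← orbit_smul Γ γ (y, γ⁻¹ • z'), Prod.smul_mk, smul_inv_smul]
  have e2 : orbit Γ (y, γ⁻¹ • z') = orbit Γ (y, z) := by
    refine hinj ?_ htV' rfl
    rw [← e1]
    exact htV
  obtain ⟨δ, hδ⟩ : (y, γ⁻¹ • z') ∈ MulAction.orbit Γᵐᵒᵖ (y, z) := Quotient.exact' e2
  obtain ⟨hδy, hδz⟩ := Prod.mk.inj hδ
  have hδ1 : δ = 1 := MulOpposite.unop_injective (hfree y δ.unop hδy)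
  have hz : z' = γ • z := by
    rw [hδ1, one_smul] at hδz
    rw [eq_comm, ← eq_inv_smul_iff]
    exact hδz
  have e3 : orbit Γ (γ • x, γ • y, z') = orbit Γ (x, y, z) := by
    rw [hz, ← Prod.smul_mk, ← Prod.smul_mk, orbit_smul]
  change orbit Γ (x, y, z) ∈ S
  rw [← e3]
  exact htS

theorem exists_transports (hX : BoundedGeometry X)
    (hfree : ∀ (x : X) (γ : Γ), MulOpposite.op γ • x = x → γ = 1)
    {R : Γ →* (F ≃ₗᵢ[ℂ] F)} (g : CoarseGroupoid Γ X) (a : Coeff X R) :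
    ∃ b, Transports R g a b := by
  classical
  obtain ⟨V, hV, hinj⟩ := exists_injOn_fst hX g
  have huniq : ∀ x y y', orbit Γ (x, y) ∈ V → orbit Γ (x, y') ∈ V → y = y' := by
    intro x y y' h1 h2
    obtain ⟨δ, hδ⟩ : (x, y) ∈ MulAction.orbit Γᵐᵒᵖ (x, y') := Quotient.exact' (hinj h1 h2 rfl)
    obtain ⟨hx, hy⟩ := Prod.mk.inj hδ
    have hδ1 : δ = 1 := MulOpposite.unop_injective (hfree x δ.unop hx)
    rw [hδ1] at hy
    exact hy.symm.trans (one_smul _ y')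
  let b : X → F →L[ℂ] F := fun x => if h : ∃ y, orbit Γ (x, y) ∈ V then a h.choose else 0
  have hb : ∀ x y, orbit Γ (x, y) ∈ V → b x = a y := fun x y h => by
    have h' : ∃ y, orbit Γ (x, y) ∈ V := ⟨y, h⟩
    simp only [b, dif_pos h']
    rw [huniq x _ y h'.choose_spec h]
  have hb0 : ∀ x, (¬ ∃ y, orbit Γ (x, y) ∈ V) → b x = 0 := fun x h => dif_neg h
  refine ⟨⟨⟨b, ?_⟩, fun x => ?_, fun x γ v => ?_⟩, fun ε hε => ?_⟩
  · refine memℓp_infty ⟨‖a‖, ?_⟩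
    rintro _ ⟨x, rfl⟩
    by_cases h : ∃ y, orbit Γ (x, y) ∈ V
    · obtain ⟨y, hy⟩ := h
      simpa only [hb x y hy] using a.norm_apply_le y
    · simp [hb0 x h]
  · change IsCompactOperator (b x)
    by_cases h : ∃ y, orbit Γ (x, y) ∈ V
    · obtain ⟨y, hy⟩ := h
      rw [hb x y hy]
      exact a.2.1 y
    · rw [hb0 x h]
      exact isCompactOperator_zero
  · change R γ (b (MulOpposite.op γ • x) _) = b x v
    by_cases h : ∃ y, orbit Γ (x, y) ∈ V
    · obtain ⟨y, hy⟩ := h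
      have hy' : orbit Γ (MulOpposite.op γ • x, MulOpposite.op γ • y) ∈ V := by
        rwa [← Prod.smul_mk, orbit_smul]
      rw [hb x y hy, hb _ _ hy']
      exact a.2.2 y γ v
    · have h' : ¬ ∃ y, orbit Γ (MulOpposite.op γ • x, y) ∈ V := by
        rintro ⟨y, hy⟩
        refine h ⟨(MulOpposite.op γ)⁻¹ • y, ?_⟩
        rwa [← orbit_smul Γ (MulOpposite.op γ) (x, (MulOpposite.op γ)⁻¹ • y), Prod.smul_mk,
          smul_inv_smul]
      rw [hb0 x h, hb0 _ h']
      simp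
  · filter_upwards [hV] with p hp x y hxy
    subst hxy
    change ‖b x - a y‖ ≤ ε
    rw [hb x y hp, sub_self, norm_zero]
    exact hε.le

end WellDefined

section Canonical

variable {Γ X F E : Type*} [Group Γ] [MetricSpace X] [MulAction Γᵐᵒᵖ X]
  [NormedAddCommGroup F] [InnerProductSpace ℂ F] [CompleteSpace F]
  [NormedAddCommGroup E] [InnerProductSpace ℂ E] [CompleteSpace E]

/-- `T` is the operator on `ℓ²(X) ⊗ F` with the `𝒦(F)`-valued kernel `T(x, y) = k([x, y])`, where
`k([x, y]) ∈ A_{[y]}` is read as an operator on `F` by evaluation at `y`: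
`(T ξ)(x) = ∑_y T(x, y) ξ(y)`. -/
def HasKernel {R : Γ →* (F ≃ₗᵢ[ℂ] F)} (k : (g : CoarseGroupoid Γ X) → Fiber R g.s)
    (T : HilbertSum X F →L[ℂ] HilbertSum X F) : Prop :=
  ∀ a : X → X → Coeff X R,
    (∀ x y, Fiber.mk R (CoarseGroupoid.pair (Γ := Γ) x y).s (a x y) = k (CoarseGroupoid.pair x y)) →
    ∀ ξ x, HasSum (fun y => a x y y (ξ y)) (T ξ x)

/-- `W` identifies the `X`-module `E` with the `X`-module `ℓ²(X) ⊗ F`, equivariantly. -/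
structure IsModuleIso (ρ : C₀(X, ℂ) →⋆ₙₐ[ℂ] (E →L[ℂ] E)) (u : Γ →* (E ≃ₗᵢ[ℂ] E))
    (R : Γ →* (F ≃ₗᵢ[ℂ] F)) (W : E ≃ₗᵢ[ℂ] HilbertSum X F) : Prop where
  map_mul : ∀ f v, W (ρ f v) = HilbertSum.mulRep (ι := X) (E := F) f (W v)
  map_unitary : ∀ γ v, W (u γ v) = diagonalRep X R γ (W v)

variable [IsIsometricSMul Γᵐᵒᵖ X]

/-- `Φ` is the canonical map of the reduced crossed product to the Roe algebra of `E`: it sends a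
compactly supported continuous section `k` to the operator with kernel `(x, y) ↦ k([x, y])`, where
`E` is identified with `ℓ²(X) ⊗ F` by `W`. -/
def IsCanonical {ρ : C₀(X, ℂ) →⋆ₙₐ[ℂ] (E →L[ℂ] E)} {u : Γ →* (E ≃ₗᵢ[ℂ] E)}
    {R : Γ →* (F ≃ₗᵢ[ℂ] F)} (W : E ≃ₗᵢ[ℂ] HilbertSum X F)
    (Φ : reducedCrossedProduct X R ≃⋆ₐ[ℂ] roeAlgebra ρ u) : Prop :=
  ∀ k : (g : CoarseGroupoid Γ X) → Fiber R g.s, IsCompactlySupportedSection R k →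
    ∃ T : reducedCrossedProduct X R, IsRegularRep k T.1 ∧
      HasKernel k (W.toContinuousLinearEquiv.toContinuousLinearMap ∘L (Φ T).1 ∘L
        W.symm.toContinuousLinearEquiv.toContinuousLinearMap)

end Canonical

end EquivariantCoarse

open EquivariantCoarse

set_option linter.unusedSectionVars false

/-! Both algebras complete the same *-algebra. An operator in the algebraic Roe algebra of the
standard module is the same thing as an equivariant kernel T(x, y) with compact values, supported in
a strip d(x, y) ≤ r (`isRoeOperator_iff`). Such a kernel lives on the dense set of pairs [x, y] of
the groupoid; it extends to a continuous compactly supported section, and every such section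
restricts to such a kernel (`IsBandOperator.exists_section`,
`IsCompactlySupportedSection.exists_isBandOperator`). What remains is to compare products, adjoints
and norms.

The tool is a concrete description of G_ω. By freeness and bounded geometry every g in G_ω is the
limit of [f x, x], as [x] → ω, for an equivariant map f : X → X whose values near ω are determined
by g (`CoarseGroupoid.rep_spec`, `eventuallyAt_eq_of_germ_eq`). Writing g x for f x, the element
gh⁻¹ is the limit of [g x, h x], and π_ω(k) is the matrix whose entry at (g, h) is the class in A_ω
of x ↦ T(g x, h x) (`Represents.isRegularRep`).

The norms agree. For x near ω, finitely many elements of G_ω take distinct values at x, so a finite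
block of the matrix, evaluated at x, is a finite block of T; hence ‖π_ω(k)‖ ≤ ‖T‖ for every ω
(`IsBandOperator.norm_sum_entry_le`). Conversely, at ω = [y] the points [x, y] of G_ω reproduce all
of X and A_ω is 𝒦, and applying π_ω(k) to rank one operators recovers every finite block of T
(`norm_le_of_isFamily`).

The pairs (π(k), T) therefore form a *-subalgebra of a product on which the two coordinates have
equal norm, and its closure is the graph of Φ (`exists_starAlgEquiv_of_correspondence`). Uniqueness
holds because sections generate the crossed product and a kernel determines its operator. For an
ample module E, the range of each projection ρ(δ_x) is separable and infinite-dimensional, hence a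
copy of F; identifying it with F at one point of each orbit and transporting by the free action
assembles W (`IsAmpleModule.exists_isModuleIso`). -/

namespace EquivariantCoarse

section

/-! ### Operators on ℓ²(I) ⊗ B given by matrices. -/

section MatrixOperators

variable {I B : Type*} [NonUnitalCStarAlgebra B]

namespace L2

theorem sub_cut_apply (s : Finset I) (ξ : L2 I B) (i : I) [Decidable (i ∈ s)] :
    (ξ - cut s ξ) i = if i ∈ s then 0 else ξ i := by
  classical
  rw [sub_apply]
  by_cases hi : i ∈ s <;> simp [cut, hi]

theorem norm_sub_cut_le {s : Finset I} {ξ : L2 I B} {ε : ℝ} (hε : 0 ≤ ε)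
    (h : ∀ t, Disjoint t s → ‖∑ i ∈ t, star (ξ i) * ξ i‖ ≤ ε ^ 2) : ‖ξ - cut s ξ‖ ≤ ε := by
  classical
  refine norm_le_of_sum_le _ hε fun t => ?_
  have : ∑ i ∈ t, star ((ξ - cut s ξ) i) * (ξ - cut s ξ) i = ∑ i ∈ t \ s, star (ξ i) * ξ i := by
    rw [Finset.sdiff_eq_filter, Finset.sum_filter]
    refine Finset.sum_congr rfl fun i _ => ?_
    rw [sub_cut_apply]
    by_cases hi : i ∈ s <;> simp [hi]
  rw [this]
  exact h _ Finset.sdiff_disjoint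

theorem exists_norm_sub_cut_le (ξ : L2 I B) {ε : ℝ} (hε : 0 < ε) :
    ∃ s : Finset I, ∀ t, s ⊆ t → ‖ξ - cut t ξ‖ ≤ ε := by
  obtain ⟨s, hs⟩ := summable_iff_vanishing_norm.1 ξ.summable_self (ε ^ 2) (by positivity)
  exact ⟨s, fun t hst => norm_sub_cut_le hε.le fun t' ht' =>
    (hs t' (ht'.mono_right hst)).le⟩

theorem tendsto_cut (ξ : L2 I B) :
    Filter.Tendsto (fun s => cut s ξ) Filter.atTop (nhds ξ) := by
  classical
  refine Metric.tendsto_atTop.2 fun ε hε => ?_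
  obtain ⟨s, hs⟩ := exists_norm_sub_cut_le ξ (half_pos hε)
  refine ⟨s, fun t ht => ?_⟩
  rw [dist_comm, dist_eq_norm]
  exact (hs t ht).trans_lt (half_lt_self hε)

theorem continuous_inner (ξ : L2 I B) : Continuous (inner ξ) := by
  refine (LipschitzWith.of_dist_le_mul (K := ‖ξ‖₊) fun η ζ => ?_).continuous
  rw [dist_eq_norm, dist_eq_norm, ← inner_sub_right]
  exact norm_inner_le _ _

theorem inner_cut_right (s : Finset I) (ξ η : L2 I B) :
    inner ξ (cut s η) = ∑ i ∈ s, star (ξ i) * η i := by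
  classical
  rw [inner, tsum_eq_sum (s := s) fun i hi => by simp [cut, hi]]
  exact Finset.sum_congr rfl fun i hi => by simp [cut, hi]

theorem hasSum_mul_cut (M : I → B) (s : Finset I) (f : I → B) :
    HasSum (fun j => M j * cut s f j) (∑ j ∈ s, M j * f j) := by
  classical
  have h : ∑ j ∈ s, M j * f j = ∑ j ∈ s, M j * cut s f j :=
    Finset.sum_congr rfl fun j hj => by simp [cut, hj]
  rw [h]
  exact hasSum_sum_of_ne_finset_zero fun i hi => by simp [cut, hi]

/-- Operators whose matrices are adjoint to each other are adjoint to each other. -/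
theorem inner_eq_of_hasSum {M : I → I → B} {T S : L2 I B → L2 I B}
    (hS' : Continuous S)
    (hT : ∀ ξ i, HasSum (fun j => M i j * ξ j) (T ξ i))
    (hS : ∀ ξ i, HasSum (fun j => star (M j i) * ξ j) (S ξ i)) (ξ η : L2 I B) :
    inner (T ξ) η = inner ξ (S η) := by
  -- For finitely supported η the pairing involves finitely many rows, so the double sum may be
  -- reordered. Continuity of S then gives the general case.
  have key : ∀ s : Finset I, inner (T ξ) (cut s η) = inner ξ (S (cut s η)) := fun s => by
    rw [inner_cut_right]
    have h1 : HasSum (fun j => ∑ i ∈ s, star (M i j * ξ j) * η i) (∑ i ∈ s, star (T ξ i) * η i) :=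
      hasSum_sum fun i _ => (hT ξ i).star.mul_right _
    rw [← h1.tsum_eq, inner]
    refine tsum_congr fun j => ?_
    rw [(hS (cut s η) j).unique (hasSum_mul_cut (fun i => star (M i j)) s η), Finset.mul_sum]
    exact Finset.sum_congr rfl fun i _ => by rw [star_mul, mul_assoc]
  refine tendsto_nhds_unique (((continuous_inner (T ξ)).tendsto _).comp (tendsto_cut η)) ?_
  exact ((((continuous_inner ξ).comp hS').tendsto _).comp (tendsto_cut η)).congr
    fun s => (key s).symm

/-- A matrix with finite rows and columns whose finite blocks are bounded by `C` defines an
operator on `ℓ²(I) ⊗ B`. -/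
theorem exists_continuousLinearMap_of_matrix {M : I → I → B} {C : ℝ} (hC : 0 ≤ C)
    (hrow : ∀ i, {j | M i j ≠ 0}.Finite) (hcol : ∀ j, {i | M i j ≠ 0}.Finite)
    (hM : ∀ (s t : Finset I) (ξ : I → B),
      ‖∑ i ∈ t, star (∑ j ∈ s, M i j * ξ j) * ∑ j ∈ s, M i j * ξ j‖ ≤
        C ^ 2 * ‖∑ j ∈ s, star (ξ j) * ξ j‖) :
    ∃ T : L2 I B →L[ℂ] L2 I B, ‖T‖ ≤ C ∧ ∀ ξ i, HasSum (fun j => M i j * ξ j) (T ξ i) := by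
  classical
  let m : L2 I B → I → B := fun ξ i => ∑' j, M i j * ξ j
  have hm : ∀ ξ i, HasSum (fun j => M i j * ξ j) (m ξ i) := fun ξ i => by
    refine (summable_of_ne_finset_zero (s := (hrow i).toFinset) fun j hj => ?_).hasSum
    have : M i j = 0 := by simpa using hj
    rw [this, zero_mul]
  -- Finitely many rows meet only finitely many columns, which is what lets the bound on finite
  -- blocks apply.
  have hm' : ∀ ξ (t : Finset I), ∃ s : Finset I, ∀ i ∈ t, m ξ i = ∑ j ∈ s, M i j * ξ j := by
    intro ξ t
    refine ⟨t.biUnion fun i => (hrow i).toFinset, fun i hi => tsum_eq_sum fun j hj => ?_⟩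
    have : M i j = 0 := by
      by_contra h
      exact hj (Finset.mem_biUnion.2 ⟨i, hi, (hrow i).mem_toFinset.2 h⟩)
    rw [this, zero_mul]
  have hb : ∀ ξ (t : Finset I), ‖∑ i ∈ t, star (m ξ i) * m ξ i‖ ≤ (C * ‖ξ‖) ^ 2 := by
    intro ξ t
    obtain ⟨s, hs⟩ := hm' ξ t
    rw [Finset.sum_congr rfl fun i hi => by rw [hs i hi], mul_pow]
    refine (hM s t ξ).trans ?_
    gcongr
    exact norm_sum_le ξ s
  -- Bounded partial sums do not imply norm convergence in B. Instead, rows outside the support of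
  -- the columns in a large finite set s see only the tail of ξ, and `hb` is applied to that tail.
  have hmem : ∀ ξ, Summable fun i => star (m ξ i) * m ξ i := by
    intro ξ
    rw [summable_iff_vanishing_norm]
    intro ε hε
    obtain ⟨s, hs⟩ := exists_norm_sub_cut_le ξ (show 0 < √ε / (2 * (C + 1)) by positivity)
    refine ⟨s.biUnion fun j => (hcol j).toFinset, fun t ht => ?_⟩
    have h1 : ∀ i ∈ t, m ξ i = m (ξ - cut s ξ) i := by
      intro i hi
      refine tsum_congr fun j => ?_
      rw [sub_cut_apply]
      split_ifs with hj
      · have : M i j = 0 := by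
          by_contra h
          exact Finset.disjoint_left.1 ht hi
            (Finset.mem_biUnion.2 ⟨j, hj, (hcol j).mem_toFinset.2 h⟩)
        rw [this, zero_mul, zero_mul]
      · rfl
    rw [Finset.sum_congr rfl fun i hi => by rw [h1 i hi]]
    refine (hb _ t).trans_lt ?_
    have h2 : C * ‖ξ - cut s ξ‖ ≤ √ε / 2 := by
      calc C * ‖ξ - cut s ξ‖ ≤ (C + 1) * (√ε / (2 * (C + 1))) := by
            gcongr
            · linarith
            · exact hs s subset_rfl
        _ = √ε / 2 := by field_simp
    calc _ ≤ (√ε / 2) ^ 2 := pow_le_pow_left₀ (by positivity) h2 2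
      _ = ε / 4 := by rw [div_pow, Real.sq_sqrt hε.le]; norm_num
      _ < ε := by linarith
  let T₀ : L2 I B →ₗ[ℂ] L2 I B :=
    { toFun := fun ξ => mk (m ξ) (hmem ξ)
      map_add' := fun ξ η => by
        ext i
        rw [mk_apply, add_apply, mk_apply, mk_apply]
        refine (hm _ i).unique (((hm ξ i).add (hm η i)).congr_fun fun j => ?_)
        rw [add_apply, mul_add]
      map_smul' := fun c ξ => by
        ext i
        rw [mk_apply, RingHom.id_apply, smul_apply, mk_apply]
        refine (hm _ i).unique (((hm ξ i).const_smul c).congr_fun fun j => ?_)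
        rw [smul_apply, mul_smul_comm] }
  refine ⟨T₀.mkContinuous C fun ξ => ?_, LinearMap.mkContinuous_norm_le _ hC _, hm⟩
  exact norm_le_of_sum_le _ (by positivity) (hb ξ)

/-- A bounded operator on a Hilbert module need not have an adjoint, so the adjoint is built from
the conjugate transpose matrix, with its own block bound `hM'`. -/
theorem exists_adjointable_of_matrix {M : I → I → B} {C : ℝ} (hC : 0 ≤ C)
    (hrow : ∀ i, {j | M i j ≠ 0}.Finite) (hcol : ∀ j, {i | M i j ≠ 0}.Finite)
    (hM : ∀ (s t : Finset I) (ξ : I → B),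
      ‖∑ i ∈ t, star (∑ j ∈ s, M i j * ξ j) * ∑ j ∈ s, M i j * ξ j‖ ≤
        C ^ 2 * ‖∑ j ∈ s, star (ξ j) * ξ j‖)
    (hM' : ∀ (s t : Finset I) (ξ : I → B),
      ‖∑ i ∈ t, star (∑ j ∈ s, star (M j i) * ξ j) * ∑ j ∈ s, star (M j i) * ξ j‖ ≤
        C ^ 2 * ‖∑ j ∈ s, star (ξ j) * ξ j‖) :
    ∃ T : Adjointable I B, ‖T‖ ≤ C ∧ ∀ ξ i, HasSum (fun j => M i j * ξ j) (T.1 ξ i) := by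
  obtain ⟨T, hTC, hT⟩ := exists_continuousLinearMap_of_matrix hC hrow hcol hM
  obtain ⟨S, -, hS⟩ := exists_continuousLinearMap_of_matrix (M := fun i j => star (M j i)) hC
    (by simpa using hcol) (by simpa using hrow) hM'
  exact ⟨⟨T, S, inner_eq_of_hasSum S.continuous hT hS⟩, hTC, hT⟩

end L2

end MatrixOperators

end

section

/-! ### Operators on ℓ²(X) ⊗ F and their kernels. -/

section Kernels

variable {X F : Type*} [NormedAddCommGroup F] [InnerProductSpace ℂ F]

namespace HilbertSum

/-- The inclusion of the summand with index `x`. -/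
noncomputable def single (x : X) : F →L[ℂ] HilbertSum X F :=
  open Classical in lp.singleContinuousLinearMap ℂ (fun _ : X => F) 2 x

/-- The projection to the summand with index `x`. -/
noncomputable def eval (x : X) : HilbertSum X F →L[ℂ] F := lp.evalCLM ℂ (fun _ : X => F) 2 x

@[simp] theorem eval_apply (x : X) (ξ : HilbertSum X F) : eval x ξ = ξ x := rfl

@[simp] theorem single_apply_self (x : X) (v : F) : single x v x = v := by
  classical
  exact lp.single_apply_self (E := fun _ : X => F) 2 x v

theorem single_apply_of_ne {x y : X} (h : y ≠ x) (v : F) : single x v y = 0 := by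
  classical
  exact lp.single_apply_ne (E := fun _ : X => F) 2 x v h

theorem norm_single (x : X) (v : F) : ‖single x v‖ = ‖v‖ := by
  classical
  exact lp.norm_single (E := fun _ : X => F) (p := 2) (by norm_num) x v

theorem hasSum_single (ξ : HilbertSum X F) : HasSum (fun x => single x (ξ x)) ξ := by
  classical
  exact lp.hasSum_single (by norm_num) ξ

theorem hasSum_norm_sq (ξ : HilbertSum X F) : HasSum (fun x => ‖ξ x‖ ^ 2) (‖ξ‖ ^ 2) := by
  simpa using lp.hasSum_norm (p := 2) (by norm_num) ξ

theorem sum_norm_sq_le (ξ : HilbertSum X F) (s : Finset X) : ∑ x ∈ s, ‖ξ x‖ ^ 2 ≤ ‖ξ‖ ^ 2 :=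
  sum_le_hasSum s (fun _ _ => by positivity) (hasSum_norm_sq ξ)

theorem norm_sum_single_sq {J : Type*} {f : J → X} (s : Finset J) (hf : Set.InjOn f s)
    (v : J → F) : ‖∑ j ∈ s, single (f j) (v j)‖ ^ 2 = ∑ j ∈ s, ‖v j‖ ^ 2 := by
  classical
  have h1 : ∀ j ∈ s, (∑ i ∈ s, single (f i) (v i)) (f j) = v j := fun j hj => by
    rw [← eval_apply, map_sum, Finset.sum_eq_single_of_mem j hj]
    · simp
    · intro i hi hij
      exact single_apply_of_ne (fun h => hij (hf hi hj h.symm)) _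
  have h2 := (hasSum_norm_sq (∑ i ∈ s, single (f i) (v i))).unique
    (hasSum_sum_of_ne_finset_zero (s := s.image f) fun x hx => ?_)
  · rw [h2, Finset.sum_image hf]
    exact Finset.sum_congr rfl fun j hj => by rw [h1 j hj]
  · rw [← eval_apply, map_sum, Finset.sum_eq_zero, norm_zero, zero_pow two_ne_zero]
    intro i hi
    refine single_apply_of_ne (fun h => hx ?_) _
    rw [h]
    exact Finset.mem_image_of_mem f hi

/-- The matrix coefficient of an operator on `ℓ²(X) ⊗ F`. -/
noncomputable def kernel (T : HilbertSum X F →L[ℂ] HilbertSum X F) (x y : X) : F →L[ℂ] F :=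
  eval x ∘L T ∘L single y

theorem kernel_apply (T : HilbertSum X F →L[ℂ] HilbertSum X F) (x y : X) (v : F) :
    kernel T x y v = T (single y v) x := rfl

theorem hasSum_kernel (T : HilbertSum X F →L[ℂ] HilbertSum X F) (ξ : HilbertSum X F) (x : X) :
    HasSum (fun y => kernel T x y (ξ y)) (T ξ x) :=
  (hasSum_single ξ).mapL (eval x ∘L T)

theorem kernel_ext {T S : HilbertSum X F →L[ℂ] HilbertSum X F}
    (h : ∀ x y, kernel T x y = kernel S x y) : T = S := by
  ext ξ x
  refine (hasSum_kernel T ξ x).unique ?_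
  simp only [h]
  exact hasSum_kernel S ξ x

theorem norm_kernel_le (T : HilbertSum X F →L[ℂ] HilbertSum X F) (x y : X) :
    ‖kernel T x y‖ ≤ ‖T‖ := by
  refine ContinuousLinearMap.opNorm_le_bound _ T.opNorm_nonneg fun v => ?_
  rw [kernel_apply]
  refine (lp.norm_apply_le_norm (by norm_num) _ x).trans ((T.le_opNorm _).trans_eq ?_)
  rw [norm_single]

theorem kernel_add (T S : HilbertSum X F →L[ℂ] HilbertSum X F) (x y : X) :
    kernel (T + S) x y = kernel T x y + kernel S x y := rfl

theorem kernel_smul (c : ℂ) (T : HilbertSum X F →L[ℂ] HilbertSum X F) (x y : X) :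
    kernel (c • T) x y = c • kernel T x y := rfl

theorem hasSum_kernel_mul (T S : HilbertSum X F →L[ℂ] HilbertSum X F) (x y : X) (v : F) :
    HasSum (fun z => kernel T x z (kernel S z y v)) (kernel (T * S) x y v) :=
  hasSum_kernel T (S (single y v)) x

theorem inner_single_left (x : X) (v : F) (ξ : HilbertSum X F) :
    inner ℂ (single x v) ξ = inner ℂ v (ξ x) := by
  classical
  exact lp.inner_single_left (𝕜 := ℂ) (G := fun _ : X => F) x v ξ

theorem kernel_star [CompleteSpace F] (T : HilbertSum X F →L[ℂ] HilbertSum X F) (x y : X) :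
    kernel (star T) x y = star (kernel T y x) := by
  refine ContinuousLinearMap.ext fun v => ext_inner_left ℂ fun w => ?_
  rw [kernel_apply, ← inner_single_left, ContinuousLinearMap.star_eq_adjoint,
    ContinuousLinearMap.adjoint_inner_right, ContinuousLinearMap.star_eq_adjoint,
    ContinuousLinearMap.adjoint_inner_right, kernel_apply, ← inner_conj_symm, inner_single_left,
    inner_conj_symm]

/-- Injectivity of f on s makes the vectors `single (f j) (v j)` orthogonal, and on t it keeps
coordinates from being counted twice. The index set J will be a source fibre G_ω, with f the
evaluation of representatives at a point. -/
theorem sum_norm_kernel_sq_le (T : HilbertSum X F →L[ℂ] HilbertSum X F) {J : Type*} {f : J → X}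
    (s t : Finset J) (hs : Set.InjOn f s) (ht : Set.InjOn f t) (v : J → F) :
    ∑ i ∈ t, ‖∑ j ∈ s, kernel T (f i) (f j) (v j)‖ ^ 2 ≤ ‖T‖ ^ 2 * ∑ j ∈ s, ‖v j‖ ^ 2 := by
  classical
  rw [← norm_sum_single_sq s hs v, ← mul_pow]
  calc _ = ∑ x ∈ t.image f, ‖T (∑ j ∈ s, single (f j) (v j)) x‖ ^ 2 := by
        rw [Finset.sum_image ht]
        refine Finset.sum_congr rfl fun i _ => ?_
        rw [← eval_apply, map_sum, map_sum]
        rfl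
    _ ≤ _ := sum_norm_sq_le _ _
    _ ≤ _ := pow_le_pow_left₀ (norm_nonneg _) (T.le_opNorm _) 2

/-- A bounded kernel supported near the diagonal of a space of bounded geometry is the kernel of
a bounded operator. -/
theorem exists_kernel_eq [MetricSpace X] (hX : BoundedGeometry X) {K : X → X → F →L[ℂ] F} {C r : ℝ}
    (hC : ∀ x y, ‖K x y‖ ≤ C) (hr : ∀ x y, r < dist x y → K x y = 0) :
    ∃ T : HilbertSum X F →L[ℂ] HilbertSum X F, ∀ x y, kernel T x y = K x y := by
  classical
  obtain ⟨N, hN⟩ := hX r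
  have hfin : ∀ x, (Metric.closedBall x r).Finite := fun x => Set.finite_of_encard_le_coe (hN x)
  let B : X → Finset X := fun x => (hfin x).toFinset
  have hmemB : ∀ x y, y ∈ B x ↔ dist x y ≤ r := fun x y => by simp [B, dist_comm]
  have hB : ∀ x, (B x).card ≤ N := fun x => by
    have := hN x
    rwa [(hfin x).encard_eq_coe_toFinset_card, Nat.cast_le] at this
  let m : HilbertSum X F → X → F := fun ξ x => ∑ y ∈ B x, K x y (ξ y)
  have hb : ∀ ξ (t : Finset X), ∑ x ∈ t, ‖m ξ x‖ ^ 2 ≤ (N * |C| * ‖ξ‖) ^ 2 := by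
    intro ξ t
    -- Cauchy–Schwarz over a ball with at most N points; the second factor N in the final bound
    -- comes from `h3`.
    have h1 : ∀ x, ‖m ξ x‖ ^ 2 ≤ N * C ^ 2 * ∑ y ∈ B x, ‖ξ y‖ ^ 2 := by
      intro x
      have h2 : ‖m ξ x‖ ≤ ∑ y ∈ B x, |C| * ‖ξ y‖ := by
        refine (norm_sum_le _ _).trans (Finset.sum_le_sum fun y _ => ?_)
        refine ((K x y).le_opNorm _).trans ?_
        gcongr
        exact (hC x y).trans (le_abs_self C)
      calc ‖m ξ x‖ ^ 2 ≤ (∑ y ∈ B x, |C| * ‖ξ y‖) ^ 2 := pow_le_pow_left₀ (norm_nonneg _) h2 2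
        _ ≤ (B x).card * ∑ y ∈ B x, (|C| * ‖ξ y‖) ^ 2 := sq_sum_le_card_mul_sum_sq
        _ ≤ N * ∑ y ∈ B x, (|C| * ‖ξ y‖) ^ 2 := by
            gcongr
            exact hB x
        _ = _ := by
            simp only [mul_pow, sq_abs, ← Finset.mul_sum]
            ring
    -- After the order of summation is exchanged, each y is counted at most N times, since x ∈ B y
    -- is symmetric in x and y.
    have h3 : ∑ x ∈ t, ∑ y ∈ B x, ‖ξ y‖ ^ 2 ≤ N * ‖ξ‖ ^ 2 := by
      have h4 : ∑ x ∈ t, ∑ y ∈ B x, ‖ξ y‖ ^ 2 =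
          ∑ y ∈ t.biUnion B, ∑ x ∈ t with x ∈ B y, ‖ξ y‖ ^ 2 := by
        refine Finset.sum_comm' fun x y => ?_
        simp only [Finset.mem_filter, Finset.mem_biUnion, hmemB]
        constructor
        · rintro ⟨hx, hxy⟩
          exact ⟨⟨hx, by rwa [dist_comm]⟩, x, hx, hxy⟩
        · rintro ⟨⟨hx, hyx⟩, -⟩
          exact ⟨hx, by rwa [dist_comm]⟩
      rw [h4]
      calc _ ≤ ∑ y ∈ t.biUnion B, N * ‖ξ y‖ ^ 2 := by
            refine Finset.sum_le_sum fun y _ => ?_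
            rw [Finset.sum_const, nsmul_eq_mul]
            gcongr
            refine le_trans (Finset.card_le_card fun x hx => ?_) (hB y)
            exact (Finset.mem_filter.1 hx).2
        _ ≤ _ := by
            rw [← Finset.mul_sum]
            gcongr
            exact sum_norm_sq_le _ _
    calc _ ≤ ∑ x ∈ t, N * C ^ 2 * ∑ y ∈ B x, ‖ξ y‖ ^ 2 := Finset.sum_le_sum fun x _ => h1 x
      _ ≤ N * C ^ 2 * (N * ‖ξ‖ ^ 2) := by
          rw [← Finset.mul_sum]
          gcongr
      _ = _ := by rw [mul_pow, mul_pow, sq_abs]; ring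
  have hmem : ∀ ξ, Memℓp (m ξ) 2 := fun ξ => memℓp_gen' (C := (N * |C| * ‖ξ‖) ^ 2) fun t => by
    simpa using hb ξ t
  let T₀ : HilbertSum X F →ₗ[ℂ] HilbertSum X F :=
    { toFun := fun ξ => ⟨m ξ, hmem ξ⟩
      map_add' := fun ξ η => lp.ext <| funext fun x => by
        change ∑ y ∈ B x, K x y (ξ y + η y) = ∑ y ∈ B x, K x y (ξ y) + ∑ y ∈ B x, K x y (η y)
        simp only [map_add, Finset.sum_add_distrib]
      map_smul' := fun c ξ => lp.ext <| funext fun x => by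
        change ∑ y ∈ B x, K x y (c • ξ y) = c • ∑ y ∈ B x, K x y (ξ y)
        simp only [map_smul, Finset.smul_sum] }
  refine ⟨T₀.mkContinuous (N * |C|) fun ξ => ?_, fun x y => ?_⟩
  · rw [← pow_le_pow_iff_left₀ (norm_nonneg _) (by positivity) two_ne_zero]
    exact le_of_tendsto' (hasSum_norm_sq (T₀ ξ)) (hb ξ)
  · ext v
    change ∑ z ∈ B x, K x z (single y v z) = K x y v
    by_cases hy : y ∈ B x
    · rw [Finset.sum_eq_single_of_mem y hy, single_apply_self]
      intro z _ hz
      rw [single_apply_of_ne hz, map_zero]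
    · rw [hr x y (not_le.1 fun h => hy ((hmemB x y).2 h)), Finset.sum_eq_zero]
      · rfl
      · intro z hz
        have hzy : z ≠ y := fun h => hy (h ▸ hz)
        rw [single_apply_of_ne hzy, map_zero]

end HilbertSum

end Kernels

end

section

/-! ### Roe operators on the standard module are band operators. -/

section RoeOperators

theorem BoundedGeometry.finite_closedBall {X : Type*} [MetricSpace X] (hX : BoundedGeometry X)
    (x : X) (r : ℝ) : (Metric.closedBall x r).Finite := by
  obtain ⟨N, hN⟩ := hX r
  exact Set.finite_of_encard_le_coe (hN x)

theorem BoundedGeometry.discreteTopology {X : Type*} [MetricSpace X] (hX : BoundedGeometry X) :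
    DiscreteTopology X := by
  refine discreteTopology_iff_isOpen_singleton.2 fun x => ?_
  have h1 : IsClosed (Metric.closedBall x 1 \ {x}) := ((hX.finite_closedBall x 1).sdiff).isClosed
  have h2 : ({x} : Set X) = Metric.ball x 1 ∩ (Metric.closedBall x 1 \ {x})ᶜ := by
    ext y
    simp only [Set.mem_singleton_iff, Set.mem_inter_iff, Metric.mem_ball, Set.mem_compl_iff,
      Set.mem_sdiff, Metric.mem_closedBall, not_and, not_not]
    refine ⟨?_, fun h => h.2 h.1.le⟩
    rintro rfl
    simp
  rw [h2]
  exact Metric.isOpen_ball.inter h1.isOpen_compl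

/-- The indicator function of a point of a discrete space. -/
noncomputable def delta {X : Type*} [TopologicalSpace X] [DiscreteTopology X] (x : X) : C₀(X, ℂ) :=
  open Classical in
  { toFun := Pi.single x 1
    continuous_toFun := continuous_of_discreteTopology
    zero_at_infty' := by
      rw [Filter.cocompact_eq_cofinite]
      refine tendsto_const_nhds.congr' ?_
      filter_upwards [(Set.finite_singleton x).compl_mem_cofinite] with y hy
      have hy : y ≠ x := hy
      simp [hy] }

@[simp] theorem delta_apply_self {X : Type*} [TopologicalSpace X] [DiscreteTopology X] (x : X) :
    delta x x = 1 := by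
  classical
  exact Pi.single_eq_same (M := fun _ : X => ℂ) x 1

theorem delta_apply_of_ne {X : Type*} [TopologicalSpace X] [DiscreteTopology X] {x y : X}
    (h : y ≠ x) : delta x y = 0 := by
  classical
  exact Pi.single_eq_of_ne (M := fun _ : X => ℂ) h 1

theorem tsupport_delta {X : Type*} [TopologicalSpace X] [DiscreteTopology X] (x : X) :
    tsupport (delta x) = {x} := by
  rw [tsupport, closure_discrete]
  ext y
  by_cases h : y = x
  · subst h
    simp
  · simp [h, delta_apply_of_ne h]

/-- On a discrete space the cocompact filter is the cofinite one, so {‖f‖ ≥ ε} is finite and f may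
be cut off outside it. -/
theorem exists_norm_sub_sum_delta_le {X : Type*} [TopologicalSpace X] [DiscreteTopology X]
    (f : C₀(X, ℂ)) {ε : ℝ} (hε : 0 < ε) :
    ∃ s : Finset X, ‖f - ∑ x ∈ s, f x • delta x‖ ≤ ε := by
  classical
  have h := f.zero_at_infty'
  rw [Filter.cocompact_eq_cofinite] at h
  have h1 := h (Metric.ball_mem_nhds 0 hε)
  rw [Filter.mem_map, Filter.mem_cofinite] at h1
  refine ⟨h1.toFinset, ?_⟩
  rw [← ZeroAtInftyContinuousMap.norm_toBCF_eq_norm, BoundedContinuousFunction.norm_le hε.le]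
  intro y
  have hsum : (∑ x ∈ h1.toFinset, f x • delta x) y = ∑ x ∈ h1.toFinset, f x * delta x y := by
    have : ∀ s : Finset X, (∑ x ∈ s, f x • delta x) y = ∑ x ∈ s, f x * delta x y := fun s => by
      induction s using Finset.induction_on with
      | empty => simp
      | insert a s ha ih => rw [Finset.sum_insert ha, Finset.sum_insert ha, ← ih]; rfl
    exact this _
  change ‖f y - (∑ x ∈ h1.toFinset, f x • delta x) y‖ ≤ ε
  rw [hsum]
  by_cases hy : y ∈ h1.toFinset
  · rw [Finset.sum_eq_single_of_mem y hy fun x _ hx => by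
      rw [delta_apply_of_ne hx.symm, mul_zero], delta_apply_self, mul_one, sub_self, norm_zero]
    exact hε.le
  · rw [Finset.sum_eq_zero fun x hx => by
      have hyx : y ≠ x := fun h => hy (h ▸ hx)
      rw [delta_apply_of_ne hyx, mul_zero], sub_zero]
    have : ‖f y‖ < ε := by simpa using hy
    exact this.le

variable {Γ X F : Type*} [Group Γ] [MetricSpace X] [MulAction Γᵐᵒᵖ X]
  [NormedAddCommGroup F] [InnerProductSpace ℂ F] [CompleteSpace F]

open HilbertSum

/-- Operators on `ℓ²(X) ⊗ F` whose kernel is equivariant, takes compact values and is supported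
near the diagonal. -/
structure IsBandOperator (R : Γ →* (F ≃ₗᵢ[ℂ] F)) (T : HilbertSum X F →L[ℂ] HilbertSum X F) :
    Prop where
  propagation : ∃ r : ℝ≥0, ∀ x y, r < dist x y → kernel T x y = 0
  compact : ∀ x y, IsCompactOperator (kernel T x y)
  equivariant : ∀ γ x y v,
    R γ (kernel T (MulOpposite.op γ • x) (MulOpposite.op γ • y) ((R γ).symm v)) = kernel T x y v

variable {R : Γ →* (F ≃ₗᵢ[ℂ] F)}

theorem diagonalRep_symm_single (γ : Γ) (y : X) (v : F) :
    (diagonalRep X R γ).symm (single y v) = single (MulOpposite.op γ • y) ((R γ).symm v) := by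
  rw [LinearIsometryEquiv.symm_apply_eq]
  refine lp.ext (funext fun x => ?_)
  change _ = R γ (single (MulOpposite.op γ • y) ((R γ).symm v) (MulOpposite.op γ • x))
  by_cases h : x = y
  · subst h
    simp
  · rw [single_apply_of_ne h, single_apply_of_ne (fun h' => h (smul_left_cancel _ h')), map_zero]

theorem diagonalRep_conj_single (T : HilbertSum X F →L[ℂ] HilbertSum X F) (γ : Γ) (x y : X)
    (v : F) : diagonalRep X R γ (T ((diagonalRep X R γ).symm (single y v))) x =
      R γ (kernel T (MulOpposite.op γ • x) (MulOpposite.op γ • y) ((R γ).symm v)) := by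
  rw [diagonalRep_symm_single]
  rfl

theorem invariant_iff_kernel (T : HilbertSum X F →L[ℂ] HilbertSum X F) :
    (∀ γ ξ, diagonalRep X R γ (T ((diagonalRep X R γ).symm ξ)) = T ξ) ↔ ∀ γ x y v,
      R γ (kernel T (MulOpposite.op γ • x) (MulOpposite.op γ • y) ((R γ).symm v)) =
        kernel T x y v := by
  refine ⟨fun h γ x y v => ?_, fun h γ => ?_⟩
  · rw [← diagonalRep_conj_single, h]
    rfl
  · let S : HilbertSum X F →L[ℂ] HilbertSum X F :=
      (diagonalRep X R γ).toContinuousLinearEquiv.toContinuousLinearMap ∘L T ∘L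
        (diagonalRep X R γ).symm.toContinuousLinearEquiv.toContinuousLinearMap
    have hS : S = T := kernel_ext fun x y => ContinuousLinearMap.ext fun v => by
      rw [← h γ, ← diagonalRep_conj_single]
      rfl
    exact fun ξ => congrArg (fun A : HilbertSum X F →L[ℂ] HilbertSum X F => A ξ) hS

theorem mulRep_apply (f : C₀(X, ℂ)) (ξ : HilbertSum X F) (x : X) :
    mulRep (ι := X) (E := F) f ξ x = f x • ξ x := rfl

theorem mulRep_single (f : C₀(X, ℂ)) (y : X) (v : F) :
    mulRep (ι := X) (E := F) f (single y v) = f y • single y v := by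
  refine lp.ext (funext fun x => ?_)
  change f x • single y v x = f y • single y v x
  by_cases h : x = y
  · rw [h]
  · rw [single_apply_of_ne h, smul_zero, smul_zero]

theorem mulRep_delta [DiscreteTopology X] (x : X) :
    mulRep (ι := X) (E := F) (delta x) = (single x ∘L eval x : HilbertSum X F →L[ℂ] HilbertSum X F) := by
  refine ContinuousLinearMap.ext fun ξ => lp.ext (funext fun y => ?_)
  change delta x y • ξ y = single x (ξ x) y
  by_cases h : y = x
  · subst h
    simp
  · rw [single_apply_of_ne h, delta_apply_of_ne h, zero_smul]

theorem lt_biInf_edist {f g : C₀(X, ℂ)} {r : ℝ≥0} {x y : X}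
    (h : (r : ℝ≥0∞) < ⨅ x ∈ tsupport f, ⨅ y ∈ tsupport g, edist x y) (hx : f x ≠ 0)
    (hy : g y ≠ 0) : r < dist x y := by
  have h1 : (r : ℝ≥0∞) < edist x y :=
    h.trans_le ((biInf_le _ (subset_tsupport f hx)).trans (biInf_le _ (subset_tsupport g hy)))
  rwa [edist_nndist, ENNReal.coe_lt_coe, ← NNReal.coe_lt_coe, coe_nndist] at h1

theorem IsRoeOperator.isBandOperator [DiscreteTopology X]
    {T : HilbertSum X F →L[ℂ] HilbertSum X F}
    (hT : IsRoeOperator mulRep (diagonalRep X R) T) : IsBandOperator R T where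
  propagation := by
    obtain ⟨r, hr⟩ := hT.finitePropagation
    refine ⟨r, fun x y hxy => ContinuousLinearMap.ext fun v => ?_⟩
    -- Finite propagation is tested on indicator functions of points, which are continuous because X
    -- is discrete.
    have h1 := hr (delta x) (delta y) (by
      rw [tsupport_delta, tsupport_delta, iInf_singleton, iInf_singleton, edist_nndist,
        ENNReal.coe_lt_coe, ← NNReal.coe_lt_coe, coe_nndist]
      exact hxy)
    have h2 := congrArg (fun A : HilbertSum X F →L[ℂ] HilbertSum X F => A (single y v) x) h1
    change mulRep (ι := X) (E := F) (delta x) (T (mulRep (ι := X) (E := F) (delta y) (single y v))) x = 0 at h2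
    rw [mulRep_single, delta_apply_self, one_smul, mulRep_apply, delta_apply_self, one_smul] at h2
    exact h2
  compact x y := by
    have h1 := ((hT.locallyCompact (delta x)).1.comp_clm (single y)).clm_comp (eval x)
    rw [mulRep_delta] at h1
    refine (congrArg IsCompactOperator (funext fun v => ?_)).mp h1
    change single x (T (single y v) x) x = T (single y v) x
    rw [single_apply_self]
  equivariant := (invariant_iff_kernel T).1 hT.invariant

theorem IsBandOperator.star {T : HilbertSum X F →L[ℂ] HilbertSum X F}
    (hT : IsBandOperator R T) : IsBandOperator R (star T) where
  propagation := by
    obtain ⟨r, hr⟩ := hT.propagation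
    refine ⟨r, fun x y h => ?_⟩
    rw [kernel_star, hr y x (by rwa [dist_comm]), star_zero]
  compact x y := by
    rw [kernel_star]
    exact isCompactOperator_star (hT.compact y x)
  equivariant γ x y v := by
    have hR : ∀ (S : F ≃ₗᵢ[ℂ] F) (w z : F), inner ℂ w (S z) = inner ℂ (S.symm w) z :=
      fun S w z => by rw [← S.inner_map_map (S.symm w) z, S.apply_symm_apply]
    have hL : ∀ (S : F ≃ₗᵢ[ℂ] F) (w z : F), inner ℂ (S w) z = inner ℂ w (S.symm z) :=
      fun S w z => by rw [← S.inner_map_map w (S.symm z), S.apply_symm_apply]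
    refine ext_inner_left ℂ fun w => ?_
    rw [kernel_star, kernel_star, ContinuousLinearMap.star_eq_adjoint,
      ContinuousLinearMap.star_eq_adjoint, hR, ContinuousLinearMap.adjoint_inner_right,
      ContinuousLinearMap.adjoint_inner_right, ← hT.equivariant γ y x w, hL]

/-- A row of the kernel is supported in a ball, hence has finitely many nonzero entries, each
compact. -/
theorem IsBandOperator.isCompactOperator_eval_comp (hX : BoundedGeometry X)
    {T : HilbertSum X F →L[ℂ] HilbertSum X F} (hT : IsBandOperator R T) (x : X) :
    IsCompactOperator (eval x ∘L T) := by
  obtain ⟨r, hr⟩ := hT.propagation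
  have h1 : eval x ∘L T = ∑ y ∈ (hX.finite_closedBall x r).toFinset, kernel T x y ∘L eval y := by
    ext ξ
    rw [_root_.sum_apply]
    refine (hasSum_kernel T ξ x).unique (hasSum_sum_of_ne_finset_zero fun y hy => ?_)
    have hxy : r < dist x y := by
      rw [Set.Finite.mem_toFinset, Metric.mem_closedBall, not_le, dist_comm] at hy
      exact hy
    rw [hr x y hxy, _root_.zero_apply]
  rw [h1]
  have h2 : ∀ s : Finset X, IsCompactOperator
      (∑ y ∈ s, kernel T x y ∘L eval y : HilbertSum X F →L[ℂ] F) := fun s => by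
    classical
    induction s using Finset.induction_on with
    | empty => exact isCompactOperator_zero
    | insert a s ha ih =>
      rw [Finset.sum_insert ha]
      exact ((hT.compact x a).comp_clm (eval a)).add ih
  exact h2 _

/-- For finitely supported f this is a finite sum of compact rows; the general case follows because
compact operators are norm closed. -/
theorem IsBandOperator.isCompactOperator_mulRep_mul (hX : BoundedGeometry X)
    {T : HilbertSum X F →L[ℂ] HilbertSum X F} (hT : IsBandOperator R T) (f : C₀(X, ℂ)) :
    IsCompactOperator (mulRep (ι := X) (E := F) f * T : HilbertSum X F →L[ℂ] HilbertSum X F) := by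
  have := hX.discreteTopology
  have hcl : IsClosed {A : HilbertSum X F →L[ℂ] HilbertSum X F | IsCompactOperator A} :=
    isClosed_setOfPred_isCompactOperator
  change mulRep (ι := X) (E := F) f * T ∈ {A : HilbertSum X F →L[ℂ] HilbertSum X F | IsCompactOperator A}
  rw [← hcl.closure_eq, Metric.mem_closure_iff]
  intro ε hε
  obtain ⟨s, hs⟩ := exists_norm_sub_sum_delta_le f (show 0 < ε / (2 * (‖T‖ + 1)) by positivity)
  refine ⟨mulRep (ι := X) (E := F) (∑ x ∈ s, f x • delta x) * T, ?_, ?_⟩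
  · have h2 : ∀ s : Finset X, IsCompactOperator
        (mulRep (ι := X) (E := F) (∑ x ∈ s, f x • delta x) * T : HilbertSum X F →L[ℂ] HilbertSum X F) := fun s => by
      classical
      induction s using Finset.induction_on with
      | empty =>
        rw [Finset.sum_empty, map_zero, zero_mul]
        exact isCompactOperator_zero
      | insert a s ha ih =>
        rw [Finset.sum_insert ha, map_add, add_mul, map_smul, smul_mul_assoc, mulRep_delta]
        exact (((hT.isCompactOperator_eval_comp hX a).clm_comp (single a)).smul (f a)).add ih
    exact h2 s
  · rw [dist_eq_norm, ← sub_mul, ← map_sub]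
    calc _ ≤ ‖(mulRep (ι := X) (E := F) (f - ∑ x ∈ s, f x • delta x) : HilbertSum X F →L[ℂ] HilbertSum X F)‖ * ‖T‖ :=
          norm_mul_le _ _
      _ ≤ ε / (2 * (‖T‖ + 1)) * (‖T‖ + 1) := by
          gcongr
          · exact (NonUnitalStarAlgHom.norm_apply_le _ _).trans hs
          · linarith
      _ = ε / 2 := by field_simp
      _ < ε := half_lt_self hε

theorem IsBandOperator.isRoeOperator (hX : BoundedGeometry X)
    {T : HilbertSum X F →L[ℂ] HilbertSum X F} (hT : IsBandOperator R T) :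
    IsRoeOperator mulRep (diagonalRep X R) T where
  finitePropagation := by
    obtain ⟨r, hr⟩ := hT.propagation
    refine ⟨r, fun f g hfg => ContinuousLinearMap.ext fun ξ => lp.ext (funext fun x => ?_)⟩
    change f x • T (mulRep (ι := X) (E := F) g ξ) x = 0
    by_cases hx : f x = 0
    · rw [hx, zero_smul]
    have h1 : T (mulRep (ι := X) (E := F) g ξ) x = 0 := by
      refine (hasSum_kernel T _ x).unique ?_
      have h2 : (fun y => kernel T x y (mulRep (ι := X) (E := F) g ξ y)) = fun _ => 0 := by
        funext y
        rw [mulRep_apply]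
        by_cases hy : g y = 0
        · rw [hy, zero_smul, map_zero]
        · rw [hr x y (lt_biInf_edist hfg hx hy)]
          rfl
      rw [h2]
      exact hasSum_zero
    rw [h1, smul_zero]
  locallyCompact f := by
    refine ⟨hT.isCompactOperator_mulRep_mul hX f, ?_⟩
    -- T ρ(f) is the adjoint of ρ(f̄) T*, and T* is again a band operator.
    have h1 := isCompactOperator_star (hT.star.isCompactOperator_mulRep_mul hX (Star.star f))
    rwa [star_mul, star_star, map_star, star_star] at h1
  invariant := (invariant_iff_kernel T).2 hT.equivariant

theorem isRoeOperator_iff (hX : BoundedGeometry X) {T : HilbertSum X F →L[ℂ] HilbertSum X F} :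
    IsRoeOperator mulRep (diagonalRep X R) T ↔ IsBandOperator R T :=
  ⟨fun h => have := hX.discreteTopology; h.isBandOperator, fun h => h.isRoeOperator hX⟩

theorem IsBandOperator.add {T S : HilbertSum X F →L[ℂ] HilbertSum X F}
    (hT : IsBandOperator R T) (hS : IsBandOperator R S) : IsBandOperator R (T + S) where
  propagation := by
    obtain ⟨r, hr⟩ := hT.propagation
    obtain ⟨q, hq⟩ := hS.propagation
    refine ⟨max r q, fun x y h => ?_⟩
    rw [NNReal.coe_max, max_lt_iff] at h
    rw [kernel_add, hr x y h.1, hq x y h.2, add_zero]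
  compact x y := (hT.compact x y).add (hS.compact x y)
  equivariant γ x y v := by
    rw [kernel_add, kernel_add, _root_.add_apply, _root_.add_apply, map_add,
      hT.equivariant, hS.equivariant]

theorem IsBandOperator.smul (c : ℂ) {T : HilbertSum X F →L[ℂ] HilbertSum X F}
    (hT : IsBandOperator R T) : IsBandOperator R (c • T) where
  propagation := by
    obtain ⟨r, hr⟩ := hT.propagation
    refine ⟨r, fun x y h => ?_⟩
    rw [kernel_smul, hr x y h, smul_zero]
  compact x y := (hT.compact x y).smul c
  equivariant γ x y v := by
    rw [kernel_smul, kernel_smul, _root_.smul_apply, _root_.smul_apply, map_smul,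
      hT.equivariant]

theorem IsBandOperator.zero : IsBandOperator R (0 : HilbertSum X F →L[ℂ] HilbertSum X F) where
  propagation := ⟨0, fun _ _ _ => rfl⟩
  compact _ _ := isCompactOperator_zero
  equivariant γ x y v := by
    change R γ 0 = 0
    exact map_zero _

theorem IsBandOperator.mul (hX : BoundedGeometry X) {T S : HilbertSum X F →L[ℂ] HilbertSum X F}
    (hT : IsBandOperator R T) (hS : IsBandOperator R S) : IsBandOperator R (T * S) where
  propagation := by
    obtain ⟨r, hr⟩ := hT.propagation
    obtain ⟨q, hq⟩ := hS.propagation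
    refine ⟨r + q, fun x y h => ContinuousLinearMap.ext fun v => ?_⟩
    refine (hasSum_kernel_mul T S x y v).unique ?_
    have h2 : (fun z => kernel T x z (kernel S z y v)) = fun _ => 0 := by
      funext z
      by_cases hxz : r < dist x z
      · rw [hr x z hxz]
        rfl
      · have hzy : q < dist z y := by
          have := dist_triangle x z y
          rw [NNReal.coe_add] at h
          linarith
        rw [hq z y hzy, _root_.zero_apply, map_zero]
    rw [h2]
    exact hasSum_zero
  -- The entry (TS)(x, y) factors through the row of T at x, which is already compact.
  compact x y := ((hT.isCompactOperator_eval_comp hX x).comp_clm S).comp_clm (single y)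
  equivariant := by
    rw [← invariant_iff_kernel]
    intro γ ξ
    have h1 := (invariant_iff_kernel T).2 hT.equivariant γ (S ξ)
    have h2 := (invariant_iff_kernel S).2 hS.equivariant γ ξ
    change _ = T (S ξ)
    rw [← h1, ← h2, LinearIsometryEquiv.symm_apply_apply]
    rfl

end RoeOperators

end

section

/-! ### Germs of equivariant maps along an ultrafilter of orbits. -/

section Germs

variable {Γ X : Type*} [Group Γ] [MulAction Γᵐᵒᵖ X]

theorem exists_smul_eq_of_orbit_eq {Y : Type*} [MulAction Γᵐᵒᵖ Y] {x y : Y}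
    (h : orbit Γ x = orbit Γ y) : ∃ γ : Γᵐᵒᵖ, γ • y = x := Quotient.exact' h

/-- For a free action, choices that depend equivariantly on a point are possible. -/
theorem exists_equivariant_choice
    (hfree : ∀ (x : X) (γ : Γ), MulOpposite.op γ • x = x → γ = 1) (P : X → X → Prop)
    (hP : ∀ (γ : Γᵐᵒᵖ) x z, P x z → P (γ • x) (γ • z)) :
    ∃ f : X →[Γᵐᵒᵖ] X, ∀ x z, P x z → P x (f x) := by
  classical
  -- The choice is made at one representative of each orbit and carried along by τ; freeness makes τ
  -- equivariant (`h3` below).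
  have hσ : ∀ x : X, ∃ γ : Γᵐᵒᵖ, γ • (orbit Γ x).out = x := fun x =>
    exists_smul_eq_of_orbit_eq (Quotient.out_eq' (orbit Γ x)).symm
  choose τ hτ using hσ
  let c : X → X := fun x => if h : ∃ z, P x z then h.choose else x
  have hc : ∀ x z, P x z → P x (c x) := fun x z h => by
    have h' : ∃ z, P x z := ⟨z, h⟩
    simp only [c, dif_pos h']
    exact h'.choose_spec
  refine ⟨⟨fun x => τ x • c (orbit Γ x).out, fun δ x => ?_⟩, fun x z hz => ?_⟩
  · have h1 : (orbit Γ (δ • x)).out = (orbit Γ x).out := by rw [orbit_smul]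
    have h2 : ((δ * τ x)⁻¹ * τ (δ • x)) • (orbit Γ x).out = (orbit Γ x).out := by
      rw [mul_smul, inv_smul_eq_iff, mul_smul, hτ x, ← h1, hτ]
    have h3 : (δ * τ x)⁻¹ * τ (δ • x) = 1 :=
      MulOpposite.unop_injective (hfree _ (MulOpposite.unop _) h2)
    rw [inv_mul_eq_one] at h3
    change τ (δ • x) • c (orbit Γ (δ • x)).out = δ • τ x • c (orbit Γ x).out
    rw [← h3, h1, mul_smul]
  · have h1 : P (orbit Γ x).out ((τ x)⁻¹ • z) := by
      have := hP (τ x)⁻¹ x z hz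
      rwa [← inv_smul_eq_iff.2 (hτ x).symm]
    have h2 := hP (τ x) _ _ (hc _ _ h1)
    rw [hτ] at h2
    exact h2

/-- `p x` holds for all `x` whose orbit is near `ω`. -/
def EventuallyAt (ω : Ultrafilter (Orbits Γ X)) (p : X → Prop) : Prop :=
  ∀ᶠ o in (ω : Filter (Orbits Γ X)), ∀ x, orbit Γ x = o → p x

namespace EventuallyAt

variable {ω : Ultrafilter (Orbits Γ X)} {p q : X → Prop}

theorem mono (hp : EventuallyAt ω p) (h : ∀ x, p x → q x) : EventuallyAt ω q :=
  Filter.Eventually.mono hp fun _ ho x hx => h x (ho x hx)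

theorem and (hp : EventuallyAt ω p) (hq : EventuallyAt ω q) : EventuallyAt ω fun x => p x ∧ q x :=
  (Filter.Eventually.and hp hq).mono fun _ ho x hx => ⟨ho.1 x hx, ho.2 x hx⟩

theorem exists_apply (hp : EventuallyAt ω p) : ∃ x, p x := by
  obtain ⟨o, ho⟩ := Filter.Eventually.exists hp
  exact ⟨o.out, ho _ (Quotient.out_eq' o)⟩

theorem of_forall (h : ∀ x, p x) : EventuallyAt ω p := Filter.Eventually.of_forall fun _ x _ => h x

theorem iff_exists_mem : EventuallyAt ω p ↔ ∃ V ∈ ω, ∀ x, orbit Γ x ∈ V → p x := by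
  refine ⟨fun h => ⟨_, h, fun x hx => hx x rfl⟩, ?_⟩
  rintro ⟨V, hV, h⟩
  refine Filter.mem_of_superset hV fun o ho x hx => h x ?_
  rwa [hx]

/-- The ultrafilter dichotomy only negates "p on the whole orbit"; invariance of p turns this into
"p nowhere on the orbit". -/
theorem not_of_not (hinv : ∀ (γ : Γᵐᵒᵖ) x, p x → p (γ • x)) (h : ¬ EventuallyAt ω p) :
    EventuallyAt ω fun x => ¬ p x := by
  rw [EventuallyAt, ← Ultrafilter.eventually_not] at h
  refine Filter.Eventually.mono h fun o ho x hx hpx => ho fun y hy => ?_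
  obtain ⟨γ, rfl⟩ := exists_smul_eq_of_orbit_eq (hy.trans hx.symm)
  exact hinv γ x hpx

theorem finset_forall {J : Type*} (s : Finset J) {p : J → X → Prop}
    (h : ∀ j ∈ s, EventuallyAt ω (p j)) : EventuallyAt ω fun x => ∀ j ∈ s, p j x := by
  have := (Filter.eventually_all_finset s).2 h
  exact Filter.Eventually.mono this fun o ho x hx j hj => ho j hj x hx

theorem pure_iff {y : X} (hinv : ∀ (γ : Γᵐᵒᵖ) x, p x → p (γ • x)) :
    EventuallyAt (pure (orbit Γ y)) p ↔ p y := by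
  refine ⟨fun h => ?_, fun h => ?_⟩
  · exact h y rfl
  · change ∀ x, orbit Γ x = orbit Γ y → p x
    intro x hx
    obtain ⟨γ, rfl⟩ := exists_smul_eq_of_orbit_eq hx
    exact hinv γ y h

end EventuallyAt

/-- The limit of `[f x, f' x]` as `[x]` tends to `ω`. -/
def germ (ω : Ultrafilter (Orbits Γ X)) (f f' : X →[Γᵐᵒᵖ] X) : Ultrafilter (Orbits Γ (X × X)) :=
  ω.map (orbitMap (fun x => (f x, f' x)) fun γ x => by rw [map_smul, map_smul, Prod.smul_mk])

theorem mem_germ {ω : Ultrafilter (Orbits Γ X)} {f f' : X →[Γᵐᵒᵖ] X}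
    {S : Set (Orbits Γ (X × X))} :
    S ∈ germ ω f f' ↔ EventuallyAt ω fun x => orbit Γ (f x, f' x) ∈ S := by
  constructor
  · intro h
    refine Filter.mem_of_superset h ?_
    rintro _ ho x rfl
    exact ho
  · intro h
    refine Ultrafilter.mem_map.2 (Filter.mem_of_superset
      (x := {o | ∀ x, orbit Γ x = o → orbit Γ (f x, f' x) ∈ S}) h fun o ho => ?_)
    induction o using Quotient.inductionOn' with | h x =>
    exact ho x rfl

theorem map_snd_germ (ω : Ultrafilter (Orbits Γ X)) (f : X →[Γᵐᵒᵖ] X) :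
    (germ ω f (.id _)).map (orbitMap Prod.snd fun _ _ => rfl) = ω := by
  rw [germ, Ultrafilter.map_map]
  convert Ultrafilter.map_id ω using 2
  ext z
  induction z using Quotient.inductionOn'
  rfl

/-- If f and f' differ near ω, the common germ contains both the set of all [f x, x] and the set of
all [f' x, x] with f x ≠ f' x. These sets are disjoint: (f x, x) = γ(f' y, y) forces x = γ y, hence
f x = f' x by equivariance. -/
theorem eventuallyAt_eq_of_germ_eq {ω : Ultrafilter (Orbits Γ X)} {f f' : X →[Γᵐᵒᵖ] X}
    (h : germ ω f (.id _) = germ ω f' (.id _)) : EventuallyAt ω fun x => f x = f' x := by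
  by_contra hne
  have hne := EventuallyAt.not_of_not (fun γ x hx => by rw [map_smul, map_smul, hx]) hne
  have h1 : {p | ∃ x, f x ≠ f' x ∧ p = orbit Γ (f x, x)} ∈ germ ω f (.id _) :=
    mem_germ.2 (hne.mono fun x hx => ⟨x, hx, rfl⟩)
  have h2 : {p | ∃ x, f x ≠ f' x ∧ p = orbit Γ (f' x, x)} ∈ germ ω f (.id _) := by
    rw [h]
    exact mem_germ.2 (hne.mono fun x hx => ⟨x, hx, rfl⟩)
  obtain ⟨p, ⟨x, hx, hpx⟩, ⟨y, hy, hpy⟩⟩ := Ultrafilter.nonempty_of_mem (Filter.inter_mem h1 h2)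
  obtain ⟨γ, hγ⟩ := exists_smul_eq_of_orbit_eq (hpx.symm.trans hpy)
  obtain ⟨h3, rfl⟩ := Prod.mk.inj hγ
  apply hx
  rw [← h3, map_smul]

end Germs

/-! ### Elements of the groupoid as germs of equivariant maps. -/

section Groupoid

variable {Γ X : Type*} [Group Γ] [MetricSpace X] [MulAction Γᵐᵒᵖ X]

namespace CoarseGroupoid

/-- An equivariant map that represents an element of the groupoid. -/
noncomputable def rep (g : CoarseGroupoid Γ X) : X →[Γᵐᵒᵖ] X :=
  @Classical.epsilon _ ⟨.id _⟩ fun f => g.1 = germ g.s f (.id _)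

theorem ext_of_rep_eq {g : CoarseGroupoid Γ X} {ω : Ultrafilter (Orbits Γ X)}
    {f f' : X →[Γᵐᵒᵖ] X} (hf : EventuallyAt ω fun x => f x = f' x)
    (hg : g.1 = germ ω f (.id _)) : g.1 = germ ω f' (.id _) := by
  rw [hg]
  refine Ultrafilter.ext fun S => ?_
  rw [mem_germ, mem_germ]
  constructor <;> intro h <;> refine (h.and hf).mono ?_
  · rintro x ⟨h1, h2⟩
    rwa [← h2]
  · rintro x ⟨h1, h2⟩
    rwa [h2]

variable [IsIsometricSMul Γᵐᵒᵖ X]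

theorem exists_injOn_snd (hX : BoundedGeometry X) (g : CoarseGroupoid Γ X) :
    ∃ V ∈ g.1, Set.InjOn (orbitMap (Γ := Γ) (Prod.snd : X × X → X) fun _ _ => rfl) V := by
  obtain ⟨V, hV, hinj⟩ := exists_injOn_fst hX g.inv
  refine ⟨_, hV, fun p hp q hq hpq => ?_⟩
  induction p using Quotient.inductionOn' with | h p =>
  induction q using Quotient.inductionOn' with | h q =>
  have h1 : orbit Γ p.swap = orbit Γ q.swap := hinj hp hq hpq
  obtain ⟨γ, hγ⟩ := exists_smul_eq_of_orbit_eq h1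
  obtain ⟨h2, h3⟩ := Prod.mk.inj hγ
  change orbit Γ p = orbit Γ q
  rw [← orbit_smul Γ γ q]
  exact congrArg _ (Prod.ext h3.symm h2.symm)

/-- Bounded geometry gives a set V in g on which the source map is injective. An equivariant choice
of z with [z, y] ∈ V is then a map f with [f y, y] running through V. -/
theorem rep_spec (hX : BoundedGeometry X)
    (hfree : ∀ (x : X) (γ : Γ), MulOpposite.op γ • x = x → γ = 1) (g : CoarseGroupoid Γ X) :
    g.1 = germ g.s g.rep (.id _) := by
  refine Classical.epsilon_spec (p := fun f => g.1 = germ g.s f (.id _)) ?_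
  obtain ⟨V, hV, hinj⟩ := exists_injOn_snd hX g
  obtain ⟨f, hf⟩ := exists_equivariant_choice hfree (fun y z => orbit Γ (z, y) ∈ V)
    fun γ x z h => by rwa [← Prod.smul_mk, orbit_smul]
  refine ⟨f, Ultrafilter.eq_of_le fun S hS => ?_⟩
  have h1 : ∀ᶠ p in (g.1 : Filter (Orbits Γ (X × X))), ∀ x, orbit Γ x =
    orbitMap (Γ := Γ) (Prod.snd : X × X → X) (fun _ _ => rfl) p → orbit Γ (f x, x) ∈ S := mem_germ.1 hS
  refine Filter.mem_of_superset (Filter.inter_mem h1 hV) ?_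
  rintro p ⟨hp, hpV⟩
  induction p using Quotient.inductionOn' with | h p =>
  have h2 : orbit Γ (f p.2, p.2) = orbit Γ p := hinj (hf p.2 p.1 hpV) hpV rfl
  have h3 := hp p.2 rfl
  rw [h2] at h3
  exact h3

/-- At the level of points this is [g x, x][x, h x] = [g x, h x]. The limit of the triples [g x, x,
h x] refines the filter of composable pairs, which is itself an ultrafilter, so the two coincide. -/
theorem comp_inv_eq (hX : BoundedGeometry X)
    (hfree : ∀ (x : X) (γ : Γ), MulOpposite.op γ • x = x → γ = 1)
    {ω : Ultrafilter (Orbits Γ X)} {g h : CoarseGroupoid Γ X} (hg : g.s = ω) (hh : h.s = ω)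
    (hgh : g.s = h.inv.r) : (g.comp h.inv hgh).1 = germ ω g.rep h.rep := by
  obtain ⟨u, hu⟩ := exists_compFilter_eq hX hfree g h.inv hgh
  have := compFilter_neBot g h.inv hgh
  have h1 : Ultrafilter.of (g.compFilter h.inv) = u :=
    Ultrafilter.eq_of_le ((Ultrafilter.of_le _).trans hu.le)
  let w : Ultrafilter (Orbits Γ (X × X × X)) := ω.map (orbitMap (fun x => (g.rep x, x, h.rep x))
    fun γ x => by rw [map_smul, map_smul, Prod.smul_mk, Prod.smul_mk])
  have hw12 : w.map p₁₂ = g.1 := by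
    rw [rep_spec hX hfree g, hg, germ, Ultrafilter.map_map]
    congr 1
    ext z
    induction z using Quotient.inductionOn'
    rfl
  have hw23 : w.map p₂₃ = h.inv.1 := by
    change _ = h.1.map _
    conv_rhs => rw [rep_spec hX hfree h]
    rw [hh, germ, Ultrafilter.map_map, Ultrafilter.map_map]
    congr 1
    ext z
    induction z using Quotient.inductionOn'
    rfl
  have h2 : (w : Filter _) ≤ g.compFilter h.inv := by
    refine le_inf ?_ ?_
    · rw [← Filter.map_le_iff_le_comap, ← hw12]
      exact le_rfl
    · rw [← Filter.map_le_iff_le_comap, ← hw23]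
      exact le_rfl
  have h3 : w = u := Ultrafilter.eq_of_le (h2.trans hu.le)
  change (Ultrafilter.of (g.compFilter h.inv)).map p₁₃ = _
  rw [h1, ← h3, Ultrafilter.map_map, germ]
  congr 1
  ext z
  induction z using Quotient.inductionOn'
  rfl

end CoarseGroupoid

namespace SourceFiber

variable [IsIsometricSMul Γᵐᵒᵖ X] {ω : Ultrafilter (Orbits Γ X)}

theorem coe_eq_germ (hX : BoundedGeometry X)
    (hfree : ∀ (x : X) (γ : Γ), MulOpposite.op γ • x = x → γ = 1) (g : SourceFiber Γ ω) :
    g.1.1 = germ ω g.1.rep (.id _) := by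
  conv_lhs => rw [g.1.rep_spec hX hfree, g.2]

theorem eq_of_eventuallyAt (hX : BoundedGeometry X)
    (hfree : ∀ (x : X) (γ : Γ), MulOpposite.op γ • x = x → γ = 1) {g h : SourceFiber Γ ω}
    (hgh : EventuallyAt ω fun x => g.1.rep x = h.1.rep x) : g = h := by
  refine Subtype.ext (Subtype.ext ?_)
  rw [CoarseGroupoid.ext_of_rep_eq hgh (coe_eq_germ hX hfree g), coe_eq_germ hX hfree h]

theorem eventuallyAt_ne (hX : BoundedGeometry X)
    (hfree : ∀ (x : X) (γ : Γ), MulOpposite.op γ • x = x → γ = 1) {g h : SourceFiber Γ ω}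
    (hgh : g ≠ h) : EventuallyAt ω fun x => g.1.rep x ≠ h.1.rep x :=
  EventuallyAt.not_of_not (fun γ x hx => by rw [map_smul, map_smul, hx])
    fun h' => hgh (eq_of_eventuallyAt hX hfree h')

/-- This lets finite blocks of matrices indexed by G_ω be read as finite blocks indexed by distinct
points of X. -/
theorem eventuallyAt_injOn (hX : BoundedGeometry X)
    (hfree : ∀ (x : X) (γ : Γ), MulOpposite.op γ • x = x → γ = 1)
    (s : Finset (SourceFiber Γ ω)) :
    EventuallyAt ω fun x => Set.InjOn (fun g : SourceFiber Γ ω => g.1.rep x) s := by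
  have h1 : EventuallyAt ω fun x => ∀ g ∈ s, ∀ h ∈ s, g.1.rep x = h.1.rep x → g = h := by
    refine EventuallyAt.finset_forall s fun g _ => EventuallyAt.finset_forall s fun h _ => ?_
    by_cases hgh : g = h
    · exact EventuallyAt.of_forall fun x _ => hgh
    · exact (eventuallyAt_ne hX hfree hgh).mono fun x hx hx' => (hx hx').elim
  exact h1.mono fun x hx g hg h hh => hx g hg h hh

/-- Bounded displacement puts some Δ_r/Γ into the germ of f, so the germ lies in G(X, Γ) and not
just in β((X × X)/Γ). -/
theorem exists_rep_eq (hX : BoundedGeometry X)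
    (hfree : ∀ (x : X) (γ : Γ), MulOpposite.op γ • x = x → γ = 1) {f : X →[Γᵐᵒᵖ] X} {r : ℝ≥0}
    (hf : EventuallyAt ω fun x => dist (f x) x ≤ r) :
    ∃ g : SourceFiber Γ ω, EventuallyAt ω fun x => g.1.rep x = f x := by
  have h1 : entourage Γ X r ∈ germ ω f (.id _) :=
    mem_germ.2 (hf.mono fun x hx => ⟨(f x, x), hx, rfl⟩)
  refine ⟨⟨CoarseGroupoid.ofMem _ r h1, map_snd_germ ω f⟩, eventuallyAt_eq_of_germ_eq ?_⟩
  rw [← coe_eq_germ hX hfree]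
  rfl

theorem exists_dist_rep_le (hX : BoundedGeometry X)
    (hfree : ∀ (x : X) (γ : Γ), MulOpposite.op γ • x = x → γ = 1) (g : SourceFiber Γ ω) :
    ∃ r : ℝ≥0, EventuallyAt ω fun x => dist (g.1.rep x) x ≤ r := by
  obtain ⟨r, hr⟩ := g.1.exists_entourage_mem
  rw [coe_eq_germ hX hfree, mem_germ] at hr
  exact ⟨r, hr.mono fun x hx => CoarseGroupoid.dist_le_of_orbit_mem hx⟩

/-- With N the bound for balls of radius r, N + 1 such elements would take N + 1 distinct values in
one of these balls at a suitable x. -/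
theorem finite_dist_le (hX : BoundedGeometry X)
    (hfree : ∀ (x : X) (γ : Γ), MulOpposite.op γ • x = x → γ = 1) (g : SourceFiber Γ ω) (r : ℝ) :
    {h : SourceFiber Γ ω | EventuallyAt ω fun x => dist (g.1.rep x) (h.1.rep x) ≤ r}.Finite := by
  obtain ⟨N, hN⟩ := hX r
  by_contra hinf
  obtain ⟨s, hs, hcard⟩ := Set.Infinite.exists_subset_card_eq hinf (N + 1)
  have h1 := EventuallyAt.finset_forall s fun h hh => hs hh
  obtain ⟨x, hx1, hx2⟩ := (h1.and (eventuallyAt_injOn hX hfree s)).exists_apply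
  have h2 : (s : Set (SourceFiber Γ ω)).encard ≤ (Metric.closedBall (g.1.rep x) r).encard :=
    Set.encard_le_encard_of_injOn (fun h hh => by
      rw [Metric.mem_closedBall, dist_comm]
      exact hx1 h hh) hx2
  have h3 := h2.trans (hN _)
  rw [Set.encard_coe_eq_coe_finsetCard, hcard, Nat.cast_le] at h3
  omega

/-- If points of the balls were missed near ω, an equivariant choice of a missed point would define
an element h of G_ω within distance r of g. This h belongs to the finite list and takes the missed
value, a contradiction. -/
theorem eventuallyAt_exists_rep_eq (hX : BoundedGeometry X)
    (hfree : ∀ (x : X) (γ : Γ), MulOpposite.op γ • x = x → γ = 1) (g : SourceFiber Γ ω) (r : ℝ≥0) :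
    EventuallyAt ω fun x => ∀ z, dist (g.1.rep x) z ≤ r →
      ∃ h ∈ (finite_dist_le hX hfree g r).toFinset, h.1.rep x = z := by
  set L := (finite_dist_le hX hfree g r).toFinset with hL
  let P : X → X → Prop := fun x z => dist (g.1.rep x) z ≤ r ∧ ∀ h ∈ L, h.1.rep x ≠ z
  have hP : ∀ (γ : Γᵐᵒᵖ) x z, P x z → P (γ • x) (γ • z) := by
    rintro γ x z ⟨h1, h2⟩
    refine ⟨by rwa [map_smul, dist_smul], fun h hh => ?_⟩
    rw [map_smul]
    exact fun h' => h2 h hh (smul_left_cancel γ h')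
  have hQ : ∀ x, (∀ z, dist (g.1.rep x) z ≤ r → ∃ h ∈ L, h.1.rep x = z) ↔ ¬ ∃ z, P x z := fun x => by
    simp only [P]
    push Not
    rfl
  simp only [hQ]
  by_contra hne
  have hne := EventuallyAt.not_of_not (fun γ x hx => by
    rintro ⟨z, hz⟩
    refine hx ⟨γ⁻¹ • z, ?_⟩
    have := hP γ⁻¹ _ _ hz
    rwa [inv_smul_smul] at this) hne
  obtain ⟨f, hf⟩ := exists_equivariant_choice hfree P hP
  have hPf : EventuallyAt ω fun x => P x (f x) := hne.mono fun x hx => by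
    obtain ⟨z, hz⟩ := not_not.1 hx
    exact hf x z hz
  obtain ⟨r₀, hr₀⟩ := exists_dist_rep_le hX hfree g
  -- f stays within r of the representative of g, which moves points by at most r₀.
  obtain ⟨h, hh⟩ := exists_rep_eq (ω := ω) hX hfree (f := f) (r := r + r₀) <| by
    refine (hPf.and hr₀).mono fun x hx => ?_
    rw [NNReal.coe_add]
    refine (dist_triangle_left (f x) x (g.1.rep x)).trans ?_
    exact add_le_add hx.1.1 hx.2
  have hhL : h ∈ L := by
    rw [hL, Set.Finite.mem_toFinset]
    exact (hPf.and hh).mono fun x hx => by rw [hx.2]; exact hx.1.1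
  obtain ⟨x, hx1, hx2⟩ := (hPf.and hh).exists_apply
  exact hx1.2 h hhL hx2

end SourceFiber

end Groupoid

end

section

open HilbertSum

/-! ### Norms of sums ∑ A_j* A_j. -/

section PositiveSums

variable {F : Type*} [NormedAddCommGroup F] [InnerProductSpace ℂ F] [CompleteSpace F]

theorem re_inner_sum_star_mul_self {J : Type*} (s : Finset J) (A : J → F →L[ℂ] F) (v : F) :
    (inner ℂ v ((∑ j ∈ s, star (A j) * A j) v)).re = ∑ j ∈ s, ‖A j v‖ ^ 2 := by
  rw [_root_.sum_apply, inner_sum, Complex.re_sum]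
  refine Finset.sum_congr rfl fun j _ => ?_
  change (inner ℂ v (star (A j) (A j v))).re = _
  rw [ContinuousLinearMap.star_eq_adjoint, ContinuousLinearMap.adjoint_inner_right]
  exact inner_self_eq_norm_sq (𝕜 := ℂ) _

theorem sum_norm_sq_le_norm_sum {J : Type*} (s : Finset J) (A : J → F →L[ℂ] F) (v : F) :
    ∑ j ∈ s, ‖A j v‖ ^ 2 ≤ ‖∑ j ∈ s, star (A j) * A j‖ * ‖v‖ ^ 2 := by
  rw [← re_inner_sum_star_mul_self]
  refine (Complex.re_le_norm _).trans ((norm_inner_le_norm _ _).trans ?_)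
  calc _ ≤ ‖v‖ * (‖∑ j ∈ s, star (A j) * A j‖ * ‖v‖) := by
        gcongr
        exact ContinuousLinearMap.le_opNorm _ _
    _ = _ := by ring

/-- The norm is tested on ⟨A_j v, A_j w⟩ for unit vectors v and w; the arithmetic-geometric mean
inequality reduces this to the diagonal form. -/
theorem norm_sum_star_mul_self_le {J : Type*} (s : Finset J) (A : J → F →L[ℂ] F) {C : ℝ}
    (hC : 0 ≤ C) (h : ∀ v, ∑ j ∈ s, ‖A j v‖ ^ 2 ≤ C * ‖v‖ ^ 2) :
    ‖∑ j ∈ s, star (A j) * A j‖ ≤ C := by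
  refine ContinuousLinearMap.opNorm_le_of_re_inner_le (𝕜 := ℂ) hC fun v w hv hw => ?_
  have h1 : ∀ j ∈ s, RCLike.re (inner ℂ ((star (A j) * A j) v) w) ≤
      (‖A j v‖ ^ 2 + ‖A j w‖ ^ 2) / 2 := fun j _ => by
    change RCLike.re (inner ℂ (star (A j) (A j v)) w) ≤ _
    rw [ContinuousLinearMap.star_eq_adjoint, ContinuousLinearMap.adjoint_inner_left]
    refine (RCLike.re_le_norm _).trans ((norm_inner_le_norm _ _).trans ?_)
    nlinarith [sq_nonneg (‖A j v‖ - ‖A j w‖)]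
  have h2 := h v
  have h3 := h w
  rw [hv, one_pow, mul_one] at h2
  rw [hw, one_pow, mul_one] at h3
  rw [_root_.sum_apply, sum_inner, map_sum]
  refine (Finset.sum_le_sum h1).trans ?_
  rw [← Finset.sum_div, Finset.sum_add_distrib]
  linarith

theorem isCompactOperator_rankOne (v e : F) :
    IsCompactOperator ((innerSL ℂ e).smulRight v : F →L[ℂ] F) :=
  (isCompactOperator_of_locallyCompactSpace_dom (innerSL ℂ e)).clm_comp
    ((1 : ℂ →L[ℂ] ℂ).smulRight v)

end PositiveSums

/-! ### Matrix entries in A_ω of a band operator. -/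

section Entries

variable {Γ X F : Type*} [Group Γ] [MetricSpace X] [MulAction Γᵐᵒᵖ X]
  [NormedAddCommGroup F] [InnerProductSpace ℂ F] [CompleteSpace F]
  {R : Γ →* (F ≃ₗᵢ[ℂ] F)} {ω : Ultrafilter (Orbits Γ X)}

theorem Coeff.sum_apply {J : Type*} (s : Finset J) (a : J → Coeff X R) (x : X) :
    (∑ j ∈ s, a j) x = ∑ j ∈ s, a j x := by
  classical
  induction s using Finset.induction_on with
  | empty => rfl
  | insert j s hj ih => rw [Finset.sum_insert hj, Finset.sum_insert hj, Coeff.add_apply, ih]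

theorem Coeff.norm_apply_smul (a : Coeff X R) (γ : Γᵐᵒᵖ) (x : X) : ‖a (γ • x)‖ = ‖a x‖ := by
  have h : a x = (R γ.unop).toContinuousLinearEquiv.toContinuousLinearMap ∘L a (γ • x) ∘L
      (R γ.unop).symm.toContinuousLinearEquiv.toContinuousLinearMap :=
    ContinuousLinearMap.ext fun v => (a.2.2 x γ.unop v).symm
  rw [h]
  refine Eq.trans ?_ (ContinuousLinearMap.opNorm_linearIsometryEquiv_comp (R γ.unop) _).symm
  exact (ContinuousLinearMap.opNorm_comp_linearIsometryEquiv _ (R γ.unop).symm).symm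

namespace Fiber

theorem mk_eq_of_eventuallyAt {a b : Coeff X R} (h : EventuallyAt ω fun x => a x = b x) :
    mk R ω a = mk R ω b := by
  rw [mk_eq_mk_iff, mem_fiberIdeal_iff]
  intro ε hε
  obtain ⟨V, hV, h⟩ := EventuallyAt.iff_exists_mem.1 h
  refine ⟨V, hV, fun x hx => ?_⟩
  rw [Coeff.sub_apply, h x hx, sub_self, norm_zero]
  exact hε.le

theorem norm_mk_le_of_eventuallyAt {a : Coeff X R} {C : ℝ} (hC : 0 ≤ C)
    (h : EventuallyAt ω fun x => ‖a x‖ ≤ C) : ‖mk R ω a‖ ≤ C := by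
  obtain ⟨V, hV, h⟩ := EventuallyAt.iff_exists_mem.1 h
  exact norm_mk_le_of_forall hV a hC h

theorem eventuallyAt_norm_apply_le (a : Coeff X R) {ε : ℝ} (hε : 0 < ε) :
    EventuallyAt ω fun x => ‖a x‖ ≤ ‖mk R ω a‖ + ε :=
  EventuallyAt.iff_exists_mem.2 (exists_norm_apply_le a hε)

/-- At a principal ultrafilter "near ω" means "on the orbit of y", where ‖a‖ is constant. Evaluation
at y is therefore well defined and isometric on A_[y]. -/
theorem norm_mk_pure (a : Coeff X R) (y : X) : ‖mk R (pure (orbit Γ y)) a‖ = ‖a y‖ := by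
  refine le_antisymm (norm_mk_le_of_eventuallyAt (norm_nonneg _) ?_) ?_
  · exact (EventuallyAt.pure_iff fun γ x h => (a.norm_apply_smul γ x).trans_le h).2 le_rfl
  · refine le_of_forall_pos_le_add fun ε hε => ?_
    exact eventuallyAt_norm_apply_le (ω := pure (orbit Γ y)) a hε y rfl

end Fiber

/-- The function `x ↦ T(f x, f' x)` of the coefficient algebra. -/
noncomputable def IsBandOperator.compress {T : HilbertSum X F →L[ℂ] HilbertSum X F}
    (hT : IsBandOperator R T) (f f' : X →[Γᵐᵒᵖ] X) : Coeff X R :=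
  ⟨⟨fun x => kernel T (f x) (f' x), memℓp_infty ⟨‖T‖, by
    rintro _ ⟨x, rfl⟩
    exact norm_kernel_le T _ _⟩⟩, fun x => hT.compact _ _, fun x γ v => by
    change R γ (kernel T (f (MulOpposite.op γ • x)) (f' (MulOpposite.op γ • x)) _) = _
    rw [map_smul, map_smul]
    exact hT.equivariant γ _ _ v⟩

@[simp] theorem IsBandOperator.compress_apply {T : HilbertSum X F →L[ℂ] HilbertSum X F}
    (hT : IsBandOperator R T) (f f' : X →[Γᵐᵒᵖ] X) (x : X) :
    hT.compress f f' x = kernel T (f x) (f' x) := rfl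

/-- The matrix coefficients of the operator on `ℓ²(G_ω) ⊗ A_ω` that corresponds to an operator on
`ℓ²(X) ⊗ F`. -/
noncomputable def IsBandOperator.entry {T : HilbertSum X F →L[ℂ] HilbertSum X F}
    (hT : IsBandOperator R T) (g h : SourceFiber Γ ω) : Fiber R ω :=
  Fiber.mk R ω (hT.compress g.1.rep h.1.rep)

namespace IsBandOperator

variable {T S : HilbertSum X F →L[ℂ] HilbertSum X F}

theorem star_entry (hT : IsBandOperator R T) (g h : SourceFiber Γ ω) :
    Star.star (hT.entry g h) = hT.star.entry h g := by
  rw [entry, entry, ← Fiber.mk_star]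
  congr 1
  ext1 x
  rw [Coeff.star_apply, compress_apply, compress_apply, kernel_star]

variable [IsIsometricSMul Γᵐᵒᵖ X]

/-- Distances are invariant, so if g and h are not within r near ω, they are more than r apart near
ω, where the kernel vanishes. -/
theorem entry_eq_zero (hT : IsBandOperator R T) {r : ℝ≥0}
    (hr : ∀ x y, r < dist x y → kernel T x y = 0) {g h : SourceFiber Γ ω}
    (hgh : ¬ EventuallyAt ω fun x => dist (g.1.rep x) (h.1.rep x) ≤ r) : hT.entry g h = 0 := by
  rw [entry, ← map_zero (Fiber.mk R ω)]
  refine Fiber.mk_eq_of_eventuallyAt ?_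
  refine (EventuallyAt.not_of_not (fun γ x hx => ?_) hgh).mono fun x hx => ?_
  · rwa [map_smul, map_smul, dist_smul]
  · exact hr _ _ (not_le.1 hx)

theorem finite_row (hX : BoundedGeometry X)
    (hfree : ∀ (x : X) (γ : Γ), MulOpposite.op γ • x = x → γ = 1) (hT : IsBandOperator R T)
    (g : SourceFiber Γ ω) : {h | hT.entry g h ≠ 0}.Finite := by
  obtain ⟨r, hr⟩ := hT.propagation
  refine (SourceFiber.finite_dist_le hX hfree g r).subset fun h hh => ?_
  by_contra h'
  exact hh (hT.entry_eq_zero hr h')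

theorem finite_column (hX : BoundedGeometry X)
    (hfree : ∀ (x : X) (γ : Γ), MulOpposite.op γ • x = x → γ = 1) (hT : IsBandOperator R T)
    (h : SourceFiber Γ ω) : {g | hT.entry g h ≠ 0}.Finite := by
  refine (hT.star.finite_row hX hfree h).subset fun g hg => ?_
  rw [Set.mem_ofPred_eq, ← star_entry, star_ne_zero]
  exact hg

/-- The vector is lifted to coefficient functions c. For x near ω the representatives take distinct
values at x, and the evaluated inequality is the bound for a finite block of T applied to the
vectors c_h(x) v. -/
theorem norm_sum_entry_le (hX : BoundedGeometry X)
    (hfree : ∀ (x : X) (γ : Γ), MulOpposite.op γ • x = x → γ = 1) (hT : IsBandOperator R T)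
    (s t : Finset (SourceFiber Γ ω)) (ξ : SourceFiber Γ ω → Fiber R ω) :
    ‖∑ g ∈ t, Star.star (∑ h ∈ s, hT.entry g h * ξ h) * ∑ h ∈ s, hT.entry g h * ξ h‖ ≤
      ‖T‖ ^ 2 * ‖∑ h ∈ s, Star.star (ξ h) * ξ h‖ := by
  choose c hc using fun h => Fiber.mk_surjective (ξ h)
  let b : SourceFiber Γ ω → Coeff X R := fun g => ∑ h ∈ s, hT.compress g.1.rep h.1.rep * c h
  have hb : ∀ g, ∑ h ∈ s, hT.entry g h * ξ h = Fiber.mk R ω (b g) := fun g => by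
    rw [map_sum]
    exact Finset.sum_congr rfl fun h _ => by rw [← hc h, Fiber.mk_mul]; rfl
  have h1 : ∑ g ∈ t, Star.star (∑ h ∈ s, hT.entry g h * ξ h) * ∑ h ∈ s, hT.entry g h * ξ h =
      Fiber.mk R ω (∑ g ∈ t, Star.star (b g) * b g) := by
    rw [map_sum]
    exact Finset.sum_congr rfl fun g _ => by rw [hb, Fiber.mk_mul, Fiber.mk_star]
  have h2 : ∑ h ∈ s, Star.star (ξ h) * ξ h = Fiber.mk R ω (∑ h ∈ s, Star.star (c h) * c h) := by
    rw [map_sum]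
    exact Finset.sum_congr rfl fun g _ => by rw [← hc, Fiber.mk_mul, Fiber.mk_star]
  rw [h1, h2]
  set e := ∑ h ∈ s, Star.star (c h) * c h with he
  -- A quotient norm bounds the values near ω only up to ε, which tends to 0 at the end.
  have key : ∀ ε > 0, ‖Fiber.mk R ω (∑ g ∈ t, Star.star (b g) * b g)‖ ≤
      ‖T‖ ^ 2 * (‖Fiber.mk R ω e‖ + ε) := by
    intro ε hε
    refine Fiber.norm_mk_le_of_eventuallyAt (by positivity) ?_
    refine (((SourceFiber.eventuallyAt_injOn hX hfree s).and
      (SourceFiber.eventuallyAt_injOn hX hfree t)).and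
      (Fiber.eventuallyAt_norm_apply_le e hε)).mono ?_
    rintro x ⟨⟨hs, ht⟩, hx⟩
    rw [Coeff.sum_apply]
    refine norm_sum_star_mul_self_le t (fun g => b g x) (by positivity) fun v => ?_
    have h3 : ∀ g, b g x v = ∑ h ∈ s, kernel T (g.1.rep x) (h.1.rep x) (c h x v) := fun g => by
      rw [Coeff.sum_apply, _root_.sum_apply]
      rfl
    calc ∑ g ∈ t, ‖b g x v‖ ^ 2 ≤ ‖T‖ ^ 2 * ∑ h ∈ s, ‖c h x v‖ ^ 2 := by
          simp only [h3]
          exact sum_norm_kernel_sq_le T s t hs ht fun h => c h x v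
      _ ≤ ‖T‖ ^ 2 * (‖e x‖ * ‖v‖ ^ 2) := by
          gcongr
          rw [he, Coeff.sum_apply]
          exact sum_norm_sq_le_norm_sum s (fun h => c h x) v
      _ ≤ ‖T‖ ^ 2 * ((‖Fiber.mk R ω e‖ + ε) * ‖v‖ ^ 2) := by gcongr
      _ = _ := by ring
  have hlim : Filter.Tendsto (fun ε : ℝ => ‖T‖ ^ 2 * (‖Fiber.mk R ω e‖ + ε))
      (nhdsWithin 0 (Set.Ioi 0)) (nhds (‖T‖ ^ 2 * (‖Fiber.mk R ω e‖ + 0))) :=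
    (Continuous.tendsto (by fun_prop) 0).mono_left nhdsWithin_le_nhds
  rw [add_zero] at hlim
  exact ge_of_tendsto hlim (eventually_nhdsWithin_of_forall fun ε hε => key ε hε)

/-- For x near ω, every z with T(g x, z) ≠ 0 is l x for exactly one l in the finite list, so the sum
over l evaluates to the sum over z that defines the kernel of TS. -/
theorem sum_entry_mul_entry (hX : BoundedGeometry X)
    (hfree : ∀ (x : X) (γ : Γ), MulOpposite.op γ • x = x → γ = 1) (hT : IsBandOperator R T)
    (hS : IsBandOperator R S) (g h : SourceFiber Γ ω) {r : ℝ≥0}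
    (hr : ∀ x y, r < dist x y → kernel T x y = 0) :
    ∑ l ∈ (SourceFiber.finite_dist_le hX hfree g r).toFinset, hT.entry g l * hS.entry l h =
      (hT.mul hX hS).entry g h := by
  classical
  set L := (SourceFiber.finite_dist_le hX hfree g r).toFinset
  simp only [entry, ← Fiber.mk_mul]
  rw [← map_sum]
  refine Fiber.mk_eq_of_eventuallyAt ?_
  refine ((SourceFiber.eventuallyAt_injOn hX hfree L).and
    (SourceFiber.eventuallyAt_exists_rep_eq hX hfree g r)).mono ?_
  rintro x ⟨hinj, hx⟩
  ext v
  rw [Coeff.sum_apply, _root_.sum_apply]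
  refine HasSum.unique ?_ (hasSum_kernel_mul T S (g.1.rep x) (h.1.rep x) v)
  have h1 : ∑ l ∈ L, (hT.compress g.1.rep l.1.rep * hS.compress l.1.rep h.1.rep) x v =
      ∑ z ∈ L.image fun l => l.1.rep x, kernel T (g.1.rep x) z (kernel S z (h.1.rep x) v) :=
    (Finset.sum_image (f := fun z => kernel T (g.1.rep x) z (kernel S z (h.1.rep x) v))
      hinj).symm
  rw [h1]
  refine hasSum_sum_of_ne_finset_zero fun z hz => ?_
  rw [hr, _root_.zero_apply]
  by_contra hd
  obtain ⟨l, hl, hlz⟩ := hx z (not_lt.1 hd)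
  exact hz (Finset.mem_image.2 ⟨l, hl, hlz⟩)

end IsBandOperator

end Entries

end

section

open HilbertSum

/-! ### The family (π_ω) attached to a band operator, and equality of norms. -/

section RegularFamily

variable {Γ X F : Type*} [Group Γ] [MetricSpace X] [MulAction Γᵐᵒᵖ X]
  [NormedAddCommGroup F] [InnerProductSpace ℂ F] [CompleteSpace F]
  {R : Γ →* (F ≃ₗᵢ[ℂ] F)}

namespace RegularFamilies

@[ext] theorem ext {A B : RegularFamilies X R} (h : ∀ ω ξ g, A.op ω ξ g = B.op ω ξ g) : A = B :=
  Subtype.ext <| funext fun ω => Subtype.ext <| ContinuousLinearMap.ext fun ξ =>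
    L2.ext fun g => h ω ξ g

theorem norm_op_le (A : RegularFamilies X R) (ω : Ultrafilter (Orbits Γ X)) : ‖A.op ω‖ ≤ ‖A‖ :=
  lp.norm_apply_le_norm (E := fun ω : Ultrafilter (Orbits Γ X) =>
    Adjointable (SourceFiber Γ ω) (Fiber R ω)) ENNReal.top_ne_zero A ω

end RegularFamilies

/-- The family of operators on `ℓ²(G_ω) ⊗ A_ω` that corresponds to an operator on `ℓ²(X) ⊗ F`. -/
def IsBandOperator.IsFamily {T : HilbertSum X F →L[ℂ] HilbertSum X F} (hT : IsBandOperator R T)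
    (A : RegularFamilies X R) : Prop :=
  ∀ (ω : Ultrafilter (Orbits Γ X)) (ξ : L2 (SourceFiber Γ ω) (Fiber R ω)) (g : SourceFiber Γ ω),
    HasSum (fun h => hT.entry g h * ξ h) (A.op ω ξ g)

namespace IsBandOperator

variable {T S : HilbertSum X F →L[ℂ] HilbertSum X F} {A B : RegularFamilies X R}

theorem IsFamily.unique {hT : IsBandOperator R T} (hA : hT.IsFamily A) (hB : hT.IsFamily B) :
    A = B :=
  RegularFamilies.ext fun ω ξ g => (hA ω ξ g).unique (hB ω ξ g)

theorem IsFamily.add {hT : IsBandOperator R T} {hS : IsBandOperator R S} (hA : hT.IsFamily A)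
    (hB : hS.IsFamily B) : (hT.add hS).IsFamily (A + B) := fun ω ξ g => by
  have h1 : ∀ h, (hT.add hS).entry g h = hT.entry g h + hS.entry g h := fun h => by
    rw [entry, entry, entry, ← map_add]
    rfl
  simp only [h1, add_mul]
  exact (hA ω ξ g).add (hB ω ξ g)

theorem IsFamily.smul {hT : IsBandOperator R T} (c : ℂ) (hA : hT.IsFamily A) :
    (hT.smul c).IsFamily (c • A) := fun ω ξ g => by
  have h1 : ∀ h, (hT.smul c).entry g h = c • hT.entry g h := fun h => by
    rw [entry, entry, ← map_smul]
    rfl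
  simp only [h1, smul_mul_assoc]
  exact (hA ω ξ g).const_smul c

theorem isFamily_zero : (IsBandOperator.zero (R := R)).IsFamily (0 : RegularFamilies X R) :=
  fun ω ξ g => by
  have h1 : ∀ h, (IsBandOperator.zero (R := R)).entry g h = 0 := fun h => by
    rw [entry, ← map_zero (Fiber.mk R ω)]
    rfl
  simp only [h1, zero_mul]
  exact hasSum_zero

variable [IsIsometricSMul Γᵐᵒᵖ X]

theorem exists_isFamily (hX : BoundedGeometry X)
    (hfree : ∀ (x : X) (γ : Γ), MulOpposite.op γ • x = x → γ = 1) (hT : IsBandOperator R T) :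
    ∃ A : RegularFamilies X R, hT.IsFamily A ∧ ‖A‖ ≤ ‖T‖ := by
  have h1 : ∀ ω : Ultrafilter (Orbits Γ X), ∃ A : Adjointable (SourceFiber Γ ω) (Fiber R ω),
      ‖A‖ ≤ ‖T‖ ∧ ∀ ξ g, HasSum (fun h => hT.entry g h * ξ h) (A.1 ξ g) := fun ω => by
    -- The same constant ‖T‖ bounds the conjugate transpose, which is the matrix of T*.
    refine L2.exists_adjointable_of_matrix (norm_nonneg T) (hT.finite_row hX hfree)
      (hT.finite_column hX hfree) (hT.norm_sum_entry_le hX hfree) fun s t ξ => ?_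
    simp only [star_entry]
    rw [← norm_star T]
    exact hT.star.norm_sum_entry_le hX hfree s t ξ
  choose A hA1 hA2 using h1
  refine ⟨⟨A, memℓp_infty ⟨‖T‖, ?_⟩⟩, hA2, lp.norm_le_of_forall_le (norm_nonneg T) hA1⟩
  rintro _ ⟨ω, rfl⟩
  exact hA1 ω

theorem IsFamily.star (hX : BoundedGeometry X)
    (hfree : ∀ (x : X) (γ : Γ), MulOpposite.op γ • x = x → γ = 1) {hT : IsBandOperator R T}
    (hA : hT.IsFamily A) : hT.star.IsFamily (Star.star A) := by
  obtain ⟨B, hB, -⟩ := hT.star.exists_isFamily hX hfree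
  convert hB
  refine Subtype.ext <| funext fun ω => Subtype.ext ?_
  refine adjointableSubalgebra.star_eq (T := A.1 ω) fun ξ η => ?_
  refine L2.inner_eq_of_hasSum (B.op ω).continuous (hA ω) (fun ξ g => ?_) ξ η
  simp only [star_entry]
  exact hB ω ξ g

/-- Rows of the first factor are finite, so the inner sum over l is finite and may be exchanged with
the sum over h. -/
theorem IsFamily.mul (hX : BoundedGeometry X)
    (hfree : ∀ (x : X) (γ : Γ), MulOpposite.op γ • x = x → γ = 1) {hT : IsBandOperator R T}
    {hS : IsBandOperator R S} (hA : hT.IsFamily A) (hB : hS.IsFamily B) :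
    (hT.mul hX hS).IsFamily (A * B) := fun ω ξ g => by
  obtain ⟨r, hr⟩ := hT.propagation
  set L := (SourceFiber.finite_dist_le hX hfree g r).toFinset with hL
  have h1 : (A * B).op ω ξ g = ∑ l ∈ L, hT.entry g l * B.op ω ξ l := by
    refine (hA ω (B.op ω ξ) g).unique (hasSum_sum_of_ne_finset_zero fun l hl => ?_)
    rw [hT.entry_eq_zero hr, zero_mul]
    rwa [hL, Set.Finite.mem_toFinset] at hl
  rw [h1]
  have h2 : HasSum (fun h => ∑ l ∈ L, hT.entry g l * (hS.entry l h * ξ h))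
      (∑ l ∈ L, hT.entry g l * B.op ω ξ l) := hasSum_sum fun l _ => (hB ω ξ l).mul_left _
  refine h2.congr_fun fun h => ?_
  rw [← sum_entry_mul_entry hX hfree hT hS g h hr, Finset.sum_mul]
  exact Finset.sum_congr rfl fun l _ => mul_assoc _ _ _

end IsBandOperator

/-- The value at y determines the values on its orbit by equivariance; freeness makes this
consistent, and the function is 0 elsewhere. -/
theorem exists_coeff_apply_eq
    (hfree : ∀ (x : X) (γ : Γ), MulOpposite.op γ • x = x → γ = 1) (y : X) {A : F →L[ℂ] F}
    (hA : IsCompactOperator A) : ∃ a : Coeff X R, a y = A := by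
  classical
  let conj (γ : Γ) : F →L[ℂ] F := (R γ).symm.toContinuousLinearEquiv.toContinuousLinearMap ∘L A ∘L
    (R γ).toContinuousLinearEquiv.toContinuousLinearMap
  have hinj : ∀ γ δ : Γ, MulOpposite.op γ • y = MulOpposite.op δ • y → γ = δ := fun γ δ h => by
    rw [← inv_smul_eq_iff, ← mul_smul, ← MulOpposite.op_inv, ← MulOpposite.op_mul] at h
    have := hfree y _ h
    rwa [mul_inv_eq_one] at this
  let b : X → F →L[ℂ] F := fun x => if h : ∃ γ : Γ, MulOpposite.op γ • y = x then conj h.choose else 0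
  have hb : ∀ γ, b (MulOpposite.op γ • y) = conj γ := fun γ => by
    have h' : ∃ δ : Γ, MulOpposite.op δ • y = MulOpposite.op γ • y := ⟨γ, rfl⟩
    simp only [b, dif_pos h']
    rw [hinj _ _ h'.choose_spec]
  have hb0 : ∀ x, (¬ ∃ γ : Γ, MulOpposite.op γ • y = x) → b x = 0 := fun x h => dif_neg h
  refine ⟨⟨⟨b, memℓp_infty ⟨‖A‖, ?_⟩⟩, fun x => ?_, fun x γ v => ?_⟩, ?_⟩
  · rintro _ ⟨x, rfl⟩
    by_cases h : ∃ γ : Γ, MulOpposite.op γ • y = x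
    · obtain ⟨γ, rfl⟩ := h
      change ‖b _‖ ≤ _
      rw [hb]
      refine ContinuousLinearMap.opNorm_le_bound _ (norm_nonneg _) fun v => ?_
      change ‖(R γ).symm (A (R γ v))‖ ≤ _
      rw [LinearIsometryEquiv.norm_map, ← LinearIsometryEquiv.norm_map (R γ) v]
      exact A.le_opNorm _
    · change ‖b _‖ ≤ _
      rw [hb0 x h, norm_zero]
      exact norm_nonneg _
  · change IsCompactOperator (b x)
    by_cases h : ∃ γ : Γ, MulOpposite.op γ • y = x
    · obtain ⟨γ, rfl⟩ := h
      rw [hb]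
      exact (hA.comp_clm (R γ).toContinuousLinearEquiv.toContinuousLinearMap).clm_comp
        (R γ).symm.toContinuousLinearEquiv.toContinuousLinearMap
    · rw [hb0 x h]
      exact isCompactOperator_zero
  · change R γ (b (MulOpposite.op γ • x) _) = b x v
    by_cases h : ∃ γ : Γ, MulOpposite.op γ • y = x
    · obtain ⟨δ, rfl⟩ := h
      rw [hb, ← mul_smul, ← MulOpposite.op_mul, hb]
      change R γ ((R (δ * γ)).symm (A (R (δ * γ) ((R γ).symm v)))) = (R δ).symm (A (R δ v))
      have h1 : R (δ * γ) ((R γ).symm v) = R δ v := by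
        rw [map_mul]
        change R δ (R γ ((R γ).symm v)) = _
        rw [LinearIsometryEquiv.apply_symm_apply]
      rw [h1, LinearIsometryEquiv.eq_symm_apply]
      have h2 : ∀ w, R δ (R γ w) = R (δ * γ) w := fun w => by rw [map_mul]; rfl
      rw [h2, LinearIsometryEquiv.apply_symm_apply]
    · have h' : ¬ ∃ δ : Γ, MulOpposite.op δ • y = MulOpposite.op γ • x := by
        rintro ⟨δ, hδ⟩
        refine h ⟨δ * γ⁻¹, ?_⟩
        rw [MulOpposite.op_mul, mul_smul, hδ, MulOpposite.op_inv, inv_smul_smul]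
      rw [hb0 x h, hb0 _ h']
      simp
  · change b y = A
    have := hb 1
    rw [MulOpposite.op_one, one_smul] at this
    rw [this]
    ext v
    change (R 1).symm (A (R 1 v)) = A v
    rw [map_one]
    rfl

/-- The representative is chosen only up to its germ, but at a principal ultrafilter the germ and
freeness fix its value at y itself. -/
theorem CoarseGroupoid.rep_pair [IsIsometricSMul Γᵐᵒᵖ X] (hX : BoundedGeometry X)
    (hfree : ∀ (x : X) (γ : Γ), MulOpposite.op γ • x = x → γ = 1) (x y : X) :
    (CoarseGroupoid.pair (Γ := Γ) x y).rep y = x := by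
  have h1 : ({orbit Γ (x, y)} : Set (Orbits Γ (X × X))) ∈ (CoarseGroupoid.pair (Γ := Γ) x y).1 :=
    Set.mem_singleton _
  rw [CoarseGroupoid.rep_spec hX hfree, mem_germ] at h1
  have h2 : orbit Γ ((CoarseGroupoid.pair (Γ := Γ) x y).rep y, y) = orbit Γ (x, y) := h1 y rfl
  obtain ⟨γ, hγ⟩ := exists_smul_eq_of_orbit_eq h2
  obtain ⟨h3, h4⟩ := Prod.mk.inj hγ
  have h5 : γ = 1 := MulOpposite.unop_injective (hfree y γ.unop h4)
  rw [← h3, h5, one_smul]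

/-- The operator at ω = [y] already sees all of T: the elements [x, y] of G_ω stand for the points
x, and v(z) is encoded by the rank one operator w ↦ ⟨e, w⟩ v(z) in A_ω ≅ 𝒦. -/
theorem sum_norm_kernel_sq_le_of_isFamily [IsIsometricSMul Γᵐᵒᵖ X] (hX : BoundedGeometry X)
    (hfree : ∀ (x : X) (γ : Γ), MulOpposite.op γ • x = x → γ = 1)
    {T : HilbertSum X F →L[ℂ] HilbertSum X F} {hT : IsBandOperator R T} {A : RegularFamilies X R}
    (hA : hT.IsFamily A) (y : X) {e : F} (he : ‖e‖ = 1)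
    (s t : Finset X) (v : X → F) :
    ∑ x ∈ t, ‖∑ z ∈ s, kernel T x z (v z)‖ ^ 2 ≤ ‖A‖ ^ 2 * ∑ z ∈ s, ‖v z‖ ^ 2 := by
  classical
  let ω : Ultrafilter (Orbits Γ X) := pure (orbit Γ y)
  let pt : X → SourceFiber Γ ω := fun x => ⟨CoarseGroupoid.pair x y, rfl⟩
  have hpt : ∀ x, (pt x).1.rep y = x := fun x => CoarseGroupoid.rep_pair hX hfree x y
  have hpt_inj : Function.Injective pt := fun x z h => by rw [← hpt x, h, hpt z]
  choose b hb using fun w : F => exists_coeff_apply_eq (R := R) hfree y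
    (isCompactOperator_rankOne w e)
  let ξ : SourceFiber Γ ω → Fiber R ω := fun g => Fiber.mk R ω (b (v (g.1.rep y)))
  let Ξ := L2.cut (s.image pt) ξ
  -- If b_z is the rank one operator of v(z), then ‖b_z w‖ ≤ ‖v z‖ ‖w‖ because e is a unit vector.
  have hΞ : ‖Ξ‖ ^ 2 ≤ ∑ z ∈ s, ‖v z‖ ^ 2 := by
    rw [L2.norm_cut_sq, Finset.sum_image hpt_inj.injOn]
    have h1 : ∑ z ∈ s, star (ξ (pt z)) * ξ (pt z) =
        Fiber.mk R ω (∑ z ∈ s, star (b (v z)) * b (v z)) := by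
      rw [map_sum]
      refine Finset.sum_congr rfl fun z _ => ?_
      rw [Fiber.mk_mul, Fiber.mk_star]
      simp only [ξ, hpt]
    rw [h1, Fiber.norm_mk_pure, Coeff.sum_apply]
    refine norm_sum_star_mul_self_le s (fun z => b (v z) y) (by positivity) fun w => ?_
    rw [Finset.sum_mul]
    refine Finset.sum_le_sum fun z _ => ?_
    rw [hb, ← mul_pow]
    refine pow_le_pow_left₀ (norm_nonneg _) ?_ 2
    change ‖inner ℂ e w • v z‖ ≤ _
    rw [norm_smul, mul_comm]
    gcongr
    refine (norm_inner_le_norm _ _).trans_eq ?_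
    rw [he, one_mul]
  let c : X → Coeff X R := fun x => ∑ z ∈ s, hT.compress (pt x).1.rep (pt z).1.rep * b (v z)
  have hc : ∀ x, A.op ω Ξ (pt x) = Fiber.mk R ω (c x) := fun x => by
    rw [(hA ω Ξ (pt x)).unique (L2.hasSum_mul_cut (fun h => hT.entry (pt x) h) _ ξ),
      Finset.sum_image hpt_inj.injOn, map_sum]
    refine Finset.sum_congr rfl fun z _ => ?_
    rw [Fiber.mk_mul]
    simp only [ξ, hpt]
    rfl
  -- Evaluation at e undoes the encoding, since ⟨e, e⟩ = 1.
  have hcy : ∀ x, c x y e = ∑ z ∈ s, kernel T x z (v z) := fun x => by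
    rw [Coeff.sum_apply, _root_.sum_apply]
    refine Finset.sum_congr rfl fun z _ => ?_
    rw [Coeff.mul_apply, IsBandOperator.compress_apply, hb, hpt, hpt]
    change kernel T x z (inner ℂ e e • v z) = _
    rw [inner_self_eq_norm_sq_to_K, he]
    simp
  calc _ = ∑ x ∈ t, ‖c x y e‖ ^ 2 := by simp only [hcy]
    _ ≤ ‖∑ x ∈ t, star (c x y) * c x y‖ * ‖e‖ ^ 2 := sum_norm_sq_le_norm_sum t (fun x => c x y) e
    _ = ‖∑ g ∈ t.image pt, star (A.op ω Ξ g) * A.op ω Ξ g‖ := by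
        rw [he, one_pow, mul_one, Finset.sum_image hpt_inj.injOn]
        have h1 : ∑ x ∈ t, star (A.op ω Ξ (pt x)) * A.op ω Ξ (pt x) =
            Fiber.mk R ω (∑ x ∈ t, star (c x) * c x) := by
          rw [map_sum]
          exact Finset.sum_congr rfl fun x _ => by rw [hc, Fiber.mk_mul, Fiber.mk_star]
        rw [h1, Fiber.norm_mk_pure, Coeff.sum_apply]
        rfl
    _ ≤ ‖A.op ω Ξ‖ ^ 2 := L2.norm_sum_le _ _
    _ ≤ (‖A‖ * ‖Ξ‖) ^ 2 := by
        refine pow_le_pow_left₀ (norm_nonneg _) (((A.op ω).le_opNorm _).trans ?_) 2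
        gcongr
        exact A.norm_op_le ω
    _ ≤ _ := by
        rw [mul_pow]
        gcongr

theorem norm_le_of_isFamily [IsIsometricSMul Γᵐᵒᵖ X] (hX : BoundedGeometry X)
    (hfree : ∀ (x : X) (γ : Γ), MulOpposite.op γ • x = x → γ = 1)
    {T : HilbertSum X F →L[ℂ] HilbertSum X F} {hT : IsBandOperator R T} {A : RegularFamilies X R}
    (hA : hT.IsFamily A) : ‖T‖ ≤ ‖A‖ := by
  refine T.opNorm_le_bound (norm_nonneg _) fun ξ => ?_
  by_cases hξ : ∃ y, ξ y ≠ 0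
  · obtain ⟨y, hy⟩ := hξ
    -- A nonzero ξ supplies both a base point of X and a unit vector of F; any other choice would
    -- serve.
    have he : ‖((‖ξ y‖⁻¹ : ℝ) : ℂ) • ξ y‖ = 1 := by
      rw [norm_smul, Complex.norm_real, norm_inv, norm_norm, inv_mul_cancel₀ (norm_ne_zero_iff.2 hy)]
    rw [← pow_le_pow_iff_left₀ (norm_nonneg _) (by positivity) two_ne_zero]
    refine le_of_tendsto' (hasSum_norm_sq (T ξ)) fun t => ?_
    have hlim : Filter.Tendsto (fun s : Finset X => ∑ x ∈ t, ‖∑ z ∈ s, kernel T x z (ξ z)‖ ^ 2)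
        Filter.atTop (nhds (∑ x ∈ t, ‖T ξ x‖ ^ 2)) :=
      tendsto_finsetSum t fun x _ => (Filter.Tendsto.norm (hasSum_kernel T ξ x)).pow 2
    refine le_of_tendsto' hlim fun s => 
      (sum_norm_kernel_sq_le_of_isFamily hX hfree hA y he s t ξ).trans ?_
    rw [mul_pow]
    gcongr
    exact sum_norm_sq_le ξ s
  · push Not at hξ
    have : ξ = 0 := lp.ext (funext hξ)
    rw [this, map_zero, norm_zero]
    positivity

end RegularFamily

end

section

open HilbertSum

/-! ### Compactly supported sections correspond to band operators. -/

section Sections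

variable {Γ X F : Type*} [Group Γ] [MetricSpace X] [MulAction Γᵐᵒᵖ X]
  [NormedAddCommGroup F] [InnerProductSpace ℂ F] [CompleteSpace F]
  {R : Γ →* (F ≃ₗᵢ[ℂ] F)}

/-- `‖K(x, y) - a(y)‖ → 0` as `[x, y] → p`, for each representative `a` of `k(p)`. -/
def Represents (k : (g : CoarseGroupoid Γ X) → Fiber R g.s) (K : X → X → F →L[ℂ] F) : Prop :=
  ∀ (p : CoarseGroupoid Γ X) (a : Coeff X R), Fiber.mk R p.s a = k p → ∀ ε > 0,
    ∀ᶠ q in (p.1 : Filter (Orbits Γ (X × X))), ∀ x y, orbit Γ (x, y) = q → ‖K x y - a y‖ ≤ ε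

theorem action_mk_of_transports {g : CoarseGroupoid Γ X} {ω ω' : Ultrafilter (Orbits Γ X)}
    (hs : g.s = ω) (hr : g.r = ω') {a b : Coeff X R} (h : Transports R g a b) :
    action g hs hr (Fiber.mk R ω a) = Fiber.mk R ω' b := by
  subst hs hr
  exact action_mk g h

theorem Represents.hasKernel {k : (g : CoarseGroupoid Γ X) → Fiber R g.s}
    {T : HilbertSum X F →L[ℂ] HilbertSum X F} (hk : Represents k (kernel T)) : HasKernel k T := by
  intro a ha ξ x
  -- At a point [x, y] the ultrafilter is principal, so convergence is equality.
  have h1 : ∀ y, a x y y = kernel T x y := fun y => by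
    rw [eq_comm, ← sub_eq_zero, ← norm_le_zero_iff]
    refine le_of_forall_pos_le_add fun ε hε => ?_
    rw [zero_add]
    exact hk _ _ (ha x y) ε hε x y rfl
  simp only [h1]
  exact hasSum_kernel T ξ x

/-- The point of the groupoid given by an orbit of pairs. -/
def CoarseGroupoid.ofOrbit (q : Orbits Γ (X × X)) : CoarseGroupoid Γ X :=
  ⟨pure q, by
    induction q using Quotient.inductionOn' with | h q =>
    exact (CoarseGroupoid.pair (Γ := Γ) q.1 q.2).2⟩

theorem CoarseGroupoid.tendsto_ofOrbit (p : CoarseGroupoid Γ X) :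
    Filter.Tendsto CoarseGroupoid.ofOrbit (p.1 : Filter (Orbits Γ (X × X))) (nhds p) :=
  tendsto_subtype_rng.2 (Ultrafilter.tendsto_pure_self p.1)

theorem CoarseGroupoid.isOpen_mem (S : Set (Orbits Γ (X × X))) :
    IsOpen {g : CoarseGroupoid Γ X | S ∈ g.1} :=
  (ultrafilter_isOpen_basic S).preimage continuous_subtype_val

/-- Every ultrafilter containing Δ_r/Γ belongs to the groupoid, so this set is a full basic clopen
subset of the compact space β((X × X)/Γ). -/
theorem CoarseGroupoid.isCompact_entourage (r : ℝ≥0) :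
    IsCompact {g : CoarseGroupoid Γ X | entourage Γ X r ∈ g.1} := by
  refine (Topology.IsInducing.subtypeVal (t := (⋃ R : ℝ≥0, closure (pure '' entourage Γ X R) :
    Set (Ultrafilter (Orbits Γ (X × X)))))).isCompact_iff.2 ?_
  have h : Subtype.val '' {g : CoarseGroupoid Γ X | entourage Γ X r ∈ g.1} =
      {u : Ultrafilter (Orbits Γ (X × X)) | entourage Γ X r ∈ u} := by
    ext u
    constructor
    · rintro ⟨g, hg, rfl⟩
      exact hg
    · intro hu
      exact ⟨CoarseGroupoid.ofMem u r hu, hu, rfl⟩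
  exact h ▸ (ultrafilter_isClosed_basic (entourage Γ X r)).isCompact

variable [IsIsometricSMul Γᵐᵒᵖ X]

/-- If a represents k(gh⁻¹), then T(g x, h x) - a(h x) → 0 as [x] → ω. Since h⁻¹ is the limit of [x,
h x], this says that α_h⁻¹ takes the class of a to that of x ↦ T(g x, h x), the entry at (g, h). -/
theorem Represents.isRegularRep (hX : BoundedGeometry X)
    (hfree : ∀ (x : X) (γ : Γ), MulOpposite.op γ • x = x → γ = 1)
    {k : (g : CoarseGroupoid Γ X) → Fiber R g.s} {T : HilbertSum X F →L[ℂ] HilbertSum X F}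
    (hk : Represents k (kernel T)) {hT : IsBandOperator R T} {A : RegularFamilies X R}
    (hA : hT.IsFamily A) : IsRegularRep k A := by
  intro ω ξ g
  refine (hA ω ξ g).congr_fun fun h => ?_
  congr 1
  have hgh : g.1.s = h.1.inv.r := g.2.trans (h.2.symm.trans h.1.r_inv.symm)
  obtain ⟨a, ha⟩ := Fiber.mk_surjective (k (g.1.comp h.1.inv hgh))
  rw [← ha]
  refine action_mk_of_transports _ _ fun ε hε => ?_
  have h1 := hk _ a ha ε hε
  rw [CoarseGroupoid.comp_inv_eq hX hfree g.2 h.2 hgh] at h1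
  have h2 : h.1.inv.1 = germ ω (.id _) h.1.rep := by
    change h.1.1.map _ = _
    rw [SourceFiber.coe_eq_germ hX hfree h, germ, germ, Ultrafilter.map_map]
    congr 1
    ext z
    induction z using Quotient.inductionOn'
    rfl
  rw [h2]
  refine mem_germ.2 (EventuallyAt.mono (mem_germ.1 h1) fun z hz x y hxy => ?_)
  obtain ⟨γ, hγ⟩ := exists_smul_eq_of_orbit_eq hxy
  obtain ⟨h3, h4⟩ := Prod.mk.inj hγ
  have h3 : x = γ • z := h3.symm
  have h4 : y = h.1.rep x := by rw [h3, map_smul]; exact h4.symm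
  rw [h4, IsBandOperator.compress_apply]
  refine hz _ _ ?_
  rw [h3, map_smul, map_smul, ← Prod.smul_mk, orbit_smul]

/-- The section has value the class of y ↦ T(g y, y) at g. -/
theorem IsBandOperator.exists_section (hX : BoundedGeometry X)
    (hfree : ∀ (x : X) (γ : Γ), MulOpposite.op γ • x = x → γ = 1)
    {T : HilbertSum X F →L[ℂ] HilbertSum X F} (hT : IsBandOperator R T) :
    ∃ k : (g : CoarseGroupoid Γ X) → Fiber R g.s,
      IsCompactlySupportedSection R k ∧ Represents k (kernel T) := by
  refine ⟨fun g => Fiber.mk R g.s (hT.compress g.rep (.id _)), ⟨fun g₀ ε hε => ?_, ?_⟩, ?_⟩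
  · refine ⟨hT.compress g₀.rep (.id _), ?_⟩
    -- Every g containing V has the same representative as g₀ near its own source, so the section
    -- agrees there with one induced by a single element of A.
    let V : Set (Orbits Γ (X × X)) := {p | ∃ x, p = orbit Γ (g₀.rep x, x)}
    have hV : V ∈ g₀.1 := by
      rw [CoarseGroupoid.rep_spec hX hfree g₀]
      exact mem_germ.2 (EventuallyAt.of_forall fun x => ⟨x, rfl⟩)
    filter_upwards [(CoarseGroupoid.isOpen_mem V).mem_nhds hV] with g hg
    have hg : V ∈ g.1 := hg
    rw [CoarseGroupoid.rep_spec hX hfree g, mem_germ] at hg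
    have h1 : Fiber.mk R g.s (hT.compress g.rep (.id _)) =
        Fiber.mk R g.s (hT.compress g₀.rep (.id _)) := by
      refine Fiber.mk_eq_of_eventuallyAt (hg.mono ?_)
      rintro x ⟨z, hz⟩
      obtain ⟨γ, hγ⟩ := exists_smul_eq_of_orbit_eq hz
      obtain ⟨h3, h4⟩ := Prod.mk.inj hγ
      have h4 : γ • z = x := h4
      have h5 : g.rep x = g₀.rep x :=
        h3.symm.trans ((map_smul g₀.rep γ z).symm.trans (congrArg g₀.rep h4))
      rw [IsBandOperator.compress_apply, IsBandOperator.compress_apply, h5]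
    rwa [h1, sub_self, norm_zero]
  · obtain ⟨r, hr⟩ := hT.propagation
    refine ⟨_, CoarseGroupoid.isCompact_entourage r, fun g hg => ?_⟩
    have hg : ¬ entourage Γ X r ∈ g.1 := hg
    rw [← Ultrafilter.compl_mem_iff_notMem, CoarseGroupoid.rep_spec hX hfree g, mem_germ] at hg
    rw [← map_zero (Fiber.mk R g.s)]
    refine Fiber.mk_eq_of_eventuallyAt (hg.mono fun x hx => ?_)
    refine hr _ _ (not_le.1 fun h => hx ⟨(g.rep x, x), h, rfl⟩)
  · intro p a ha ε hε
    rw [CoarseGroupoid.rep_spec hX hfree p]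
    have h1 : EventuallyAt p.s fun x => ‖(hT.compress p.rep (.id _) - a) x‖ ≤ ε := by
      refine (Fiber.eventuallyAt_norm_apply_le _ hε).mono fun x hx => hx.trans ?_
      rw [map_sub, ha, sub_self, norm_zero, zero_add]
    refine mem_germ.2 (h1.mono fun z hz x y hxy => ?_)
    obtain ⟨γ, hγ⟩ := exists_smul_eq_of_orbit_eq hxy
    obtain ⟨h3, h4⟩ := Prod.mk.inj hγ
    have h4 : y = γ • z := h4.symm
    have h3 : x = p.rep y := by rw [h4, map_smul]; exact h3.symm
    rw [h3]
    rw [← Coeff.norm_apply_smul _ γ, ← h4] at hz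
    exact hz

theorem IsCompactlySupportedSection.exists_norm_le {k : (g : CoarseGroupoid Γ X) → Fiber R g.s}
    (hk : IsCompactlySupportedSection R k) : ∃ C, ∀ g, ‖k g‖ ≤ C := by
  obtain ⟨K, hK, hK0⟩ := hk.compactSupport
  obtain ⟨C, hC⟩ : ∃ C, ∀ g ∈ K, ‖k g‖ ≤ C := by
    refine hK.induction_on (p := fun s => ∃ C, ∀ g ∈ s, ‖k g‖ ≤ C) ⟨0, fun g hg => hg.elim⟩ ?_ ?_ ?_
    · rintro s t hst ⟨C, hC⟩
      exact ⟨C, fun g hg => hC g (hst hg)⟩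
    · rintro s t ⟨C, hC⟩ ⟨D, hD⟩
      refine ⟨max C D, ?_⟩
      rintro g (hg | hg)
      · exact (hC g hg).trans (le_max_left _ _)
      · exact (hD g hg).trans (le_max_right _ _)
    · intro g _
      obtain ⟨a, ha⟩ := hk.continuous g 1 one_pos
      refine ⟨_, mem_nhdsWithin_of_mem_nhds ha, ‖a‖ + 1, fun g' hg' => ?_⟩
      have h1 : ‖k g' - Fiber.mk R g'.s a‖ < 1 := hg'
      have h2 := norm_le_norm_add_norm_sub' (k g') (Fiber.mk R g'.s a)
      have h3 := Fiber.norm_mk_le (ω := g'.s) a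
      linarith
  refine ⟨max C 0, fun g => ?_⟩
  by_cases hg : g ∈ K
  · exact (hC g hg).trans (le_max_left _ _)
  · rw [hK0 g hg, norm_zero]
    exact le_max_right _ _

/-- The sets {g | Δ_r/Γ ∈ g} are open, increase with r and cover the groupoid, so one of them
contains the compact support. -/
theorem IsCompactlySupportedSection.exists_propagation
    {k : (g : CoarseGroupoid Γ X) → Fiber R g.s} (hk : IsCompactlySupportedSection R k) :
    ∃ r : ℝ≥0, ∀ g : CoarseGroupoid Γ X, entourage Γ X r ∉ g.1 → k g = 0 := by
  have hmono : ∀ r r' : ℝ≥0, r ≤ r' → entourage Γ X r ⊆ entourage Γ X r' := fun r r' h =>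
    Set.image_mono fun p (hp : dist p.1 p.2 ≤ r) => hp.trans (NNReal.coe_le_coe.2 h)
  obtain ⟨K, hK, hK0⟩ := hk.compactSupport
  obtain ⟨r, hr⟩ : ∃ r : ℝ≥0, ∀ g ∈ K, entourage Γ X r ∈ g.1 := by
    refine hK.induction_on (p := fun s => ∃ r : ℝ≥0, ∀ g ∈ s, entourage Γ X r ∈ g.1)
      ⟨0, fun g hg => hg.elim⟩ ?_ ?_ ?_
    · rintro s t hst ⟨C, hC⟩
      exact ⟨C, fun g hg => hC g (hst hg)⟩
    · rintro s t ⟨C, hC⟩ ⟨D, hD⟩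
      refine ⟨max C D, ?_⟩
      rintro g (hg | hg)
      · exact Filter.mem_of_superset (hC g hg) (hmono _ _ (le_max_left _ _))
      · exact Filter.mem_of_superset (hD g hg) (hmono _ _ (le_max_right _ _))
    · intro g _
      obtain ⟨r, hr⟩ := g.exists_entourage_mem
      exact ⟨_, mem_nhdsWithin_of_mem_nhds ((CoarseGroupoid.isOpen_mem _).mem_nhds hr), r,
        fun g' hg' => hg'⟩
  exact ⟨r, fun g hg => hK0 g fun h => hg (hr g h)⟩

/-- The kernel is read off at the points [x, y]. Boundedness and propagation come from compact
support, and the approximation at limit points from continuity of k. -/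
theorem IsCompactlySupportedSection.exists_isBandOperator (hX : BoundedGeometry X)
    {k : (g : CoarseGroupoid Γ X) → Fiber R g.s} (hk : IsCompactlySupportedSection R k) :
    ∃ T : HilbertSum X F →L[ℂ] HilbertSum X F, IsBandOperator R T ∧ Represents k (kernel T) := by
  choose a ha using fun x y : X => Fiber.mk_surjective (k (CoarseGroupoid.pair x y))
  have hnorm : ∀ x y, ‖a x y y‖ = ‖k (CoarseGroupoid.pair x y)‖ := fun x y => by
    rw [← ha]
    exact (Fiber.norm_mk_pure (a x y) y).symm
  have hdist : ∀ x y (b : Coeff X R), ‖a x y y - b y‖ =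
      ‖k (CoarseGroupoid.pair x y) - Fiber.mk R (CoarseGroupoid.pair (Γ := Γ) x y).s b‖ :=
    fun x y b => by
    rw [← ha, ← map_sub]
    exact (Fiber.norm_mk_pure (a x y - b) y).symm
  obtain ⟨C, hC⟩ := hk.exists_norm_le
  obtain ⟨r, hr⟩ := hk.exists_propagation
  have hprop : ∀ x y, r < dist x y → a x y y = 0 := fun x y hxy => by
    rw [← norm_eq_zero, hnorm, hr, norm_zero]
    intro h
    have h' : orbit Γ (x, y) ∈ entourage Γ X r := h
    exact not_le.2 hxy (CoarseGroupoid.dist_le_of_orbit_mem h')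
  obtain ⟨T, hT⟩ := exists_kernel_eq hX (K := fun x y => a x y y) (r := r)
    (fun x y => (hnorm x y).trans_le (hC _)) hprop
  refine ⟨T, ⟨⟨r, fun x y h => ?_⟩, fun x y => ?_, fun γ x y v => ?_⟩, fun p b hb ε hε => ?_⟩
  · rw [hT, hprop x y h]
  · rw [hT]
    exact (a x y).2.1 y
  · rw [hT, hT]
    have h1 : (CoarseGroupoid.pair (MulOpposite.op γ • x) (MulOpposite.op γ • y) :
        CoarseGroupoid Γ X) = CoarseGroupoid.pair x y := by
      refine Subtype.ext ?_
      change (pure (orbit Γ (MulOpposite.op γ • (x, y))) : Ultrafilter _) = pure (orbit Γ (x, y))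
      rw [orbit_smul]
    have h2 : ∀ (p q : CoarseGroupoid Γ X) (c : Coeff X R), p = q → Fiber.mk R p.s c = k p →
        Fiber.mk R q.s c = k q := by
      rintro p _ c rfl h
      exact h
    -- The lifts chosen at (x, y) and (xγ, yγ) may differ, but both represent k at the same groupoid
    -- element, so they agree at y.
    have h3 := h2 _ _ _ h1 (ha (MulOpposite.op γ • x) (MulOpposite.op γ • y))
    have h4 : a x y y = a (MulOpposite.op γ • x) (MulOpposite.op γ • y) y := by
      rw [← sub_eq_zero, ← norm_eq_zero, hdist, h3, sub_self, norm_zero]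
    rw [h4]
    exact (a (MulOpposite.op γ • x) (MulOpposite.op γ • y)).2.2 y γ v
  · obtain ⟨c, hc⟩ := hk.continuous p (ε / 3) (by positivity)
    have h1 := hc.self_of_nhds
    rw [← hb, ← map_sub] at h1
    have h2 : EventuallyAt p.s fun y => ‖(b - c) y‖ ≤ ε / 3 + ε / 3 :=
      (Fiber.eventuallyAt_norm_apply_le (b - c) (show 0 < ε / 3 by positivity)).mono
        fun y hy => hy.trans (by linarith)
    have h3 : ∀ᶠ q in (p.1 : Filter (Orbits Γ (X × X))), ∀ y, orbit Γ y =
      orbitMap (Γ := Γ) (Prod.snd : X × X → X) (fun _ _ => rfl) q → ‖(b - c) y‖ ≤ ε / 3 + ε / 3 := h2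
    filter_upwards [h3, p.tendsto_ofOrbit.eventually hc] with q hq1 hq2 x y hxy
    subst hxy
    have h4 : ‖a x y y - c y‖ < ε / 3 := by
      rw [hdist]
      exact hq2
    have h5 : ‖b y - c y‖ ≤ ε / 3 + ε / 3 := hq1 y rfl
    rw [hT]
    have h6 : a x y y - b y = (a x y y - c y) - (b y - c y) := by abel
    rw [h6]
    refine (norm_sub_le _ _).trans ?_
    linarith

end Sections

end

section

open HilbertSum

/-! ### Isomorphisms of C⋆-algebras from norm preserving correspondences. -/

section Closures

variable {P A B : Type*} [NonUnitalCStarAlgebra P] [NonUnitalCStarAlgebra A]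
  [NonUnitalCStarAlgebra B]

/-- A star homomorphism that is isometric on a star subalgebra identifies its closure with the
C⋆-algebra generated by the image. -/
theorem exists_starAlgEquiv_topologicalClosure (S : NonUnitalStarSubalgebra ℂ P)
    (φ : P →⋆ₙₐ[ℂ] A) (hiso : ∀ p ∈ S, ‖φ p‖ = ‖p‖) {s : Set A} (hs : φ '' S = s) :
    ∃ e : S.topologicalClosure ≃⋆ₐ[ℂ] (NonUnitalStarAlgebra.adjoin ℂ s).topologicalClosure,
      ∀ p, (e p).1 = φ p.1 := by
  have hφ : Continuous φ := AddMonoidHomClass.continuous_of_bound φ 1 fun p => by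
    rw [one_mul]
    exact NonUnitalStarAlgHom.norm_apply_le φ p
  have hiso' : ∀ p ∈ S.topologicalClosure, ‖φ p‖ = ‖p‖ := fun p hp =>
    closure_minimal (t := {p | ‖φ p‖ = ‖p‖}) hiso (isClosed_eq hφ.norm continuous_norm) hp
  have hmem : ∀ p : S.topologicalClosure,
      φ p.1 ∈ (NonUnitalStarAlgebra.adjoin ℂ s).topologicalClosure := fun p => by
    have h1 : p.1 ∈ closure (φ ⁻¹' s) := by
      refine closure_mono ?_ p.2
      rw [← hs]
      exact Set.subset_preimage_image φ S
    exact closure_mono (NonUnitalStarAlgebra.subset_adjoin ℂ s) (hφ.closure_preimage_subset s h1)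
  let ψ : S.topologicalClosure →⋆ₙₐ[ℂ] (NonUnitalStarAlgebra.adjoin ℂ s).topologicalClosure :=
    NonUnitalStarAlgHom.codRestrict
      (φ.comp (NonUnitalStarSubalgebraClass.subtype S.topologicalClosure)) _ hmem
  have hψiso : Isometry fun p : S.topologicalClosure => φ p.1 := by
    refine Isometry.of_dist_eq fun p q => ?_
    rw [dist_eq_norm, ← map_sub, hiso' _ (sub_mem p.2 q.2), Subtype.dist_eq, dist_eq_norm]
  have : CompleteSpace S.topologicalClosure :=
    S.isClosed_topologicalClosure.completeSpace_coe
  -- An isometric image of a complete space is closed, so it contains the closure of the algebra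
  -- generated by s.
  have hcl : IsClosed (Set.range fun p : S.topologicalClosure => φ p.1) :=
    hψiso.isClosedEmbedding.isClosed_range
  have hsub : ((NonUnitalStarAlgebra.adjoin ℂ s).topologicalClosure : Set A) ⊆
      Set.range fun p : S.topologicalClosure => φ p.1 := by
    refine closure_minimal (fun a ha => ?_) hcl
    have h1 : NonUnitalStarAlgebra.adjoin ℂ s ≤ S.map φ := by
      refine NonUnitalStarAlgebra.adjoin_le ?_
      rw [← hs]
      rfl
    obtain ⟨p, hp, rfl⟩ := h1 ha
    exact ⟨⟨p, S.le_topologicalClosure hp⟩, rfl⟩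
  refine ⟨StarAlgEquiv.ofBijective ψ ⟨fun p q hpq => ?_, fun a => ?_⟩, fun p => rfl⟩
  · exact hψiso.injective (congrArg Subtype.val hpq)
  · obtain ⟨p, hp⟩ := hsub a.2
    exact ⟨p, Subtype.ext hp⟩

/-- A norm preserving correspondence between generating sets that is a star subalgebra of the
product extends to an isomorphism. -/
theorem exists_starAlgEquiv_of_correspondence (S : NonUnitalStarSubalgebra ℂ (A × B))
    (hS : ∀ p ∈ S, ‖p.1‖ = ‖p.2‖) {s : Set A} {t : Set B} (hs : Prod.fst '' (S : Set (A × B)) = s)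
    (ht : Prod.snd '' (S : Set (A × B)) = t) :
    ∃ Φ : (NonUnitalStarAlgebra.adjoin ℂ s).topologicalClosure ≃⋆ₐ[ℂ]
        (NonUnitalStarAlgebra.adjoin ℂ t).topologicalClosure,
      ∀ p ∈ S, ∀ h, (Φ ⟨p.1, h⟩).1 = p.2 := by
  -- The product has the maximum norm, so both projections are isometric on S; Φ goes up one
  -- projection and down the other.
  obtain ⟨e, he⟩ := exists_starAlgEquiv_topologicalClosure S (NonUnitalStarAlgHom.fst ℂ A B)
    (fun p hp => by
      change ‖p.1‖ = max ‖p.1‖ ‖p.2‖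
      rw [hS p hp, max_self]) hs
  obtain ⟨f, hf⟩ := exists_starAlgEquiv_topologicalClosure S (NonUnitalStarAlgHom.snd ℂ A B)
    (fun p hp => by
      change ‖p.2‖ = max ‖p.1‖ ‖p.2‖
      rw [hS p hp, max_self]) ht
  refine ⟨e.symm.trans f, fun p hp h => ?_⟩
  have h1 : (⟨p.1, h⟩ : (NonUnitalStarAlgebra.adjoin ℂ s).topologicalClosure) =
      e ⟨p, S.le_topologicalClosure hp⟩ := 
    Subtype.ext (he ⟨p, S.le_topologicalClosure hp⟩).symm
  rw [h1]
  change (f (e.symm (e _))).1 = _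
  rw [e.symm_apply_apply, hf]
  rfl

/-- Isomorphisms of C⋆-algebras are automatically isometric, so agreement on generators extends to
the closure by continuity. -/
theorem starAlgEquiv_ext_of_adjoin {s : Set A} {C : NonUnitalStarSubalgebra ℂ B}
    (hC : IsClosed (C : Set B))
    {Φ Ψ : (NonUnitalStarAlgebra.adjoin ℂ s).topologicalClosure ≃⋆ₐ[ℂ] C}
    (h : ∀ a ∈ s, ∀ ha, Φ ⟨a, ha⟩ = Ψ ⟨a, ha⟩) : Φ = Ψ := by
  have hcl : IsClosed ((NonUnitalStarAlgebra.adjoin ℂ s).topologicalClosure : Set A) :=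
    NonUnitalStarSubalgebra.isClosed_topologicalClosure _
  have hle : ∀ a ∈ NonUnitalStarAlgebra.adjoin ℂ s,
      a ∈ (NonUnitalStarAlgebra.adjoin ℂ s).topologicalClosure :=
    fun a ha => NonUnitalStarSubalgebra.le_topologicalClosure _ ha
  have hadj : ∀ a (ha : a ∈ NonUnitalStarAlgebra.adjoin ℂ s),
      Φ ⟨a, hle a ha⟩ = Ψ ⟨a, hle a ha⟩ := fun a ha => by
    induction ha using NonUnitalStarAlgebra.adjoin_induction with
    | mem a ha => exact h a ha _
    | add a b ha hb h1 h2 =>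
      exact (map_add Φ ⟨a, hle a ha⟩ ⟨b, hle b hb⟩).trans ((congrArg₂ (· + ·) h1 h2).trans
        (map_add Ψ _ _).symm)
    | zero => exact (map_zero Φ).trans (map_zero Ψ).symm
    | mul a b ha hb h1 h2 =>
      exact (map_mul Φ ⟨a, hle a ha⟩ ⟨b, hle b hb⟩).trans ((congrArg₂ (· * ·) h1 h2).trans
        (map_mul Ψ _ _).symm)
    | smul c a ha h1 =>
      exact (map_smul Φ c ⟨a, hle a ha⟩).trans ((congrArg (c • ·) h1).trans
        (map_smul Ψ c _).symm)
    | star a ha h1 =>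
      exact (map_star Φ ⟨a, hle a ha⟩).trans ((congrArg star h1).trans (map_star Ψ _).symm)
  have hdense : Dense {a : (NonUnitalStarAlgebra.adjoin ℂ s).topologicalClosure |
      a.1 ∈ NonUnitalStarAlgebra.adjoin ℂ s} := fun a => by
    have ha : a.1 ∈ closure ((NonUnitalStarAlgebra.adjoin ℂ s :
      NonUnitalStarSubalgebra ℂ A) : Set A) := a.2
    refine closure_subtype.2 (closure_mono (fun b hb => ?_) ha)
    exact ⟨⟨b, hle b hb⟩, hb, rfl⟩
  refine DFunLike.coe_injective (Continuous.ext_on hdense ?_ ?_ fun a ha => hadj a.1 ha)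
  · exact (StarAlgEquiv.isometry Φ).continuous
  · exact (StarAlgEquiv.isometry Ψ).continuous

end Closures

/-! ### The canonical isomorphism. -/

section Correspondence

variable {Γ X F : Type*} [Group Γ] [MetricSpace X] [MulAction Γᵐᵒᵖ X] [IsIsometricSMul Γᵐᵒᵖ X]
  [NormedAddCommGroup F] [InnerProductSpace ℂ F] [CompleteSpace F]
  {R : Γ →* (F ≃ₗᵢ[ℂ] F)}

/-- `HasKernel` quantifies over all lifts of the values of k; it determines T because such lifts
exist. -/
theorem HasKernel.unique {k : (g : CoarseGroupoid Γ X) → Fiber R g.s}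
    {T S : HilbertSum X F →L[ℂ] HilbertSum X F} (hT : HasKernel k T) (hS : HasKernel k S) :
    T = S := by
  choose a ha using fun x y : X => Fiber.mk_surjective (k (CoarseGroupoid.pair x y))
  ext ξ x
  exact (hT a ha ξ x).unique (hS a ha ξ x)

theorem IsRegularRep.unique {k : (g : CoarseGroupoid Γ X) → Fiber R g.s} {A B : RegularFamilies X R}
    (hA : IsRegularRep k A) (hB : IsRegularRep k B) : A = B :=
  RegularFamilies.ext fun ω ξ g => (hA ω ξ g).unique (hB ω ξ g)

variable {E : Type*} [NormedAddCommGroup E] [InnerProductSpace ℂ E] [CompleteSpace E]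
  {ρ : C₀(X, ℂ) →⋆ₙₐ[ℂ] (E →L[ℂ] E)} {u : Γ →* (E ≃ₗᵢ[ℂ] E)} {W : E ≃ₗᵢ[ℂ] HilbertSum X F}

theorem isCompactOperator_conj_iff (T : E →L[ℂ] E) :
    IsCompactOperator (W.conjStarAlgEquiv T) ↔ IsCompactOperator T := by
  refine ⟨fun h => ?_, fun h => ?_⟩
  · have h1 := (h.comp_clm W.toContinuousLinearEquiv.toContinuousLinearMap).clm_comp
      W.symm.toContinuousLinearEquiv.toContinuousLinearMap
    refine (congrArg IsCompactOperator (funext fun v => ?_)).mp h1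
    change W.symm (W (T (W.symm (W v)))) = T v
    simp
  · exact (h.comp_clm W.symm.toContinuousLinearEquiv.toContinuousLinearMap).clm_comp
      W.toContinuousLinearEquiv.toContinuousLinearMap

theorem norm_conj (T : E →L[ℂ] E) : ‖W.conjStarAlgEquiv T‖ = ‖T‖ :=
  (ContinuousLinearMap.opNorm_linearIsometryEquiv_comp W _).trans
    (ContinuousLinearMap.opNorm_comp_linearIsometryEquiv T W.symm)

theorem IsModuleIso.conj_rep (hW : IsModuleIso ρ u R W) (f : C₀(X, ℂ)) :
    W.conjStarAlgEquiv (ρ f) = mulRep (ι := X) (E := F) f := by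
  ext1 ξ
  rw [LinearIsometryEquiv.conjStarAlgEquiv_apply_apply, hW.map_mul,
    LinearIsometryEquiv.apply_symm_apply]

theorem IsModuleIso.isRoeOperator_conj_iff (hW : IsModuleIso ρ u R W) (T : E →L[ℂ] E) :
    IsRoeOperator mulRep (diagonalRep X R) (W.conjStarAlgEquiv T) ↔ IsRoeOperator ρ u T := by
  have hmul : ∀ A B : E →L[ℂ] E, W.conjStarAlgEquiv A * W.conjStarAlgEquiv B =
      W.conjStarAlgEquiv (A * B) := fun A B => (_root_.map_mul W.conjStarAlgEquiv A B).symm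
  have hzero : ∀ A : E →L[ℂ] E, W.conjStarAlgEquiv A = 0 ↔ A = 0 := fun A =>
    map_eq_zero_iff W.conjStarAlgEquiv W.conjStarAlgEquiv.injective
  have h1 : (∃ r : ℝ≥0, ∀ f g : C₀(X, ℂ),
      (r : ℝ≥0∞) < ⨅ x ∈ tsupport f, ⨅ y ∈ tsupport g, edist x y →
        mulRep (ι := X) (E := F) f * W.conjStarAlgEquiv T * mulRep (ι := X) (E := F) g = 0) ↔
      ∃ r : ℝ≥0, ∀ f g : C₀(X, ℂ),
        (r : ℝ≥0∞) < ⨅ x ∈ tsupport f, ⨅ y ∈ tsupport g, edist x y → ρ f * T * ρ g = 0 := by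
    simp only [← hW.conj_rep, hmul, hzero]
  have h2 : (∀ f, IsCompactOperator (mulRep (ι := X) (E := F) f * W.conjStarAlgEquiv T) ∧
      IsCompactOperator (W.conjStarAlgEquiv T * mulRep (ι := X) (E := F) f)) ↔
      ∀ f, IsCompactOperator (ρ f * T) ∧ IsCompactOperator (T * ρ f) := by
    simp only [← hW.conj_rep, hmul, isCompactOperator_conj_iff]
  have h3 : (∀ γ ξ, diagonalRep X R γ (W.conjStarAlgEquiv T ((diagonalRep X R γ).symm ξ)) =
      W.conjStarAlgEquiv T ξ) ↔ ∀ γ v, u γ (T ((u γ).symm v)) = T v := by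
    have hsymm : ∀ γ v, (diagonalRep X R γ).symm (W v) = W ((u γ).symm v) := fun γ v => by
      rw [LinearIsometryEquiv.symm_apply_eq, ← hW.map_unitary, LinearIsometryEquiv.apply_symm_apply]
    have h4 : ∀ γ v, diagonalRep X R γ (W.conjStarAlgEquiv T ((diagonalRep X R γ).symm (W v))) =
        W (u γ (T ((u γ).symm v))) := fun γ v => by
      rw [hsymm, LinearIsometryEquiv.conjStarAlgEquiv_apply_apply,
        LinearIsometryEquiv.symm_apply_apply, hW.map_unitary]
    refine forall_congr' fun γ => ⟨fun h v => ?_, fun h ξ => ?_⟩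
    · have h5 := h (W v)
      rw [h4, LinearIsometryEquiv.conjStarAlgEquiv_apply_apply,
        LinearIsometryEquiv.symm_apply_apply] at h5
      exact W.injective h5
    · obtain ⟨v, rfl⟩ := W.surjective ξ
      rw [h4, h, LinearIsometryEquiv.conjStarAlgEquiv_apply_apply,
        LinearIsometryEquiv.symm_apply_apply]
  exact ⟨fun h => ⟨h1.1 h.1, h2.1 h.2, h3.1 h.3⟩, fun h => ⟨h1.2 h.1, h2.2 h.2, h3.2 h.3⟩⟩

/-- The pairs of a band operator `W T W*` and its family of operators on the modules
`ℓ²(G_ω) ⊗ A_ω`. -/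
noncomputable def bandCorrespondence (hX : BoundedGeometry X)
    (hfree : ∀ (x : X) (γ : Γ), MulOpposite.op γ • x = x → γ = 1) (R : Γ →* (F ≃ₗᵢ[ℂ] F))
    (W : E ≃ₗᵢ[ℂ] HilbertSum X F) :
    NonUnitalStarSubalgebra ℂ (RegularFamilies X R × (E →L[ℂ] E)) where
  carrier := {p | ∃ hT : IsBandOperator R (W.conjStarAlgEquiv p.2), hT.IsFamily p.1}
  add_mem' {p q} := by
    rintro ⟨hT, hA⟩ ⟨hS, hB⟩
    rw [Set.mem_ofPred_eq, Prod.snd_add, map_add]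
    exact ⟨hT.add hS, hA.add hB⟩
  zero_mem' := by
    rw [Set.mem_ofPred_eq, Prod.snd_zero, map_zero]
    exact ⟨IsBandOperator.zero, IsBandOperator.isFamily_zero⟩
  mul_mem' {p q} := by
    rintro ⟨hT, hA⟩ ⟨hS, hB⟩
    rw [Set.mem_ofPred_eq, Prod.snd_mul, map_mul]
    exact ⟨hT.mul hX hS, hA.mul hX hfree hB⟩
  smul_mem' c p := by
    rintro ⟨hT, hA⟩
    rw [Set.mem_ofPred_eq, Prod.smul_snd, map_smul]
    exact ⟨hT.smul c, hA.smul c⟩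
  star_mem' {p} := by
    rintro ⟨hT, hA⟩
    rw [Set.mem_ofPred_eq, Prod.snd_star, map_star]
    exact ⟨hT.star, hA.star hX hfree⟩

theorem existsUnique_isCanonical (hX : BoundedGeometry X)
    (hfree : ∀ (x : X) (γ : Γ), MulOpposite.op γ • x = x → γ = 1) (hW : IsModuleIso ρ u R W) :
    ∃! Φ : reducedCrossedProduct X R ≃⋆ₐ[ℂ] roeAlgebra ρ u, IsCanonical W Φ := by
  -- The first coordinates of the correspondence are exactly the generators of the crossed product.
  have hs : Prod.fst '' (bandCorrespondence hX hfree R W : Set (RegularFamilies X R × (E →L[ℂ] E))) =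
      {A | ∃ k, IsCompactlySupportedSection R k ∧ IsRegularRep k A} := by
    ext A
    constructor
    · rintro ⟨⟨A, T⟩, ⟨hT, hA⟩, rfl⟩
      obtain ⟨k, hk, hkT⟩ := hT.exists_section hX hfree
      exact ⟨k, hk, hkT.isRegularRep hX hfree hA⟩
    · rintro ⟨k, hk, hkA⟩
      obtain ⟨T, hT, hkT⟩ := hk.exists_isBandOperator hX
      obtain ⟨B, hB, -⟩ := hT.exists_isFamily hX hfree
      have hAB : A = B := hkA.unique (hkT.isRegularRep hX hfree hB)
      refine ⟨(A, W.conjStarAlgEquiv.symm T), ?_, rfl⟩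
      change ∃ hT : IsBandOperator R (W.conjStarAlgEquiv (W.conjStarAlgEquiv.symm T)), hT.IsFamily A
      rw [StarAlgEquiv.apply_symm_apply, hAB]
      exact ⟨hT, hB⟩
  have ht : Prod.snd '' (bandCorrespondence hX hfree R W : Set (RegularFamilies X R × (E →L[ℂ] E))) =
      {T | IsRoeOperator ρ u T} := by
    ext T
    rw [Set.mem_ofPred_eq, ← hW.isRoeOperator_conj_iff, isRoeOperator_iff hX]
    constructor
    · rintro ⟨⟨A, T⟩, ⟨hT, hA⟩, rfl⟩
      exact hT
    · intro hT
      obtain ⟨A, hA, -⟩ := hT.exists_isFamily hX hfree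
      exact ⟨(A, T), ⟨hT, hA⟩, rfl⟩
  obtain ⟨Φ, hΦ⟩ := exists_starAlgEquiv_of_correspondence (bandCorrespondence hX hfree R W) (by
    rintro ⟨A, T⟩ ⟨hT, hA⟩
    obtain ⟨B, hB, hBT⟩ := hT.exists_isFamily hX hfree
    have h1 : ‖W.conjStarAlgEquiv T‖ = ‖T‖ := norm_conj T
    rw [hB.unique hA, h1] at hBT
    have h2 := norm_le_of_isFamily hX hfree hA
    rw [h1] at h2
    exact le_antisymm hBT h2) hs ht
  refine ⟨Φ, fun k hk => ?_, fun Ψ hΨ => ?_⟩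
  · obtain ⟨T, hT, hkT⟩ := hk.exists_isBandOperator hX
    obtain ⟨A, hA, -⟩ := hT.exists_isFamily hX hfree
    have hkA := hkT.isRegularRep hX hfree hA
    have hmem : A ∈ reducedCrossedProduct X R :=
      NonUnitalStarSubalgebra.le_topologicalClosure _
        (NonUnitalStarAlgebra.subset_adjoin ℂ _ ⟨k, hk, hkA⟩)
    refine ⟨⟨A, hmem⟩, hkA, ?_⟩
    have h1 : (Φ ⟨A, hmem⟩).1 = W.conjStarAlgEquiv.symm T := by
      refine hΦ (A, W.conjStarAlgEquiv.symm T) ?_ hmem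
      change ∃ hT : IsBandOperator R (W.conjStarAlgEquiv (W.conjStarAlgEquiv.symm T)), hT.IsFamily A
      rw [StarAlgEquiv.apply_symm_apply]
      exact ⟨hT, hA⟩
    change HasKernel k (W.conjStarAlgEquiv (Φ ⟨A, hmem⟩).1)
    rw [h1, StarAlgEquiv.apply_symm_apply]
    exact hkT.hasKernel
  -- On a generator π(k) the values of Ψ and Φ, carried over by W, both have the kernel of k and
  -- hence coincide.
  · refine starAlgEquiv_ext_of_adjoin (NonUnitalStarSubalgebra.isClosed_topologicalClosure _) ?_
    rintro A ⟨k, hk, hkA⟩ hmem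
    obtain ⟨B, hkB, hB⟩ := hΨ k hk
    obtain ⟨T, hT, hkT⟩ := hk.exists_isBandOperator hX
    have hBA : B = ⟨A, hmem⟩ := Subtype.ext (hkB.unique hkA)
    subst hBA
    obtain ⟨A', hA', -⟩ := hT.exists_isFamily hX hfree
    have hAA : A = A' := hkA.unique (hkT.isRegularRep hX hfree hA')
    subst hAA
    have h1 : (Φ ⟨A, hmem⟩).1 = W.conjStarAlgEquiv.symm T := by
      refine hΦ (A, W.conjStarAlgEquiv.symm T) ?_ hmem
      change ∃ hT : IsBandOperator R (W.conjStarAlgEquiv (W.conjStarAlgEquiv.symm T)), hT.IsFamily A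
      rw [StarAlgEquiv.apply_symm_apply]
      exact ⟨hT, hA'⟩
    have h2 : W.conjStarAlgEquiv (Ψ ⟨A, hmem⟩).1 = T := HasKernel.unique hB hkT.hasKernel
    have h3 : (Ψ ⟨A, hmem⟩).1 = W.conjStarAlgEquiv.symm T := by
      rw [← h2, StarAlgEquiv.symm_apply_apply]
    exact Subtype.ext (h3.trans h1.symm)

end Correspondence

end

section

open HilbertSum

/-! ### Separable infinite-dimensional Hilbert spaces. -/

section SeparableHilbertSpaces

variable {E F : Type*} [NormedAddCommGroup E] [InnerProductSpace ℂ E] [CompleteSpace E]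
  [NormedAddCommGroup F] [InnerProductSpace ℂ F] [CompleteSpace F]

/-- Distinct orthonormal vectors are at distance √2 ≥ 1, so they form a discrete subspace of a
second countable space. -/
theorem countable_of_orthonormal [TopologicalSpace.SeparableSpace E] {ι : Type*} {v : ι → E}
    (hv : Orthonormal ℂ v) : Countable ι := by
  have hdist : ∀ i j, i ≠ j → 1 ≤ dist (v i) (v j) := fun i j hij => by
    have h1 := norm_sub_sq (𝕜 := ℂ) (v i) (v j)
    rw [hv.2 hij, hv.1 i, hv.1 j] at h1
    rw [dist_eq_norm]
    norm_num at h1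
    nlinarith [norm_nonneg (v i - v j)]
  have : SecondCountableTopology E := UniformSpace.secondCountable_of_separable E
  have hd : DiscreteTopology (Set.range v) :=
    DiscreteTopology.of_forall_le_dist zero_lt_one fun a b hab => by
      obtain ⟨_, i, rfl⟩ := a
      obtain ⟨_, j, rfl⟩ := b
      exact hdist i j fun h => hab (by subst h; rfl)
  have hc : Countable (Set.range v) := countable_of_Lindelof_of_discrete
  exact (Set.rangeFactorization_injective.2 hv.linearIndependent.injective).countable

/-- An infinite-dimensional separable Hilbert space has a Hilbert basis indexed by `ℕ`. -/
theorem nonempty_hilbertBasis_nat [TopologicalSpace.SeparableSpace E]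
    (hE : ¬ FiniteDimensional ℂ E) : Nonempty (HilbertBasis ℕ ℂ E) := by
  obtain ⟨w, b, -⟩ := exists_hilbertBasis ℂ E
  have hc : Countable w := countable_of_orthonormal b.orthonormal
  have hi : Infinite w := by
    by_contra h
    rw [not_infinite_iff_finite] at h
    have := Fintype.ofFinite w
    exact hE b.toOrthonormalBasis.toBasis.finiteDimensional_of_finite
  obtain ⟨e⟩ := nonempty_equiv_of_countable (α := ℕ) (β := w)
  refine ⟨HilbertBasis.mk (b.orthonormal.comp e e.injective) ?_⟩
  rw [e.surjective.range_comp, b.dense_span]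

theorem nonempty_linearIsometryEquiv [TopologicalSpace.SeparableSpace E]
    [TopologicalSpace.SeparableSpace F] (hE : ¬ FiniteDimensional ℂ E)
    (hF : ¬ FiniteDimensional ℂ F) : Nonempty (E ≃ₗᵢ[ℂ] F) := by
  obtain ⟨b⟩ := nonempty_hilbertBasis_nat hE
  obtain ⟨c⟩ := nonempty_hilbertBasis_nat hF
  exact ⟨b.repr.trans c.repr.symm⟩

theorem separableSpace_hilbertSum (ι : Type*) [Countable ι] [TopologicalSpace.SeparableSpace F] :
    TopologicalSpace.SeparableSpace (HilbertSum ι F) := by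
  have h1 : TopologicalSpace.IsSeparable (⋃ i : ι, Set.range (single (F := F) i)) :=
    TopologicalSpace.IsSeparable.iUnion fun i =>
      TopologicalSpace.isSeparable_range (single (F := F) i).continuous
  have h2 := (h1.span (R := ℂ)).closure
  rw [← TopologicalSpace.isSeparable_univ_iff]
  refine h2.mono fun ξ _ => mem_closure_of_tendsto (hasSum_single ξ) (Filter.Eventually.of_forall
    fun s => Submodule.sum_mem _ fun i _ => Submodule.subset_span (Set.mem_iUnion.2 ⟨i, ξ i, rfl⟩))

theorem not_finiteDimensional_hilbertSum (ι : Type*) [Nonempty ι]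
    (hF : ¬ FiniteDimensional ℂ F) : ¬ FiniteDimensional ℂ (HilbertSum ι F) := fun h => by
  obtain ⟨i⟩ := ‹Nonempty ι›
  refine hF (FiniteDimensional.of_injective (single (F := F) i).toLinearMap fun v w hvw => ?_)
  have := congrArg (fun ξ : HilbertSum ι F => ξ i) hvw
  simpa using this

theorem isCompactOperator_of_finiteDimensional_range (T : E →L[ℂ] F) (K : Submodule ℂ F)
    [FiniteDimensional ℂ K] (hT : ∀ v, T v ∈ K) : IsCompactOperator T := by
  have h1 : IsCompactOperator (T.codRestrict K hT) := by
    have : ProperSpace K := FiniteDimensional.proper ℂ K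
    refine ⟨Metric.closedBall 0 1, isCompact_closedBall 0 1, ?_⟩
    refine (T.codRestrict K hT).continuous.continuousAt.preimage_mem_nhds ?_
    rw [map_zero]
    exact Metric.closedBall_mem_nhds 0 one_pos
  exact h1.clm_comp K.subtypeL

end SeparableHilbertSpaces

/-! ### Ample modules are isomorphic to the standard one. -/

section AmpleModules

variable {Γ X F : Type*} [Group Γ] [MetricSpace X] [MulAction Γᵐᵒᵖ X]
  [NormedAddCommGroup F] [InnerProductSpace ℂ F] [CompleteSpace F]
  {R : Γ →* (F ≃ₗᵢ[ℂ] F)}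
  {E : Type*} [NormedAddCommGroup E] [InnerProductSpace ℂ E] [CompleteSpace E]
  {ρ : C₀(X, ℂ) →⋆ₙₐ[ℂ] (E →L[ℂ] E)} {u : Γ →* (E ≃ₗᵢ[ℂ] E)}

theorem mul_delta [DiscreteTopology X] (f : C₀(X, ℂ)) (x : X) : f * delta x = f x • delta x := by
  refine ZeroAtInftyContinuousMap.ext fun y => ?_
  change f y * delta x y = f x * delta x y
  by_cases h : y = x
  · rw [h]
  · rw [delta_apply_of_ne h, mul_zero, mul_zero]

theorem star_delta [DiscreteTopology X] (x : X) : star (delta x) = delta x := by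
  refine ZeroAtInftyContinuousMap.ext fun y => ?_
  change star (delta x y) = delta x y
  by_cases h : y = x
  · rw [h, delta_apply_self, star_one]
  · rw [delta_apply_of_ne h, star_zero]

theorem rep_apply_rep_delta [DiscreteTopology X] (ρ : C₀(X, ℂ) →⋆ₙₐ[ℂ] (E →L[ℂ] E))
    (f : C₀(X, ℂ)) (x : X) (v : E) : ρ f (ρ (delta x) v) = f x • ρ (delta x) v := by
  rw [← mul_apply_eq_comp, ← map_mul, mul_delta, map_smul]
  rfl

theorem rep_delta_idem [DiscreteTopology X] (ρ : C₀(X, ℂ) →⋆ₙₐ[ℂ] (E →L[ℂ] E)) (x : X) (v : E) :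
    ρ (delta x) (ρ (delta x) v) = ρ (delta x) v := by
  rw [rep_apply_rep_delta, delta_apply_self, one_smul]

theorem inner_rep_delta_of_ne [DiscreteTopology X] (ρ : C₀(X, ℂ) →⋆ₙₐ[ℂ] (E →L[ℂ] E)) {x y : X}
    (h : x ≠ y) (v w : E) : inner ℂ (ρ (delta x) v) (ρ (delta y) w) = 0 := by
  have h1 : star (ρ (delta x)) = ρ (delta x) := by rw [← map_star, star_delta]
  rw [← h1, ContinuousLinearMap.star_eq_adjoint, ContinuousLinearMap.adjoint_inner_left,
    rep_apply_rep_delta, delta_apply_of_ne h.symm, zero_smul, inner_zero_right]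

namespace IsAmpleModule

theorem unitary_rep_delta [DiscreteTopology X] (h : IsAmpleModule ρ u) (γ : Γ) (x : X) (v : E) :
    u γ (ρ (delta (MulOpposite.op γ • x)) v) = ρ (delta x) (u γ v) := by
  have h1 := h.covariant γ (delta (MulOpposite.op γ • x)) (delta x) (fun y => by
    by_cases hy : y = x
    · rw [hy, delta_apply_self, delta_apply_self]
    · rw [delta_apply_of_ne hy, delta_apply_of_ne fun h => hy (smul_left_cancel _ h)]) (u γ v)
  rwa [LinearIsometryEquiv.symm_apply_apply] at h1

/-- Were the range of the projection ρ(δ_x) finite-dimensional, the projection would be compact,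
against ampleness. The range is thus isometric to F. -/
theorem exists_linearIsometry [DiscreteTopology X] [TopologicalSpace.SeparableSpace F]
    (h : IsAmpleModule ρ u) (hF : ¬ FiniteDimensional ℂ F) (x : X) :
    ∃ V : F →ₗᵢ[ℂ] E, (∀ v, ρ (delta x) (V v) = V v) ∧ ∀ v, ∃ w, V w = ρ (delta x) v := by
  let K : Submodule ℂ E := LinearMap.eqLocus (ρ (delta x)).toLinearMap LinearMap.id
  have hK : ∀ v, v ∈ K ↔ ρ (delta x) v = v := fun v => Iff.rfl
  have hclosed : IsClosed (K : Set E) := isClosed_eq (ρ (delta x)).continuous continuous_id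
  have : CompleteSpace K := hclosed.completeSpace_coe
  have := h.separable
  have : SecondCountableTopology E := UniformSpace.secondCountable_of_separable E
  have hfin : ¬ FiniteDimensional ℂ K := fun hfin => by
    refine h.ample (delta x) (fun h0 => ?_)
      (isCompactOperator_of_finiteDimensional_range _ K (rep_delta_idem ρ x))
    have := delta_apply_self x
    rw [h0] at this
    exact zero_ne_one this
  obtain ⟨e⟩ := nonempty_linearIsometryEquiv hF hfin
  refine ⟨K.subtypeₗᵢ.comp e.toLinearIsometry, fun v => (e v).2, fun v => ?_⟩
  refine ⟨e.symm ⟨ρ (delta x) v, rep_delta_idem ρ x v⟩, ?_⟩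
  change (e (e.symm _)).1 = _
  rw [LinearIsometryEquiv.apply_symm_apply]

/-- The isometries V₀ are kept only at orbit representatives and moved to x by u_τ* V₀ R_τ, with τ =
τ(x) carrying the representative to x. Freeness gives τ(xγ) = τ(x)γ, which is what equivariance
needs. -/
theorem exists_equivariant_linearIsometry [DiscreteTopology X] [TopologicalSpace.SeparableSpace F]
    (h : IsAmpleModule ρ u) (hfree : ∀ (x : X) (γ : Γ), MulOpposite.op γ • x = x → γ = 1)
    (hF : ¬ FiniteDimensional ℂ F) (R : Γ →* (F ≃ₗᵢ[ℂ] F)) :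
    ∃ V : X → F →ₗᵢ[ℂ] E, (∀ x v, ρ (delta x) (V x v) = V x v) ∧
      (∀ x v, ∃ w, V x w = ρ (delta x) v) ∧
      ∀ γ x v, u γ (V (MulOpposite.op γ • x) v) = V x (R γ v) := by
  choose V₀ hV₀ hV₀' using h.exists_linearIsometry hF
  have hσ : ∀ x : X, ∃ γ : Γ, MulOpposite.op γ • (orbit Γ x).out = x := fun x => by
    obtain ⟨γ, hγ⟩ := exists_smul_eq_of_orbit_eq (Quotient.out_eq' (orbit Γ x)).symm
    exact ⟨γ.unop, hγ⟩
  choose τ hτ using hσ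
  have hτ' : ∀ (γ : Γ) x, τ (MulOpposite.op γ • x) = τ x * γ := fun γ x => by
    have h1 := hτ (MulOpposite.op γ • x)
    rw [orbit_smul] at h1
    have h2 : MulOpposite.op (τ x * γ) • (orbit Γ x).out = MulOpposite.op γ • x := by
      rw [MulOpposite.op_mul, mul_smul, hτ]
    replace h1 := h1.trans h2.symm
    rw [← inv_smul_eq_iff, ← mul_smul, ← MulOpposite.op_inv, ← MulOpposite.op_mul] at h1
    exact mul_inv_eq_one.1 (hfree _ _ h1)
  have hP : ∀ x v, ρ (delta x) ((u (τ x)).symm v) =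
      (u (τ x)).symm (ρ (delta (orbit Γ x).out) v) := fun x v => by
    have h1 := h.unitary_rep_delta (τ x) (orbit Γ x).out ((u (τ x)).symm v)
    rw [hτ, LinearIsometryEquiv.apply_symm_apply] at h1
    rw [← h1, LinearIsometryEquiv.symm_apply_apply]
  refine ⟨fun x => ((u (τ x)).symm.toLinearIsometry.comp (V₀ (orbit Γ x).out)).comp
    (R (τ x)).toLinearIsometry, fun x v => ?_, fun x v => ?_, fun γ x v => ?_⟩
  · exact (hP x _).trans (congrArg _ (hV₀ _ _))
  · obtain ⟨w, hw⟩ := hV₀' (orbit Γ x).out (u (τ x) v)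
    refine ⟨(R (τ x)).symm w, ?_⟩
    change (u (τ x)).symm (V₀ (orbit Γ x).out (R (τ x) ((R (τ x)).symm w))) = _
    rw [LinearIsometryEquiv.apply_symm_apply, hw, ← hP, LinearIsometryEquiv.symm_apply_apply]
  · change u γ ((u (τ (MulOpposite.op γ • x))).symm (V₀ (orbit Γ (MulOpposite.op γ • x)).out
      (R (τ (MulOpposite.op γ • x)) v))) = (u (τ x)).symm (V₀ (orbit Γ x).out (R (τ x) (R γ v)))
    rw [hτ', orbit_smul, map_mul R, map_mul u, LinearIsometryEquiv.eq_symm_apply]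
    exact LinearIsometryEquiv.apply_symm_apply (u (τ x) * u γ) _

/-- An equivariant ample `X`-module is isomorphic to the standard one. -/
theorem exists_isModuleIso [TopologicalSpace.SeparableSpace F] (hX : BoundedGeometry X)
    (hfree : ∀ (x : X) (γ : Γ), MulOpposite.op γ • x = x → γ = 1)
    (h : IsAmpleModule ρ u) (hF : ¬ FiniteDimensional ℂ F) (R : Γ →* (F ≃ₗᵢ[ℂ] F)) :
    ∃ W : E ≃ₗᵢ[ℂ] HilbertSum X F, IsModuleIso ρ u R W := by
  classical
  have := hX.discreteTopology
  obtain ⟨V, hV, hV', hVu⟩ := h.exists_equivariant_linearIsometry hfree hF R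
  have hortho : OrthogonalFamily ℂ (fun _ : X => F) V := fun x y hxy v w => by
    rw [← hV x, ← hV y]
    exact inner_rep_delta_of_ne ρ hxy _ _
  -- Finitely supported functions are dense in C₀(X), so nondegeneracy of ρ makes the ranges of the
  -- V_x span a dense subspace.
  have hrange : ∀ f v, ρ f v ∈ (⨆ x, LinearMap.range (V x).toLinearMap).topologicalClosure :=
    fun f v => by
      refine Metric.mem_closure_iff.2 fun ε hε => ?_
      obtain ⟨s, hs⟩ := exists_norm_sub_sum_delta_le f (ε := ε / (2 * (‖v‖ + 1))) (by positivity)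
      refine ⟨ρ (∑ x ∈ s, f x • delta x) v, ?_, ?_⟩
      · rw [map_sum, sum_apply]
        refine Submodule.sum_mem _ fun x _ => ?_
        rw [map_smul]
        obtain ⟨w, hw⟩ := hV' x v
        exact Submodule.smul_mem _ _ (Submodule.mem_iSup_of_mem x ⟨w, hw⟩)
      · rw [dist_eq_norm, ← sub_apply, ← map_sub]
        calc _ ≤ ‖ρ (f - ∑ x ∈ s, f x • delta x)‖ * ‖v‖ := ContinuousLinearMap.le_opNorm _ _
          _ ≤ ε / (2 * (‖v‖ + 1)) * (‖v‖ + 1) := by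
            gcongr
            · exact (NonUnitalStarAlgHom.norm_apply_le ρ _).trans hs
            · linarith
          _ < ε := by
            field_simp
            linarith
  have htotal : ⊤ ≤ (⨆ x, LinearMap.range (V x).toLinearMap).topologicalClosure := by
    rw [← Submodule.dense_iff_topologicalClosure_eq_top.1 h.nondegenerate]
    refine Submodule.topologicalClosure_minimal _ (Submodule.span_le.2 ?_)
      (Submodule.isClosed_topologicalClosure _)
    rintro _ ⟨f, v, rfl⟩
    exact hrange f v
  have hsum := IsHilbertSum.mk hortho htotal
  let W : E ≃ₗᵢ[ℂ] HilbertSum X F := hsum.linearIsometryEquiv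
  have hW : ∀ x v, W.symm (single x v) = V x v := fun x v =>
    hsum.linearIsometryEquiv_symm_apply_single v
  have hext : ∀ {A B : HilbertSum X F →L[ℂ] E}, (∀ x v, A (single x v) = B (single x v)) →
      A = B := fun {A B} hAB => ContinuousLinearMap.ext fun ξ => by
    have h1 := A.hasSum (hasSum_single ξ)
    have h2 := B.hasSum (hasSum_single ξ)
    simp only [hAB] at h1
    exact h1.unique h2
  let W' : HilbertSum X F →L[ℂ] E := W.symm.toContinuousLinearEquiv.toContinuousLinearMap
  refine ⟨W, fun f v => ?_, fun γ v => ?_⟩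
  · have h1 : ρ f ∘L W' = W' ∘L mulRep (ι := X) (E := F) f := hext fun x v => by
      change ρ f (W.symm (single x v)) = W.symm (mulRep (ι := X) (E := F) f (single x v))
      rw [mulRep_single, map_smul, hW, ← hV, rep_apply_rep_delta]
    have h2 := DFunLike.congr_fun h1 (W v)
    change ρ f (W.symm (W v)) = W.symm _ at h2
    rw [LinearIsometryEquiv.symm_apply_apply] at h2
    rw [h2]
    exact W.apply_symm_apply _
  -- The inverse representation is compared because it sends `single` vectors to `single` vectors by
  -- a ready formula.
  · have h1 : W' ∘L (diagonalRep X R γ).symm.toContinuousLinearEquiv.toContinuousLinearMap =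
        (u γ).symm.toContinuousLinearEquiv.toContinuousLinearMap ∘L W' := hext fun x v => by
      change W.symm ((diagonalRep X R γ).symm (single x v)) = (u γ).symm (W.symm (single x v))
      rw [diagonalRep_symm_single, hW, hW, LinearIsometryEquiv.eq_symm_apply, hVu,
        LinearIsometryEquiv.apply_symm_apply]
    have h2 := DFunLike.congr_fun h1 (diagonalRep X R γ (W v))
    change W.symm ((diagonalRep X R γ).symm (diagonalRep X R γ (W v))) =
      (u γ).symm (W.symm (diagonalRep X R γ (W v))) at h2
    rw [LinearIsometryEquiv.symm_apply_apply, LinearIsometryEquiv.symm_apply_apply,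
      LinearIsometryEquiv.eq_symm_apply] at h2
    rw [h2]
    exact W.apply_symm_apply _

end IsAmpleModule

end AmpleModules

end

end EquivariantCoarse

theorem mainTheorem7 {X Γ H : Type*} [MetricSpace X] [Group Γ] [Countable Γ]
    [MulAction Γᵐᵒᵖ X] [IsIsometricSMul Γᵐᵒᵖ X]
    [NormedAddCommGroup H] [InnerProductSpace ℂ H] [CompleteSpace H]
    [TopologicalSpace.SeparableSpace H] (hH : ¬ FiniteDimensional ℂ H)
    (hX : BoundedGeometry X)
    (hfree : ∀ (x : X) (γ : Γ), MulOpposite.op γ • x = x → γ = 1)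
    (hproper : ∀ (x : X) (r : ℝ), {γ : Γ | dist (MulOpposite.op γ • x) x ≤ r}.Finite) :
    (∃! Φ : reducedCrossedProduct X (rightRegular Γ H) ≃⋆ₐ[ℂ]
        roeAlgebra HilbertSum.mulRep (diagonalRep X (rightRegular Γ H)),
      IsCanonical (LinearIsometryEquiv.refl ℂ (HilbertSum X (HilbertSum Γ H))) Φ) ∧
    ∀ {E : Type*} [NormedAddCommGroup E] [InnerProductSpace ℂ E] [CompleteSpace E]
      (ρ : C₀(X, ℂ) →⋆ₙₐ[ℂ] (E →L[ℂ] E)) (u : Γ →* (E ≃ₗᵢ[ℂ] E)), IsAmpleModule ρ u →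
      (∃ W : E ≃ₗᵢ[ℂ] HilbertSum X (HilbertSum Γ H), IsModuleIso ρ u (rightRegular Γ H) W) ∧
      ∀ W : E ≃ₗᵢ[ℂ] HilbertSum X (HilbertSum Γ H), IsModuleIso ρ u (rightRegular Γ H) W →
        ∃! Φ : reducedCrossedProduct X (rightRegular Γ H) ≃⋆ₐ[ℂ] roeAlgebra ρ u,
          IsCanonical W Φ := by
  have hR : IsModuleIso HilbertSum.mulRep (diagonalRep X (rightRegular Γ H)) (rightRegular Γ H)
      (LinearIsometryEquiv.refl ℂ (HilbertSum X (HilbertSum Γ H))) :=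
    ⟨fun _ _ => rfl, fun _ _ => rfl⟩
  -- Countability of Γ enters here: ℓ²(Γ) ⊗ H has to be separable to be identified with the ranges
  -- of the ρ(δ_x).
  have := separableSpace_hilbertSum (F := H) Γ
  exact ⟨existsUnique_isCanonical hX hfree hR, fun ρ u h =>
    ⟨h.exists_isModuleIso hX hfree (not_finiteDimensional_hilbertSum Γ hH) _,
      fun W hW => existsUnique_isCanonical hX hfree hW⟩⟩
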